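/- Let $k$ be a field, $Q$ a quiver (not necessarily finite), and $\rho$ a set of paths of length $\ge 2$ in $Q$, such that $\Lambda=kQ/(\rho)$ is a string algebra: every vertex is the head of at most two arrows and the tail of at most two arrows, and for every arrow $y$ there is at most one path $xy$ of length $2$ with $xy\notin\rho$ and at most one path $yz$ of length $2$ with $yz\notin\rho$. (Paths are composed like functions: in $xy$ the tail of $x$ is the head of $y$.) Modules are left $\Lambda$-modules $M$ with $\Lambda M=M$; $e_v$ is the trivial path at the vertex $v$. A module $M$ is *finitely generated* if $M=\Lambda m_1+\dots+\Lambda m_n$ for some $m_1,\dots,m_n\in M$, *finitely controlled* if for every $a\in\Lambda$ the set $aM$ is contained in a finitely generated submodule, *supported at* $v$ if $e_vM\ne0$, and *indecomposable* if it is nonzero and not the direct sum of two nonzero submodules. *Words.* A letter is an arrow $x$ (direct) or its formal inverse $x^{-1}$ (inverse), where the head of $x^{-1}$ is the tail of $x$ and vice versa, and $(x^{-1})^{-1}=x$. Let $I$ be $\{0,\dots,n\}$ ($n\ge0$), $\mathbb N=\{0,1,2,\dots\}$, $-\mathbb N$ or $\mathbb Z$. For $I\ne\{0\}$ an $I$-word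 $C$ is a family of letters $C_i$, for all $i\in I$ with $i-1\in I$, such that for consecutive letters the tail of $C_i$ is the head of $C_{i+1}$ and $C_i^{-1}\ne C_{i+1}$, and such that no $x_1\cdots x_m\in\rho$ and no inverse $x_m^{-1}\cdots x_1^{-1}$ of such a path occurs as a sequence of consecutive letters in $C$. The $\{0\}$-words are the trivial words $1_{v,\epsilon}$ with $v$ a vertex and $\epsilon=\pm1$. For $i\in I$, the vertex $v_i(C)$ is the tail of $C_i$ or the head of $C_{i+1}$, or $v$ for $1_{v,\epsilon}$. The inverse $C^{-1}$ is obtained by inverting the letters and reversing their order, with $(C^{-1})_i=(C_{1-i})^{-1}$ for a $\mathbb Z$-word and $(1_{v,\epsilon})^{-1}=1_{v,-\epsilon}$. For a $\mathbb Z$-word, $C[n]$ is the word with $C[n]_i=C_{n+i}$; for all other words $C[n]=C$. Write $C\sim D$ if $D=C[n]$ or $D=(C^{-1})[n]$ for some $n\in\mathbb Z$. A $\mathbb Z$-word is periodic if $C=C[n]$ for some $n>0$; the least such $n$ is its period. A word $C$ is *eventually inverse* if only finitely many $C_i$ with $i>0$ are direct, and *vertex-finite* if for every vertex $v$ there are only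 finitely many $i>0$ in $I$ with $v_i(C)=v$. *String and band modules.* The string module $M(C)$ has $k$-basis $b_i$ ($i\in I$), where $e_vb_i$ is $b_i$ if $v_i(C)=v$ and $0$ otherwise, and, for an arrow $x$, $xb_i$ is $b_{i-1}$ if $C_i=x$, is $b_{i+1}$ if $C_{i+1}=x^{-1}$, and is $0$ otherwise. If $C$ is periodic of period $n$, then $M(C)$ is also a $k[T,T^{-1}]$-module, with $Tb_i=b_{i-n}$. A band module is a module $M(C,V)=M(C)\otimes_{k[T,T^{-1}]}V$ with $C$ a periodic $\mathbb Z$-word and $V$ a finite-dimensional indecomposable $k[T,T^{-1}]$-module. Let $V^{-1}$ be $V$ with the actions of $T$ and $T^{-1}$ exchanged. **Theorem.** (i) All string modules and all band modules are indecomposable. (ii) (a) $M(C)\cong M(D)$ if and only if $C\sim D$. (b) For band modules, $M(C,V)\cong M(D,U)$ if and only if either $D=C[n]$ for some $n$ and $U\cong V$, or $D=(C^{-1})[n]$ for some $n$ and $U\cong V^{-1}$. (c) No string module is isomorphic to a band module. (iii) A string module $M(C)$ is finitely generated if and only if both $C$ and $C^{-1}$ are eventually inverse. It is finitely controlled if and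 only if each of $C$ and $C^{-1}$ is eventually inverse or vertex-finite. (iv) A direct sum of a family of string and band modules is finitely generated if and only if all string modules among the summands are finitely generated and the family is finite. It is finitely controlled if and only if all string modules among the summands are finitely controlled and, for every vertex $v$, only finitely many summands are supported at $v$. -/

import Mathlib

open scoped TensorProduct LaurentPolynomial DirectSum

/-! ## Path algebras of (possibly infinite) quivers -/

section PathAlgebra

/-- The paths of the quiver `Q`, of arbitrary length and with arbitrary end points. -/
abbrev QPath (Q : Type*) [Quiver Q] := Σ a b : Q, Quiver.Path a b

/-- The path algebra `kQ`: the vector space with basis the paths of `Q`. -/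
def PathAlgebra (k Q : Type*) [Field k] [Quiver Q] := QPath Q →₀ k

namespace PathAlgebra

variable {k Q : Type*} [Field k] [Quiver Q]

noncomputable instance : AddCommGroup (PathAlgebra k Q) :=
  inferInstanceAs (AddCommGroup (QPath Q →₀ k))

noncomputable instance : Module k (PathAlgebra k Q) :=
  inferInstanceAs (Module k (QPath Q →₀ k))

/-- The basis element of `kQ` given by a path. -/
noncomputable def ofPath (p : QPath Q) : PathAlgebra k Q := Finsupp.single p (1 : k)

open Classical in
/-- The product `p q` of two paths: first `q`, then `p` (as for functions), and zero if `q` does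
not end where `p` starts. -/
noncomputable def pathMul (p q : QPath Q) : PathAlgebra k Q :=
  if h : q.2.1 = p.1 then ofPath ⟨q.1, p.2.1, (h ▸ q.2.2 : Quiver.Path q.1 p.1).comp p.2.2⟩ else 0

/-- The linear map with given values on the paths. -/
noncomputable def linExt {M : Type*} [AddCommGroup M] [Module k M] (f : QPath Q → M) :
    PathAlgebra k Q →ₗ[k] M :=
  Finsupp.linearCombination k f

theorem linExt_ofPath {M : Type*} [AddCommGroup M] [Module k M] (f : QPath Q → M) (p : QPath Q) :
    linExt (k := k) f (ofPath p) = f p :=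
  (Finsupp.linearCombination_single k (1 : k) p).trans (one_smul k (f p))

/-- The bilinear extension of the product of paths. -/
noncomputable def mulLin : PathAlgebra k Q →ₗ[k] PathAlgebra k Q →ₗ[k] PathAlgebra k Q :=
  linExt fun p => linExt fun q => pathMul p q

noncomputable instance : Mul (PathAlgebra k Q) := ⟨fun f g => mulLin f g⟩

theorem mul_def (f g : PathAlgebra k Q) : f * g = mulLin f g := rfl

theorem ofPath_mul_ofPath (p q : QPath Q) :
    (ofPath p * ofPath q : PathAlgebra k Q) = pathMul p q := by
  rw [mul_def, mulLin, linExt_ofPath, linExt_ofPath]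

theorem pathMul_comp {a b c : Q} (p : Quiver.Path b c) (q : Quiver.Path a b) :
    (pathMul ⟨b, c, p⟩ ⟨a, b, q⟩ : PathAlgebra k Q) = ofPath ⟨a, c, q.comp p⟩ := by
  simp [pathMul]

theorem pathMul_eq_zero {a b c d : Q} (p : Quiver.Path c d) (q : Quiver.Path a b) (h : b ≠ c) :
    (pathMul ⟨c, d, p⟩ ⟨a, b, q⟩ : PathAlgebra k Q) = 0 := by
  simp [pathMul, h]

/-- Linear maps out of `kQ` agree if they agree on paths. -/
theorem hom_ext {M : Type*} [AddCommGroup M] [Module k M] {f g : PathAlgebra k Q →ₗ[k] M}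
    (h : ∀ p, f (ofPath p) = g (ofPath p)) : f = g :=
  Finsupp.lhom_ext' fun p => LinearMap.ext_ring (h p)

theorem mulLin_ofPath (p q : QPath Q) :
    mulLin (ofPath p) (ofPath q) = (pathMul p q : PathAlgebra k Q) :=
  ofPath_mul_ofPath p q

theorem mul_assoc_ofPath (p q r : QPath Q) :
    (ofPath p * ofPath q * ofPath r : PathAlgebra k Q) = ofPath p * (ofPath q * ofPath r) := by
  obtain ⟨e, f, p⟩ := p
  obtain ⟨c, d, q⟩ := q
  obtain ⟨a, b, r⟩ := r
  rw [ofPath_mul_ofPath, ofPath_mul_ofPath]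
  by_cases h : d = e
  · subst h
    rw [pathMul_comp, ofPath_mul_ofPath]
    by_cases h' : b = c
    · subst h'
      rw [pathMul_comp, pathMul_comp, ofPath_mul_ofPath, pathMul_comp, Quiver.Path.comp_assoc]
    · rw [pathMul_eq_zero _ _ h', pathMul_eq_zero _ _ h', mul_def, map_zero]
  · rw [pathMul_eq_zero _ _ h, mul_def, map_zero, LinearMap.zero_apply]
    by_cases h' : b = c
    · subst h'
      rw [pathMul_comp, ofPath_mul_ofPath, pathMul_eq_zero _ _ h]
    · rw [pathMul_eq_zero _ _ h', mul_def, map_zero]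

theorem mul_assoc_aux (f g h : PathAlgebra k Q) : f * g * h = f * (g * h) := by
  have key : (LinearMap.llcomp k _ _ _ (mulLin (k := k) (Q := Q))).comp mulLin
      = (LinearMap.llcomp k _ _ _).flip (mulLin (k := k) (Q := Q)) ∘ₗ
          (LinearMap.llcomp k (PathAlgebra k Q) (PathAlgebra k Q) (PathAlgebra k Q)) ∘ₗ
            mulLin := by
    refine hom_ext fun p => hom_ext fun q => hom_ext fun r => ?_
    exact mul_assoc_ofPath p q r
  exact LinearMap.congr_fun (LinearMap.congr_fun (LinearMap.congr_fun key f) g) h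

noncomputable instance : NonUnitalRing (PathAlgebra k Q) :=
  { (inferInstance : AddCommGroup (PathAlgebra k Q)),
    (inferInstance : Mul (PathAlgebra k Q)) with
    left_distrib := fun f g h => map_add (mulLin f) g h
    right_distrib := fun f g h => by
      change mulLin (f + g) h = mulLin f h + mulLin g h
      rw [map_add, LinearMap.add_apply]
    zero_mul := fun f => by
      change mulLin 0 f = 0
      rw [map_zero, LinearMap.zero_apply]
    mul_zero := fun f => map_zero (mulLin f)
    mul_assoc := mul_assoc_aux }

instance : IsScalarTower k (PathAlgebra k Q) (PathAlgebra k Q) :=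
  ⟨fun c f g => by
    change mulLin (c • f) g = c • mulLin f g
    rw [map_smul, LinearMap.smul_apply]⟩

instance : SMulCommClass k (PathAlgebra k Q) (PathAlgebra k Q) :=
  ⟨fun c f g => (map_smul (mulLin f) c g).symm⟩

/-- The operator by which a path acts, if `e v` is the action of the trivial path at `v` and
`X x` that of the arrow `x`. -/
def pathOp {B : Type*} [Mul B] (e : Q → B) (X : Quiver.Total Q → B) {a : Q} :
    {b : Q} → Quiver.Path a b → B
  | _, .nil => e a
  | _, .cons p x => X ⟨_, _, x⟩ * pathOp e X p

section lift

variable {B : Type*} [Ring B] [Algebra k B] (e : Q → B) (X : Quiver.Total Q → B)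

theorem mul_pathOp (he : ∀ v, e v * e v = e v) (hX : ∀ x, e x.right * X x = X x) {a b : Q}
    (p : Quiver.Path a b) : e b * pathOp e X p = pathOp e X p := by
  cases p with
  | nil => exact he a
  | cons p x => rw [pathOp, ← mul_assoc, hX ⟨_, _, x⟩]

theorem pathOp_mul (he : ∀ v, e v * e v = e v) {a b : Q}
    (p : Quiver.Path a b) : pathOp e X p * e a = pathOp e X p := by
  induction p with
  | nil => exact he a
  | cons p x ih => rw [pathOp, mul_assoc, ih]

theorem pathOp_comp (he : ∀ v, e v * e v = e v) (hX : ∀ x, e x.right * X x = X x) {a b c : Q}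
    (p : Quiver.Path b c) (q : Quiver.Path a b) :
    pathOp e X (q.comp p) = pathOp e X p * pathOp e X q := by
  induction p with
  | nil => exact (mul_pathOp e X he hX q).symm
  | cons p x ih => rw [Quiver.Path.comp_cons, pathOp, pathOp, ih, mul_assoc]

/-- The homomorphism from `kQ` given by orthogonal idempotents `e v` for the vertices and elements
`X x` for the arrows. -/
noncomputable def lift (he : ∀ v, e v * e v = e v) (hne : ∀ v w, v ≠ w → e v * e w = 0)
    (hX : ∀ x, e x.right * X x = X x) : PathAlgebra k Q →ₙₐ[k] B :=
  let L : PathAlgebra k Q →ₗ[k] B := linExt fun p => pathOp e X p.2.2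
  { L with
    map_zero' := map_zero L
    map_mul' := by
      have hL : ∀ p : QPath Q, L (ofPath p) = pathOp e X p.2.2 := fun p =>
        linExt_ofPath _ p
      have key : (LinearMap.llcomp k _ _ _ L).comp mulLin
          = (LinearMap.llcomp k _ _ _).flip L ∘ₗ (LinearMap.mul k B) ∘ₗ L := by
        refine hom_ext fun p => hom_ext fun q => ?_
        obtain ⟨c, d, p⟩ := p
        obtain ⟨a, b, q⟩ := q
        change L (mulLin (ofPath _) (ofPath _)) = L (ofPath _) * L (ofPath _)
        rw [mulLin_ofPath, hL, hL]
        by_cases h : b = c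
        · subst h
          rw [pathMul_comp, hL, pathOp_comp e X he hX]
        · rw [pathMul_eq_zero _ _ h, map_zero, ← pathOp_mul e X he p,
            ← mul_pathOp e X he hX q, mul_assoc, ← mul_assoc (e c), hne c b (Ne.symm h),
            zero_mul, mul_zero]
      exact fun f g => LinearMap.congr_fun (LinearMap.congr_fun key f) g }

theorem lift_ofPath (he : ∀ v, e v * e v = e v) (hne : ∀ v w, v ≠ w → e v * e w = 0)
    (hX : ∀ x, e x.right * X x = X x) (p : QPath Q) :
    lift (k := k) e X he hne hX (ofPath p) = pathOp e X p.2.2 :=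
  linExt_ofPath (k := k) (fun p => pathOp e X p.2.2) p

end lift

end PathAlgebra

/-! ## The algebra `Λ = kQ/(ρ)` and its modules -/

variable (k : Type*) {Q : Type*} [Field k] [Quiver Q] (ρ : Set (QPath Q))

/-- The ideal `(ρ)` of `kQ` generated by the set of paths `ρ`. -/
noncomputable def relIdeal : Submodule k (PathAlgebra k Q) :=
  sInf {J | (∀ p ∈ ρ, PathAlgebra.ofPath p ∈ J) ∧ ∀ a, ∀ x ∈ J, a * x ∈ J ∧ x * a ∈ J}

variable {k ρ} in
theorem relIdeal_mul_left (a : PathAlgebra k Q) {x : PathAlgebra k Q} (hx : x ∈ relIdeal k ρ) :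
    a * x ∈ relIdeal k ρ := by
  rw [relIdeal, Submodule.mem_sInf] at hx ⊢
  exact fun J hJ => (hJ.2 a x (hx J hJ)).1

variable {k ρ} in
theorem relIdeal_mul_right (a : PathAlgebra k Q) {x : PathAlgebra k Q} (hx : x ∈ relIdeal k ρ) :
    x * a ∈ relIdeal k ρ := by
  rw [relIdeal, Submodule.mem_sInf] at hx ⊢
  exact fun J hJ => (hJ.2 a x (hx J hJ)).2

/-- The algebra `Λ = kQ/(ρ)`. It has a one only if `Q` has finitely many vertices. -/
def QuiverAlgebra := PathAlgebra k Q ⧸ relIdeal k ρ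

namespace QuiverAlgebra

noncomputable instance : AddCommGroup (QuiverAlgebra k ρ) :=
  inferInstanceAs (AddCommGroup (PathAlgebra k Q ⧸ relIdeal k ρ))

noncomputable instance : Module k (QuiverAlgebra k ρ) :=
  inferInstanceAs (Module k (PathAlgebra k Q ⧸ relIdeal k ρ))

/-- The canonical map `kQ → Λ`. -/
noncomputable def mk : PathAlgebra k Q →ₗ[k] QuiverAlgebra k ρ := (relIdeal k ρ).mkQ

theorem mk_surjective : Function.Surjective (mk k ρ) := (relIdeal k ρ).mkQ_surjective

theorem mk_eq_iff {x y : PathAlgebra k Q} : mk k ρ x = mk k ρ y ↔ x - y ∈ relIdeal k ρ :=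
  Submodule.Quotient.eq _

noncomputable instance : Mul (QuiverAlgebra k ρ) :=
  ⟨Quotient.map₂ (· * ·) fun a a' ha b b' hb => by
    have ha' : a - a' ∈ relIdeal k ρ := (Submodule.quotientRel_def _).1 ha
    have hb' : b - b' ∈ relIdeal k ρ := (Submodule.quotientRel_def _).1 hb
    refine (Submodule.quotientRel_def _).2 ?_
    have h : a * b - a' * b' = (a - a') * b + a' * (b - b') := by
      rw [sub_mul, mul_sub]; abel
    rw [h]
    exact add_mem (relIdeal_mul_right b ha') (relIdeal_mul_left a' hb')⟩

theorem mk_mul (x y : PathAlgebra k Q) : mk k ρ (x * y) = mk k ρ x * mk k ρ y := rfl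

noncomputable instance : NonUnitalRing (QuiverAlgebra k ρ) :=
  { (inferInstance : AddCommGroup (QuiverAlgebra k ρ)),
    (inferInstance : Mul (QuiverAlgebra k ρ)) with
    left_distrib := fun a b c => by
      obtain ⟨a, rfl⟩ := mk_surjective k ρ a
      obtain ⟨b, rfl⟩ := mk_surjective k ρ b
      obtain ⟨c, rfl⟩ := mk_surjective k ρ c
      simp only [← mk_mul, ← map_add, mul_add]
    right_distrib := fun a b c => by
      obtain ⟨a, rfl⟩ := mk_surjective k ρ a
      obtain ⟨b, rfl⟩ := mk_surjective k ρ b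
      obtain ⟨c, rfl⟩ := mk_surjective k ρ c
      simp only [← mk_mul, ← map_add, add_mul]
    zero_mul := fun a => by
      obtain ⟨a, rfl⟩ := mk_surjective k ρ a
      rw [← map_zero (mk k ρ), ← mk_mul, zero_mul]
    mul_zero := fun a => by
      obtain ⟨a, rfl⟩ := mk_surjective k ρ a
      rw [← map_zero (mk k ρ), ← mk_mul, mul_zero]
    mul_assoc := fun a b c => by
      obtain ⟨a, rfl⟩ := mk_surjective k ρ a
      obtain ⟨b, rfl⟩ := mk_surjective k ρ b
      obtain ⟨c, rfl⟩ := mk_surjective k ρ c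
      simp only [← mk_mul, mul_assoc] }

instance : IsScalarTower k (QuiverAlgebra k ρ) (QuiverAlgebra k ρ) :=
  ⟨fun c a b => by
    obtain ⟨a, rfl⟩ := mk_surjective k ρ a
    obtain ⟨b, rfl⟩ := mk_surjective k ρ b
    simp only [smul_eq_mul, ← mk_mul, ← map_smul, smul_mul_assoc]⟩

instance : SMulCommClass k (QuiverAlgebra k ρ) (QuiverAlgebra k ρ) :=
  ⟨fun c a b => by
    obtain ⟨a, rfl⟩ := mk_surjective k ρ a
    obtain ⟨b, rfl⟩ := mk_surjective k ρ b
    simp only [smul_eq_mul, ← mk_mul, ← map_smul, mul_smul_comm]⟩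

/-- The trivial path `e_v` as an idempotent of `Λ`. -/
noncomputable def idem (v : Q) : QuiverAlgebra k ρ :=
  mk k ρ (PathAlgebra.ofPath ⟨v, v, Quiver.Path.nil⟩)

variable {k ρ} in
/-- A homomorphism from `kQ` that kills the relations factors through `Λ`. -/
noncomputable def lift {B : Type*} [Ring B] [Algebra k B] (φ : PathAlgebra k Q →ₙₐ[k] B)
    (hφ : ∀ p ∈ ρ, φ (PathAlgebra.ofPath p) = 0) : QuiverAlgebra k ρ →ₙₐ[k] B :=
  let φ' : PathAlgebra k Q →ₗ[k] B := (φ : PathAlgebra k Q →ₗ[k] B)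
  let L : QuiverAlgebra k ρ →ₗ[k] B := (relIdeal k ρ).liftQ φ' (by
    refine sInf_le ⟨fun p hp => hφ p hp, fun a x hx => ?_⟩
    have hx' : φ x = 0 := hx
    refine ⟨?_, ?_⟩
    · change φ (a * x) = 0
      rw [map_mul, hx', mul_zero]
    · change φ (x * a) = 0
      rw [map_mul, hx', zero_mul])
  { L with
    map_zero' := map_zero L
    map_mul' := fun a b => by
      obtain ⟨a, rfl⟩ := mk_surjective k ρ a
      obtain ⟨b, rfl⟩ := mk_surjective k ρ b
      exact map_mul φ a b }

variable {k ρ} in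
theorem lift_mk {B : Type*} [Ring B] [Algebra k B] (φ : PathAlgebra k Q →ₙₐ[k] B)
    (hφ : ∀ p ∈ ρ, φ (PathAlgebra.ofPath p) = 0) (x : PathAlgebra k Q) :
    lift φ hφ (mk k ρ x) = φ x := rfl

end QuiverAlgebra

/-- `kQ/(ρ)` is a string algebra: `ρ` consists of paths of length at least two, any vertex is the
head of at most two arrows and the tail of at most two arrows, and for any arrow `y` there is at
most one path `xy` of length two, and at most one path `yz` of length two, outside `ρ`. -/
structure IsStringAlgebra {Q : Type*} [Quiver Q] (ρ : Set (QPath Q)) : Prop where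
  two_le_length : ∀ p ∈ ρ, 2 ≤ p.2.2.length
  heads : ∀ v : Q, {x : Quiver.Total Q | x.right = v}.encard ≤ 2
  tails : ∀ v : Q, {x : Quiver.Total Q | x.left = v}.encard ≤ 2
  unique_after : ∀ {a b c c' : Q} (y : a ⟶ b) (x : b ⟶ c) (x' : b ⟶ c'),
    (⟨a, c, y.toPath.cons x⟩ : QPath Q) ∉ ρ → (⟨a, c', y.toPath.cons x'⟩ : QPath Q) ∉ ρ →
      (⟨b, c, x⟩ : Quiver.Total Q) = ⟨b, c', x'⟩
  unique_before : ∀ {a a' b c : Q} (y : b ⟶ c) (z : a ⟶ b) (z' : a' ⟶ b),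
    (⟨a, c, z.toPath.cons y⟩ : QPath Q) ∉ ρ → (⟨a', c, z'.toPath.cons y⟩ : QPath Q) ∉ ρ →
      (⟨a, b, z⟩ : Quiver.Total Q) = ⟨a', b, z'⟩

/-- Left modules over the non-unital algebra `Λ` are the same as modules over the ring obtained
by adjoining a one to `Λ`; the element `a` of `Λ` acts as `(a : OneAdjoined k ρ)`. -/
abbrev OneAdjoined := Unitization k (QuiverAlgebra k ρ)

variable (M : Type*) [AddCommGroup M] [Module (OneAdjoined k ρ) M]

/-- `M = Λ m₁ + ⋯ + Λ mₙ` for some elements `m₁, …, mₙ` of `M`. -/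
def IsFinitelyGenerated : Prop :=
  ∃ (n : ℕ) (m : Fin n → M), ∀ z : M, ∃ a : Fin n → QuiverAlgebra k ρ,
    z = ∑ i, (a i : OneAdjoined k ρ) • m i

/-- For every `a` in `Λ`, the set `a M` is contained in a finitely generated submodule. -/
def IsFinitelyControlled : Prop :=
  ∀ a : QuiverAlgebra k ρ, ∃ N : Submodule (OneAdjoined k ρ) M,
    IsFinitelyGenerated k ρ N ∧ ∀ m : M, (a : OneAdjoined k ρ) • m ∈ N

/-- `M` is supported at the vertex `v`, that is, `e_v M ≠ 0`. -/
def IsSupportedAt (v : Q) : Prop :=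
  ∃ m : M, (QuiverAlgebra.idem k ρ v : OneAdjoined k ρ) • m ≠ 0

/-- A module is indecomposable if it is nonzero and not the direct sum of two nonzero
submodules. -/
def IsIndecomposableModule (R M : Type*) [Ring R] [AddCommGroup M] [Module R M] : Prop :=
  Nontrivial M ∧ ∀ N N' : Submodule R M, IsCompl N N' → N = ⊥ ∨ N' = ⊥

end PathAlgebra

/-! ## Words -/

section Words

/-- A letter is an arrow (a direct letter) or the formal inverse of an arrow (an inverse letter). -/
inductive Letter (Q : Type*) [Quiver Q]
  | direct (x : Quiver.Total Q)
  | inverse (x : Quiver.Total Q)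

namespace Letter

variable {Q : Type*} [Quiver Q]

def inv : Letter Q → Letter Q
  | direct x => inverse x
  | inverse x => direct x

def head : Letter Q → Q
  | direct x => x.right
  | inverse x => x.left

def tail : Letter Q → Q
  | direct x => x.left
  | inverse x => x.right

theorem inv_inv (l : Letter Q) : l.inv.inv = l := by cases l <;> rfl

theorem head_inv (l : Letter Q) : l.inv.head = l.tail := by cases l <;> rfl

theorem tail_inv (l : Letter Q) : l.inv.tail = l.head := by cases l <;> rfl

end Letter

/-- The possible index sets of words: `{0, …, n}`, `ℕ`, `-ℕ` and `ℤ`. -/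
inductive Shape
  | fin (n : ℕ)
  | nat
  | negNat
  | int

namespace Shape

/-- The index set `I`. -/
def idx : Shape → Set ℤ
  | fin n => Set.Icc 0 (n : ℤ)
  | nat => Set.Ici 0
  | negNat => Set.Iic 0
  | int => Set.univ

/-- The index set of the inverse of a word. -/
def inv : Shape → Shape
  | fin n => fin n
  | nat => negNat
  | negNat => nat
  | int => int

/-- Inverting a word sends the position `i` to the position `s.mirror - i`. -/
def mirror : Shape → ℤ
  | fin n => n
  | _ => 0

/-- The amount by which `C[n]` is shifted: `n` for `ℤ`-words, and `0` for all other words. -/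
def offset : Shape → ℤ → ℤ
  | int, n => n
  | _, _ => 0

theorem mem_idx_inv (s : Shape) (i : ℤ) : i ∈ s.inv.idx ↔ s.mirror - i ∈ s.idx := by
  cases s <;> simp [inv, mirror, idx]
  omega

theorem mem_idx_offset (s : Shape) (n i : ℤ) : i + s.offset n ∈ s.idx ↔ i ∈ s.idx := by
  cases s <;> simp [offset, idx]

end Shape

variable {Q : Type*} [Quiver Q]

/-- The arrows `x₁, …, xₘ` of a path `x₁ ⋯ xₘ`; the arrow passed last comes first. -/
def arrowList {a : Q} : {b : Q} → Quiver.Path a b → List (Quiver.Total Q)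
  | _, .nil => []
  | _, .cons p x => ⟨_, _, x⟩ :: arrowList p

/-- `w` occurs as a sequence of consecutive letters in `f`. -/
def OccursIn (w : List (Letter Q)) (f : ℤ → Option (Letter Q)) : Prop :=
  ∃ i : ℤ, ∀ j : ℕ, j < w.length → f (i + j) = w[j]?

/-- An `I`-word `C` for the relations `ρ`. The letter `C_i` is `letter i`, which is `none` unless
both `i` and `i - 1` are in `I`. A word without letters, `I = {0}`, is a trivial word `1_{v,ε}`,
and then `base` is `(v, ε)`. -/
@[ext]
structure Word (ρ : Set (QPath Q)) where
  shape : Shape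
  letter : ℤ → Option (Letter Q)
  base : Option (Q × ℤˣ)
  letter_isSome : ∀ i, (letter i).isSome ↔ i ∈ shape.idx ∧ i - 1 ∈ shape.idx
  base_isSome : base.isSome ↔ shape = Shape.fin 0
  composable : ∀ i l l', letter i = some l → letter (i + 1) = some l' → l.tail = l'.head
  reduced : ∀ i l l', letter i = some l → letter (i + 1) = some l' → l.inv ≠ l'
  no_relation : ∀ p ∈ ρ, ¬ OccursIn ((arrowList p.2.2).map Letter.direct) letter
  no_inverse_relation :
    ∀ p ∈ ρ, ¬ OccursIn ((arrowList p.2.2).map Letter.inverse).reverse letter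

theorem OccursIn.of_shift {w : List (Letter Q)} {f : ℤ → Option (Letter Q)} {n : ℤ}
    (h : OccursIn w fun i => f (i + n)) : OccursIn w f := by
  obtain ⟨i, hi⟩ := h
  refine ⟨i + n, fun j hj => ?_⟩
  rw [← hi j hj]
  congr 1
  ring

theorem OccursIn.of_inv {w : List (Letter Q)} {f : ℤ → Option (Letter Q)} {n : ℤ}
    (h : OccursIn w fun i => (f (n - i)).map Letter.inv) :
    OccursIn (w.map Letter.inv).reverse f := by
  obtain ⟨i, hi⟩ := h
  refine ⟨n - i - (w.length - 1), fun j hj => ?_⟩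
  rw [List.length_reverse, List.length_map] at hj
  have h1 := hi (w.length - 1 - j) (by omega)
  have h2 : n - (i + ((w.length - 1 - j : ℕ) : ℤ)) = n - i - (w.length - 1) + j := by omega
  beta_reduce at h1
  rw [h2] at h1
  rw [List.getElem?_reverse (by simpa using hj), List.length_map, List.getElem?_map, ← h1,
    Option.map_map]
  have h3 : (Letter.inv ∘ Letter.inv : Letter Q → Letter Q) = id :=
    funext fun l => Letter.inv_inv l
  rw [h3, Option.map_id_fun, id]

namespace Word

variable {ρ : Set (QPath Q)}

/-- The vertex `v_i(C)`, for `i` in `I`: the tail of `C_i` or the head of `C_{i+1}`, or `v` for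
`1_{v,ε}`. -/
def vertex (C : Word ρ) (i : ℤ) : Option Q :=
  match C.letter i, C.letter (i + 1) with
  | some l, _ => some l.tail
  | none, some l => some l.head
  | none, none => C.base.map Prod.fst

/-- The inverse word: the letters are inverted and their order is reversed, and the inverse of
`1_{v,ε}` is `1_{v,-ε}`. -/
def inv (C : Word ρ) : Word ρ where
  shape := C.shape.inv
  letter i := (C.letter (C.shape.mirror + 1 - i)).map Letter.inv
  base := C.base.map fun b => (b.1, -b.2)
  letter_isSome i := by
    rw [Option.isSome_map, C.letter_isSome, C.shape.mem_idx_inv, C.shape.mem_idx_inv, and_comm]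
    have h1 : C.shape.mirror + 1 - i - 1 = C.shape.mirror - i := by ring
    have h2 : C.shape.mirror + 1 - i = C.shape.mirror - (i - 1) := by ring
    rw [h1, h2]
  base_isSome := by
    rw [Option.isSome_map, C.base_isSome]
    cases C.shape <;> simp [Shape.inv]
  composable i l l' h h' := by
    obtain ⟨m, hm, rfl⟩ := Option.map_eq_some_iff.1 h
    obtain ⟨m', hm', rfl⟩ := Option.map_eq_some_iff.1 h'
    rw [Letter.tail_inv, Letter.head_inv]
    refine (C.composable _ _ _ hm' ?_).symm
    rw [← hm]; congr 1; ring
  reduced i l l' h h' := by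
    obtain ⟨m, hm, rfl⟩ := Option.map_eq_some_iff.1 h
    obtain ⟨m', hm', rfl⟩ := Option.map_eq_some_iff.1 h'
    rw [Letter.inv_inv]
    refine (C.reduced _ _ _ hm' ?_).symm
    rw [← hm]; congr 1; ring
  no_relation p hp h := by
    refine C.no_inverse_relation p hp ?_
    have := h.of_inv
    rwa [List.map_map] at this
  no_inverse_relation p hp h := by
    refine C.no_relation p hp ?_
    have := h.of_inv
    rwa [List.map_reverse, List.reverse_reverse, List.map_map] at this

/-- The shift `C[n]`, with `C[n]_i = C_{n+i}`, for a `ℤ`-word; all other words are unchanged. -/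
def shift (C : Word ρ) (n : ℤ) : Word ρ where
  shape := C.shape
  letter i := C.letter (i + C.shape.offset n)
  base := C.base
  letter_isSome i := by
    rw [C.letter_isSome, C.shape.mem_idx_offset, ← C.shape.mem_idx_offset n (i - 1)]
    have h : i + C.shape.offset n - 1 = i - 1 + C.shape.offset n := by ring
    rw [h]
  base_isSome := C.base_isSome
  composable i l l' h h' := by
    refine C.composable _ _ _ h ?_
    rw [← h']; congr 1; ring
  reduced i l l' h h' := by
    refine C.reduced _ _ _ h ?_
    rw [← h']; congr 1; ring
  no_relation p hp h := C.no_relation p hp h.of_shift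
  no_inverse_relation p hp h := C.no_inverse_relation p hp h.of_shift

/-- The equivalence relation on words. -/
def Equivalent (C D : Word ρ) : Prop :=
  ∃ n : ℤ, D = C.shift n ∨ D = C.inv.shift n

/-- `C` is a `ℤ`-word with `C = C[n]` for some `n > 0`. -/
def IsPeriodic (C : Word ρ) : Prop :=
  C.shape = Shape.int ∧ ∃ n : ℕ, 0 < n ∧ C.shift n = C

/-- The period of a periodic word: the least `n > 0` with `C = C[n]`. -/
noncomputable def period (C : Word ρ) : ℕ :=
  sInf {n : ℕ | 0 < n ∧ C.shift n = C}

/-- Only finitely many `C_i` with `i > 0` are direct letters. -/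
def EventuallyInverse (C : Word ρ) : Prop :=
  {i : ℤ | 0 < i ∧ ∃ x, C.letter i = some (Letter.direct x)}.Finite

/-- Every vertex `v` is `v_i(C)` for only finitely many `i > 0` in `I`. -/
def VertexFinite (C : Word ρ) : Prop :=
  ∀ v : Q, {i : ℤ | 0 < i ∧ i ∈ C.shape.idx ∧ C.vertex i = some v}.Finite

theorem mem_of_letter {C : Word ρ} {i : ℤ} {l : Letter Q} (h : C.letter i = some l) :
    i ∈ C.shape.idx ∧ i - 1 ∈ C.shape.idx :=
  (C.letter_isSome i).1 (by rw [h]; rfl)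

theorem mem_of_letter_succ {C : Word ρ} {i : ℤ} {l : Letter Q} (h : C.letter (i + 1) = some l) :
    i + 1 ∈ C.shape.idx :=
  (mem_of_letter h).1

theorem vertex_of_letter {C : Word ρ} {i : ℤ} {l : Letter Q} (h : C.letter i = some l) :
    C.vertex i = some l.tail := by
  simp [vertex, h]

theorem vertex_of_letter_succ {C : Word ρ} {i : ℤ} {l : Letter Q}
    (h : C.letter (i + 1) = some l) : C.vertex i = some l.head := by
  cases h' : C.letter i with
  | none => simp [vertex, h, h']
  | some l' => rw [vertex_of_letter h', C.composable i l' l h' h]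

end Word

end Words

/-! ## String modules -/

section StringModules

variable {Q : Type*} [Quiver Q] {ρ : Set (QPath Q)} (k : Type*) [Field k]

/-- The string module `M(C)`, the vector space with basis the symbols `b_i` for `i` in `I`. -/
def StringModule (C : Word ρ) := C.shape.idx →₀ k

namespace StringModule

variable (C : Word ρ)

noncomputable instance : AddCommGroup (StringModule k C) :=
  inferInstanceAs (AddCommGroup (C.shape.idx →₀ k))

noncomputable instance : Module k (StringModule k C) :=
  inferInstanceAs (Module k (C.shape.idx →₀ k))

variable {C} in
/-- The basis element `b_i`. -/
noncomputable def b (i : C.shape.idx) : StringModule k C := Finsupp.single i (1 : k)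

/-- The linear map with given values on the basis elements. -/
noncomputable def linExt {M : Type*} [AddCommGroup M] [Module k M] (f : C.shape.idx → M) :
    StringModule k C →ₗ[k] M :=
  Finsupp.linearCombination k f

variable {k C} in
theorem linExt_b {M : Type*} [AddCommGroup M] [Module k M] (f : C.shape.idx → M)
    (i : C.shape.idx) : linExt k C f (b k i) = f i :=
  (Finsupp.linearCombination_single k (1 : k) i).trans (one_smul k (f i))

variable {k C} in
theorem hom_ext {M : Type*} [AddCommGroup M] [Module k M] {f g : StringModule k C →ₗ[k] M}
    (h : ∀ i, f (b k i) = g (b k i)) : f = g :=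
  Finsupp.lhom_ext' fun i => LinearMap.ext_ring (h i)

open Classical in
/-- The action of the trivial path at `v`: `e_v b_i` is `b_i` if `v_i(C) = v`, and otherwise
zero. -/
noncomputable def vertexOp (v : Q) : Module.End k (StringModule k C) :=
  linExt k C fun i => if C.vertex i = some v then b k i else 0

open Classical in
/-- The action of the arrow `x`: `x b_i` is `b_{i-1}` if `C_i = x`, it is `b_{i+1}` if
`C_{i+1} = x⁻¹`, and otherwise zero. -/
noncomputable def arrowOp (x : Quiver.Total Q) : Module.End k (StringModule k C) :=
  linExt k C fun i =>
    if h : C.letter i = some (Letter.direct x) then b k ⟨i - 1, (Word.mem_of_letter h).2⟩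
    else if h : C.letter (i + 1) = some (Letter.inverse x) then
      b k ⟨i + 1, Word.mem_of_letter_succ h⟩
    else 0

variable {k C}

theorem vertexOp_b_of_eq {v : Q} {i : C.shape.idx} (h : C.vertex i = some v) :
    vertexOp k C v (b k i) = b k i := by
  rw [vertexOp, linExt_b, if_pos h]

theorem vertexOp_b_of_ne {v : Q} {i : C.shape.idx} (h : C.vertex i ≠ some v) :
    vertexOp k C v (b k i) = 0 := by
  rw [vertexOp, linExt_b, if_neg h]

theorem arrowOp_b_direct {x : Quiver.Total Q} {i : C.shape.idx}
    (h : C.letter i = some (Letter.direct x)) :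
    arrowOp k C x (b k i) = b k ⟨i - 1, (Word.mem_of_letter h).2⟩ := by
  rw [arrowOp, linExt_b, dif_pos h]

theorem arrowOp_b_inverse {x : Quiver.Total Q} {i : C.shape.idx}
    (h : C.letter (i + 1) = some (Letter.inverse x)) :
    arrowOp k C x (b k i) = b k ⟨i + 1, Word.mem_of_letter_succ h⟩ := by
  have h' : C.letter i ≠ some (Letter.direct x) := fun h' => C.reduced i _ _ h' h rfl
  rw [arrowOp, linExt_b, dif_neg h', dif_pos h]

theorem arrowOp_b_zero {x : Quiver.Total Q} {i : C.shape.idx}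
    (h : C.letter i ≠ some (Letter.direct x))
    (h' : C.letter (i + 1) ≠ some (Letter.inverse x)) : arrowOp k C x (b k i) = 0 := by
  rw [arrowOp, linExt_b, dif_neg h, dif_neg h']

theorem vertexOp_mul_self (v : Q) : vertexOp k C v * vertexOp k C v = vertexOp k C v := by
  refine hom_ext fun i => ?_
  rw [Module.End.mul_apply]
  by_cases h : C.vertex i = some v
  · simp only [vertexOp_b_of_eq h]
  · rw [vertexOp_b_of_ne h, map_zero]

theorem vertexOp_mul_of_ne (v w : Q) (hvw : v ≠ w) : vertexOp k C v * vertexOp k C w = 0 := by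
  refine hom_ext fun i => ?_
  rw [Module.End.mul_apply, LinearMap.zero_apply]
  by_cases h : C.vertex i = some w
  · rw [vertexOp_b_of_eq h, vertexOp_b_of_ne]
    rw [h]
    exact fun h' => hvw (Option.some.inj h').symm
  · rw [vertexOp_b_of_ne h, map_zero]

theorem vertexOp_mul_arrowOp (x : Quiver.Total Q) :
    vertexOp k C x.right * arrowOp k C x = arrowOp k C x := by
  refine hom_ext fun i => ?_
  rw [Module.End.mul_apply]
  by_cases h : C.letter i = some (Letter.direct x)
  · rw [arrowOp_b_direct h, vertexOp_b_of_eq]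
    exact Word.vertex_of_letter_succ (i := i - 1) (l := Letter.direct x)
      (by rw [sub_add_cancel]; exact h)
  · by_cases h' : C.letter (i + 1) = some (Letter.inverse x)
    · rw [arrowOp_b_inverse h', vertexOp_b_of_eq]
      exact Word.vertex_of_letter h'
    · rw [arrowOp_b_zero h h', map_zero]

/-- A path that does not kill `b_i` occurs in `C`, itself or as its inverse. -/
theorem pathOp_b {a c : Q} (p : Quiver.Path a c) (i : C.shape.idx) :
    PathAlgebra.pathOp (vertexOp k C) (arrowOp k C) p (b k i) = 0 ∨
    ∃ j : C.shape.idx,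
      PathAlgebra.pathOp (vertexOp k C) (arrowOp k C) p (b k i) = b k j ∧
      (((j : ℤ) + (arrowList p).length = i ∧ ∀ r : ℕ, r < (arrowList p).length →
          C.letter (j + 1 + r) = ((arrowList p).map Letter.direct)[r]?) ∨
        ((i : ℤ) + (arrowList p).length = j ∧ ∀ r : ℕ, r < (arrowList p).length →
          C.letter (i + 1 + r) = ((arrowList p).map Letter.inverse).reverse[r]?)) := by
  induction p with
  | nil =>
    by_cases h : C.vertex i = some a
    · exact Or.inr ⟨i, vertexOp_b_of_eq h, Or.inl (by simp [arrowList])⟩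
    · exact Or.inl (vertexOp_b_of_ne h)
  | @cons c d p x ih =>
    rw [PathAlgebra.pathOp, Module.End.mul_apply]
    rcases ih with ih | ⟨j, hj, ih⟩
    · left; rw [ih, map_zero]
    · rw [hj]
      by_cases h : C.letter j = some (Letter.direct ⟨c, d, x⟩)
      · right
        refine ⟨_, arrowOp_b_direct h, Or.inl ?_⟩
        have hd : (j : ℤ) + (arrowList p).length = i ∧ ∀ r : ℕ, r < (arrowList p).length →
            C.letter (j + 1 + r) = ((arrowList p).map Letter.direct)[r]? := by
          rcases ih with ih | ⟨ih1, ih2⟩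
          · exact ih
          · rcases Nat.eq_zero_or_pos (arrowList p).length with h0 | h0
            · refine ⟨by omega, fun r hr => by omega⟩
            · exfalso
              have h1 := ih2 ((arrowList p).length - 1) (by omega)
              have h2 : (i : ℤ) + 1 + (((arrowList p).length - 1 : ℕ) : ℤ) = j := by omega
              rw [h2, h, List.getElem?_reverse (by simp; omega), List.getElem?_map] at h1
              obtain ⟨y, -, hy⟩ := Option.map_eq_some_iff.1 h1.symm
              cases hy
        refine ⟨by rw [arrowList, List.length_cons]; push_cast; omega, fun r hr => ?_⟩
        rw [arrowList, List.length_cons] at hr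
        rw [arrowList, List.map_cons]
        cases r with
        | zero => simpa using h
        | succ r =>
          rw [List.getElem?_cons_succ, ← hd.2 r (by omega)]
          congr 1
          push_cast
          ring
      · by_cases h' : C.letter (j + 1) = some (Letter.inverse ⟨c, d, x⟩)
        · right
          refine ⟨_, arrowOp_b_inverse h', Or.inr ?_⟩
          have hd : (i : ℤ) + (arrowList p).length = j ∧ ∀ r : ℕ, r < (arrowList p).length →
              C.letter (i + 1 + r) = ((arrowList p).map Letter.inverse).reverse[r]? := by
            rcases ih with ⟨ih1, ih2⟩ | ih
            · rcases Nat.eq_zero_or_pos (arrowList p).length with h0 | h0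
              · refine ⟨by omega, fun r hr => by omega⟩
              · exfalso
                have h1 := ih2 0 h0
                rw [Nat.cast_zero, add_zero, h', List.getElem?_map] at h1
                obtain ⟨y, -, hy⟩ := Option.map_eq_some_iff.1 h1.symm
                cases hy
            · exact ih
          refine ⟨by rw [arrowList, List.length_cons]; push_cast; omega, fun r hr => ?_⟩
          rw [arrowList, List.length_cons] at hr
          rw [arrowList, List.map_cons, List.reverse_cons]
          rcases Nat.lt_or_ge r (arrowList p).length with hr' | hr'
          · rw [hd.2 r hr', List.getElem?_append_left (by simpa using hr')]
          · have hr2 : r = (arrowList p).length := by omega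
            subst hr2
            rw [List.getElem?_append_right (by simp)]
            have h3 : (i : ℤ) + 1 + (arrowList p).length = j + 1 := by omega
            rw [h3, h']
            simp
        · left
          exact arrowOp_b_zero h h'

theorem pathOp_relation (p : QPath Q) (hp : p ∈ ρ) :
    PathAlgebra.pathOp (vertexOp k C) (arrowOp k C) p.2.2 = 0 := by
  refine hom_ext fun i => ?_
  rcases pathOp_b (k := k) p.2.2 i with h | ⟨j, -, h | h⟩
  · exact h
  · exact absurd ⟨j + 1, fun r hr => h.2 r (by simpa using hr)⟩ (C.no_relation p hp)
  · exact absurd ⟨i + 1, fun r hr => h.2 r (by simpa using hr)⟩ (C.no_inverse_relation p hp)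

variable (k C)

/-- The action of `Λ` on `M(C)`. -/
noncomputable def action : QuiverAlgebra k ρ →ₙₐ[k] Module.End k (StringModule k C) :=
  QuiverAlgebra.lift
    (PathAlgebra.lift (vertexOp k C) (arrowOp k C) vertexOp_mul_self vertexOp_mul_of_ne
      vertexOp_mul_arrowOp)
    fun p hp => by rw [PathAlgebra.lift_ofPath, pathOp_relation p hp]

noncomputable instance : Module (OneAdjoined k ρ) (StringModule k C) :=
  Module.compHom (StringModule k C) (Unitization.lift (action k C)).toRingHom

variable {k C}

theorem smul_def (r : OneAdjoined k ρ) (m : StringModule k C) :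
    r • m = Unitization.lift (action k C) r m := rfl

theorem inl_smul (c : k) (m : StringModule k C) :
    (Unitization.inl c : OneAdjoined k ρ) • m = c • m := by
  rw [smul_def]
  simp [Unitization.lift, Algebra.algebraMap_eq_smul_one]

theorem inr_smul (a : QuiverAlgebra k ρ) (m : StringModule k C) :
    (a : OneAdjoined k ρ) • m = action k C a m := by
  rw [smul_def]
  simp [Unitization.lift]

theorem smul_smul_aux (c : k) (r : OneAdjoined k ρ) (m : StringModule k C) :
    (c • r) • m = c • r • m := by
  rw [smul_def, smul_def, map_smul, LinearMap.smul_apply]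

instance : IsScalarTower k (OneAdjoined k ρ) (StringModule k C) := ⟨smul_smul_aux⟩

/-- A linear endomorphism that commutes with the trivial paths and the arrows commutes with all
of `Λ`. -/
theorem map_smul_of_commute (f : Module.End k (StringModule k C))
    (hv : ∀ v, f * vertexOp k C v = vertexOp k C v * f)
    (hx : ∀ x, f * arrowOp k C x = arrowOp k C x * f) (r : OneAdjoined k ρ)
    (m : StringModule k C) : f (r • m) = r • f m := by
  have hp : ∀ {a c : Q} (p : Quiver.Path a c),
      f * PathAlgebra.pathOp (vertexOp k C) (arrowOp k C) p =
        PathAlgebra.pathOp (vertexOp k C) (arrowOp k C) p * f := by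
    intro a c p
    induction p with
    | nil => exact hv a
    | cons p x ih => rw [PathAlgebra.pathOp, ← mul_assoc, hx, mul_assoc, ih, mul_assoc]
  have ha : ∀ a : QuiverAlgebra k ρ, f * action k C a = action k C a * f := by
    intro a
    obtain ⟨a, rfl⟩ := QuiverAlgebra.mk_surjective k ρ a
    let φ : PathAlgebra k Q →ₙₐ[k] Module.End k (StringModule k C) :=
      PathAlgebra.lift (vertexOp k C) (arrowOp k C) vertexOp_mul_self vertexOp_mul_of_ne
        vertexOp_mul_arrowOp
    let φ' : PathAlgebra k Q →ₗ[k] Module.End k (StringModule k C) := φ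
    have key : (LinearMap.mulLeft k f).comp φ' = (LinearMap.mulRight k f).comp φ' := by
      refine PathAlgebra.hom_ext fun p => ?_
      change f * φ (PathAlgebra.ofPath p) = φ (PathAlgebra.ofPath p) * f
      rw [PathAlgebra.lift_ofPath, hp]
    exact LinearMap.congr_fun key a
  induction r using Unitization.ind with
  | inl_add_inr c a =>
    rw [add_smul, add_smul, inl_smul, inl_smul, inr_smul, inr_smul, map_add, map_smul]
    congr 1
    exact LinearMap.congr_fun (ha a) m

end StringModule

/-! ## Band modules -/

/-- The string module `M(C)` of a periodic word `C`, with its additional module structure over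
`k[T, T⁻¹]`. -/
def PeriodicStringModule {C : Word ρ} (_ : C.IsPeriodic) := StringModule k C

namespace PeriodicStringModule

variable {C : Word ρ} (hC : C.IsPeriodic)

noncomputable instance : AddCommGroup (PeriodicStringModule k hC) :=
  inferInstanceAs (AddCommGroup (StringModule k C))

noncomputable instance : Module k (PeriodicStringModule k hC) :=
  inferInstanceAs (Module k (StringModule k C))

noncomputable instance : Module (OneAdjoined k ρ) (PeriodicStringModule k hC) :=
  inferInstanceAs (Module (OneAdjoined k ρ) (StringModule k C))

instance : IsScalarTower k (OneAdjoined k ρ) (PeriodicStringModule k hC) :=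
  inferInstanceAs (IsScalarTower k (OneAdjoined k ρ) (StringModule k C))

variable {k hC}

theorem mem_idx (hC : C.IsPeriodic) (i : ℤ) : i ∈ C.shape.idx := by
  rw [hC.1]; exact Set.mem_univ i

theorem letter_add_mul_period (hC : C.IsPeriodic) (i m : ℤ) :
    C.letter (i + m * C.period) = C.letter i := by
  have hper : Function.Periodic C.letter (C.period : ℤ) := by
    intro i
    have h : C.shift C.period = C := (Nat.sInf_mem hC.2).2
    have h' := congrFun (congrArg Word.letter h) i
    simpa [Word.shift, hC.1, Shape.offset] using h'
  exact hper.int_mul m i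

theorem vertex_add_mul_period (hC : C.IsPeriodic) (i m : ℤ) :
    C.vertex (i + m * C.period) = C.vertex i := by
  have h : i + m * C.period + 1 = i + 1 + m * C.period := by ring
  rw [Word.vertex, Word.vertex, h, letter_add_mul_period hC, letter_add_mul_period hC]

variable (k hC)

/-- The linear map `b_i ↦ b_{i-mn}`, where `n` is the period of `C`. -/
noncomputable def shiftLin (m : ℤ) : Module.End k (StringModule k C) :=
  StringModule.linExt k C fun i => StringModule.b k ⟨i - m * C.period, mem_idx hC _⟩

variable {k hC}

theorem shiftLin_b (m : ℤ) (i : C.shape.idx) :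
    shiftLin k hC m (StringModule.b k i) =
      StringModule.b k ⟨i - m * C.period, mem_idx hC _⟩ :=
  StringModule.linExt_b _ i

theorem shiftLin_vertexOp (m : ℤ) (v : Q) :
    shiftLin k hC m * StringModule.vertexOp k C v =
      StringModule.vertexOp k C v * shiftLin k hC m := by
  refine StringModule.hom_ext fun i => ?_
  rw [Module.End.mul_apply, Module.End.mul_apply, shiftLin_b]
  have hv : C.vertex ((i : ℤ) - m * C.period) = C.vertex i := by
    rw [← vertex_add_mul_period hC _ m, sub_add_cancel]
  by_cases h : C.vertex i = some v
  · rw [StringModule.vertexOp_b_of_eq h, StringModule.vertexOp_b_of_eq (hv.trans h), shiftLin_b]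
  · rw [StringModule.vertexOp_b_of_ne h, map_zero, StringModule.vertexOp_b_of_ne]
    exact fun h' => h (hv.symm.trans h')

theorem shiftLin_arrowOp (m : ℤ) (x : Quiver.Total Q) :
    shiftLin k hC m * StringModule.arrowOp k C x =
      StringModule.arrowOp k C x * shiftLin k hC m := by
  refine StringModule.hom_ext fun i => ?_
  rw [Module.End.mul_apply, Module.End.mul_apply, shiftLin_b]
  have h1 : C.letter ((i : ℤ) - m * C.period) = C.letter i := by
    rw [← letter_add_mul_period hC _ m, sub_add_cancel]
  have h2 : C.letter ((i : ℤ) - m * C.period + 1) = C.letter (i + 1) := by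
    rw [← letter_add_mul_period hC _ m]; congr 1; ring
  by_cases h : C.letter i = some (Letter.direct x)
  · rw [StringModule.arrowOp_b_direct h, StringModule.arrowOp_b_direct (h1.trans h), shiftLin_b]
    congr 2; ring
  · by_cases h' : C.letter (i + 1) = some (Letter.inverse x)
    · rw [StringModule.arrowOp_b_inverse h', StringModule.arrowOp_b_inverse (h2.trans h'),
        shiftLin_b]
      congr 2; ring
    · rw [StringModule.arrowOp_b_zero h h', map_zero, StringModule.arrowOp_b_zero]
      · exact fun h'' => h (h1.symm.trans h'')
      · exact fun h'' => h' (h2.symm.trans h'')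

variable (k hC)

/-- The automorphism `b_i ↦ b_{i-mn}` of the `Λ`-module `M(C)`, where `n` is the period of `C`. -/
noncomputable def shiftEnd (m : ℤ) : Module.End (OneAdjoined k ρ) (PeriodicStringModule k hC) where
  toFun := shiftLin k hC m
  map_add' := map_add (shiftLin k hC m)
  map_smul' := StringModule.map_smul_of_commute _ (shiftLin_vertexOp m) (shiftLin_arrowOp m)

/-- The homomorphism `T^m ↦ (b_i ↦ b_{i-mn})`. -/
noncomputable def shiftHom :
    Multiplicative ℤ →* Module.End (OneAdjoined k ρ) (PeriodicStringModule k hC) where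
  toFun m := shiftEnd k hC m.toAdd
  map_one' := by
    have h : shiftLin k hC 0 = 1 := StringModule.hom_ext fun i => by
      rw [shiftLin_b, Module.End.one_apply]
      congr 2; ring
    exact LinearMap.ext fun z => LinearMap.congr_fun h z
  map_mul' m m' := by
    have h : shiftLin k hC (m.toAdd + m'.toAdd) =
        shiftLin k hC m.toAdd * shiftLin k hC m'.toAdd := StringModule.hom_ext fun i => by
      rw [Module.End.mul_apply, shiftLin_b, shiftLin_b, shiftLin_b]
      congr 2; ring
    exact LinearMap.ext fun z => LinearMap.congr_fun h z

/-- The action of `k[T, T⁻¹]` on `M(C)`: `T` acts as `b_i ↦ b_{i-n}`, where `n` is the period. -/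
noncomputable def laurentHom :
    k[T;T⁻¹] →ₐ[k] Module.End (OneAdjoined k ρ) (PeriodicStringModule k hC) :=
  AddMonoidAlgebra.lift k _ ℤ (shiftHom k hC)

noncomputable instance : Module k[T;T⁻¹] (PeriodicStringModule k hC) :=
  Module.compHom (PeriodicStringModule k hC) (laurentHom k hC).toRingHom

instance : SMulCommClass k[T;T⁻¹] (OneAdjoined k ρ) (PeriodicStringModule k hC) :=
  ⟨fun f r m => map_smul (laurentHom k hC f) r m⟩

instance : SMulCommClass (OneAdjoined k ρ) k[T;T⁻¹] (PeriodicStringModule k hC) :=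
  SMulCommClass.symm _ _ _

end PeriodicStringModule

/-- The module `M(C, V) = M(C) ⊗ V` over `Λ`, the tensor product over `k[T, T⁻¹]`. It is a band
module if `V` is finite-dimensional and indecomposable. -/
abbrev BandModule {C : Word ρ} (hC : C.IsPeriodic) (V : Type*) [AddCommGroup V]
    [Module k[T;T⁻¹] V] :=
  PeriodicStringModule k hC ⊗[k[T;T⁻¹]] V

/-- The `k[T, T⁻¹]`-module `V⁻¹`: it is `V` with the actions of `T` and `T⁻¹` exchanged. -/
def InvModule (V : Type*) := V

instance (V : Type*) [AddCommGroup V] : AddCommGroup (InvModule V) :=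
  inferInstanceAs (AddCommGroup V)

noncomputable instance (V : Type*) [AddCommGroup V] [Module k[T;T⁻¹] V] :
    Module k[T;T⁻¹] (InvModule V) :=
  Module.compHom V (LaurentPolynomial.invert (R := k)).toRingEquiv.toRingHom

/-- The `k[T, T⁻¹]`-module `V` is finite-dimensional over `k` and indecomposable. -/
def IsBandCoefficient (V : Type*) [AddCommGroup V] [Module k[T;T⁻¹] V] : Prop :=
  Module.Finite k (RestrictScalars k k[T;T⁻¹] V) ∧ IsIndecomposableModule k[T;T⁻¹] V

end StringModules

/-- `N` is isomorphic to a string module. -/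
def IsStringModule (k : Type*) [Field k] {Q : Type*} [Quiver Q] (ρ : Set (QPath Q))
    (N : Type*) [AddCommGroup N] [Module (OneAdjoined k ρ) N] : Prop :=
  ∃ C : Word ρ, Nonempty (N ≃ₗ[OneAdjoined k ρ] StringModule k C)

/-- `N` is isomorphic to a band module. -/
def IsBandModule.{w, u₁, u₂, u₃, u₄} (k : Type u₁) [Field k] {Q : Type u₂} [Quiver.{u₃} Q]
    (ρ : Set (QPath Q)) (N : Type u₄) [AddCommGroup N] [Module (OneAdjoined k ρ) N] : Prop :=
  ∃ (C : Word ρ) (hC : C.IsPeriodic) (V : Type w) (_ : AddCommGroup V) (_ : Module k[T;T⁻¹] V),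
    IsBandCoefficient k V ∧ Nonempty (N ≃ₗ[OneAdjoined k ρ] BandModule k hC V)

/-! ## Generators of `Λ` and unital modules -/

section Generators

variable (k : Type*) {Q : Type*} [Field k] [Quiver Q] (ρ : Set (QPath Q))

namespace PathAlgebra

variable {k}

/-! A string or band module is treated as a family of copies of a coefficient space `V`, one at each
position of the word, with inclusions `β i` and coordinates `π i` (`WordCoord`). Positions at which
the word looks the same (`Word.SameAt`) are identified through `V` (`WordCoord.Rigid`). For a
nonperiodic word `V` is `k`; for a band module it is the given `k[T;T⁻¹]`-module; the string module
of a periodic word is read as `M(C) ⊗ k[T;T⁻¹]`, with `V = k[T;T⁻¹]`. This puts all cases on the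
same footing.

A homomorphism `f` has entries `π j ∘ f ∘ β i`. An entry does not change when both positions move
along a common letter (`entry_step`). Signs on the letters (`exists_isLetterSign`) tell which side
of `i` is to be compared with which side of `j`. Where the two half words first differ, a nonzero
entry excludes a direct letter in the first and an inverse letter in the second. So nonzero entries
occur only between positions related by the preorder `Word.Below` (`below_of_entry_ne_zero`).
Positions related both ways have the same letters on both sides, up to reflection; hence their words
are equivalent (`Below.equivalent`). Within a single word they differ by a translation preserving
the word, since a word is never its own reflection (`Below.sameAt`).

Homomorphisms between modules over one word are therefore triangular. Their diagonal is a single map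
`V → V'`, the same at all positions (`entry_self_eq_diag`), multiplicative (`diag_comp`) and
compatible with translations (`diag_π_β`), that is, with `T`. An endomorphism with zero diagonal
fixes nothing but zero (`eq_zero_of_diag_eq_zero`), so a decomposition of the module is detected by
an idempotent of `V`: this is (i). An isomorphism has nonzero entries in both directions at some
pair of positions, so the words are equivalent, and its diagonal is then an isomorphism of
coefficients (`exists_addEquiv`); a reflection of the word replaces `T` by `T⁻¹`. Conversely the
maps `π j ∘ β i` determine the module (`nonempty_linearEquiv`). A string module is not a band
module, because `k[T;T⁻¹]` is infinite-dimensional.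

For finiteness, the `b_j` in front of a direct letter span a submodule (`smul_mem_initialPart`), so
a finitely generated submodule is bounded in every direction with infinitely many direct letters.
Behind the last direct letter all `b_j` are generated by one of them
(`bz_mem_of_eventuallyInverse`). Band modules are always finitely generated, and direct sums are
treated componentwise. -/

theorem ofPath_comp {a b c : Q} (p : Quiver.Path b c) (q : Quiver.Path a b) :
    (ofPath ⟨a, c, q.comp p⟩ : PathAlgebra k Q) = ofPath ⟨b, c, p⟩ * ofPath ⟨a, b, q⟩ := by
  rw [ofPath_mul_ofPath, pathMul_comp]

theorem span_ofPath_induction {P : PathAlgebra k Q → Prop} (h0 : P 0)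
    (hadd : ∀ x y, P x → P y → P (x + y)) (hsmul : ∀ (c : k) p, P (c • ofPath p))
    (x : PathAlgebra k Q) : P x := by
  induction x using Finsupp.induction_linear with
  | zero => exact h0
  | add x y hx hy => exact hadd x y hx hy
  | single p c =>
    have h : (Finsupp.single p c : PathAlgebra k Q) = c • ofPath p := by
      refine (?_ : Finsupp.single p c = c • Finsupp.single p (1 : k))
      simp
    rw [h]
    exact hsmul c p

end PathAlgebra

namespace QuiverAlgebra

/-- The arrow `x` as an element of `Λ`. -/
noncomputable def arrow (x : Quiver.Total Q) : QuiverAlgebra k ρ :=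
  mk k ρ (PathAlgebra.ofPath ⟨x.left, x.right, x.hom.toPath⟩)

/-- The scalars, the trivial paths and the arrows generate the ring `OneAdjoined k ρ`. -/
theorem closure_generators :
    Subring.closure (Set.range (Unitization.inl : k → OneAdjoined k ρ) ∪
      (Set.range fun v : Q => (idem k ρ v : OneAdjoined k ρ)) ∪
      (Set.range fun x : Quiver.Total Q => (arrow k ρ x : OneAdjoined k ρ))) = ⊤ := by
  set S := Subring.closure (Set.range (Unitization.inl : k → OneAdjoined k ρ) ∪
      (Set.range fun v : Q => (idem k ρ v : OneAdjoined k ρ)) ∪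
      (Set.range fun x : Quiver.Total Q => (arrow k ρ x : OneAdjoined k ρ))) with hS
  have hc : ∀ c : k, (Unitization.inl c : OneAdjoined k ρ) ∈ S := fun c =>
    Subring.subset_closure (Or.inl (Or.inl ⟨c, rfl⟩))
  have he : ∀ v : Q, (idem k ρ v : OneAdjoined k ρ) ∈ S := fun v =>
    Subring.subset_closure (Or.inl (Or.inr ⟨v, rfl⟩))
  have hx : ∀ x : Quiver.Total Q, (arrow k ρ x : OneAdjoined k ρ) ∈ S := fun x =>
    Subring.subset_closure (Or.inr ⟨x, rfl⟩)
  have hp : ∀ {a b : Q} (p : Quiver.Path a b),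
      (mk k ρ (PathAlgebra.ofPath ⟨a, b, p⟩) : OneAdjoined k ρ) ∈ S := by
    intro a b p
    induction p with
    | nil => exact he a
    | @cons b c p x ih =>
      have h := PathAlgebra.ofPath_comp (k := k) x.toPath p
      rw [Quiver.Path.comp_toPath_eq_cons] at h
      rw [h, mk_mul, Unitization.inr_mul]
      exact S.mul_mem (hx ⟨b, c, x⟩) ih
  have ha : ∀ a : QuiverAlgebra k ρ, (a : OneAdjoined k ρ) ∈ S := by
    intro a
    obtain ⟨a, rfl⟩ := mk_surjective k ρ a
    induction a using PathAlgebra.span_ofPath_induction with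
    | h0 => simp
    | hadd x y hx hy => simpa using S.add_mem hx hy
    | hsmul c p =>
      have h : (mk k ρ (c • PathAlgebra.ofPath p) : OneAdjoined k ρ) =
          Unitization.inl c * (mk k ρ (PathAlgebra.ofPath p) : OneAdjoined k ρ) := by
        rw [map_smul, Unitization.inl_mul_inr]
      rw [h]
      exact S.mul_mem (hc c) (hp p.2.2)
  refine eq_top_iff.2 fun r _ => ?_
  induction r using Unitization.ind with
  | inl_add_inr c a => exact S.add_mem (hc c) (ha a)

variable {k ρ}

variable {M : Type*} [AddCommGroup M] [Module (OneAdjoined k ρ) M]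

/-- An additive subgroup that is stable under the generators of `Λ` is a submodule. -/
theorem smul_mem_of_generators (P : AddSubgroup M)
    (hc : ∀ (c : k), ∀ m ∈ P, (Unitization.inl c : OneAdjoined k ρ) • m ∈ P)
    (he : ∀ v, ∀ m ∈ P, (idem k ρ v : OneAdjoined k ρ) • m ∈ P)
    (hx : ∀ x, ∀ m ∈ P, (arrow k ρ x : OneAdjoined k ρ) • m ∈ P) (r : OneAdjoined k ρ) :
    ∀ m ∈ P, r • m ∈ P := by
  have hr : r ∈ (⊤ : Subring (OneAdjoined k ρ)) := Subring.mem_top r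
  rw [← closure_generators k ρ] at hr
  induction hr using Subring.closure_induction with
  | mem r hr =>
    rcases hr with (⟨c, rfl⟩ | ⟨v, rfl⟩) | ⟨x, rfl⟩
    exacts [hc c, he v, hx x]
  | zero => intro m _; rw [zero_smul]; exact P.zero_mem
  | one => intro m hm; rwa [one_smul]
  | add r s _ _ hr hs => intro m hm; rw [add_smul]; exact P.add_mem (hr m hm) (hs m hm)
  | neg r _ hr => intro m hm; rw [neg_smul]; exact P.neg_mem (hr m hm)
  | mul r s _ _ hr hs => intro m hm; rw [mul_smul]; exact hr _ (hs m hm)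

/-- An additive map that commutes with the generators of `Λ` is linear. -/
theorem map_smul_of_generators {M' : Type*} [AddCommGroup M'] [Module (OneAdjoined k ρ) M']
    (f : M →+ M')
    (hc : ∀ (c : k) m, f ((Unitization.inl c : OneAdjoined k ρ) • m) =
      (Unitization.inl c : OneAdjoined k ρ) • f m)
    (he : ∀ v m, f ((idem k ρ v : OneAdjoined k ρ) • m) = (idem k ρ v : OneAdjoined k ρ) • f m)
    (hx : ∀ x m, f ((arrow k ρ x : OneAdjoined k ρ) • m) =
      (arrow k ρ x : OneAdjoined k ρ) • f m) (r : OneAdjoined k ρ) :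
    ∀ m, f (r • m) = r • f m := by
  have hr : r ∈ (⊤ : Subring (OneAdjoined k ρ)) := Subring.mem_top r
  rw [← closure_generators k ρ] at hr
  induction hr using Subring.closure_induction with
  | mem r hr =>
    rcases hr with (⟨c, rfl⟩ | ⟨v, rfl⟩) | ⟨x, rfl⟩
    exacts [hc c, he v, hx x]
  | zero => intro m; rw [zero_smul, zero_smul, map_zero]
  | one => intro m; rw [one_smul, one_smul]
  | add r s _ _ hr hs => intro m; rw [add_smul, add_smul, map_add, hr, hs]
  | neg r _ hr => intro m; rw [neg_smul, neg_smul, map_neg, hr]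
  | mul r s _ _ hr hs => intro m; rw [mul_smul, mul_smul, hr, hs]

variable (k ρ) in
/-- Every element of `Λ` is fixed by the sum of finitely many trivial paths. -/
theorem exists_sum_idem_mul (a : QuiverAlgebra k ρ) :
    ∃ S : Finset Q, ∀ S' : Finset Q, S ⊆ S' → (∑ v ∈ S', idem k ρ v) * a = a := by
  classical
  obtain ⟨a, rfl⟩ := mk_surjective k ρ a
  induction a using PathAlgebra.span_ofPath_induction with
  | h0 => exact ⟨∅, fun S' _ => by rw [map_zero, mul_zero]⟩
  | hadd x y hx hy =>
    obtain ⟨S, hS⟩ := hx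
    obtain ⟨T, hT⟩ := hy
    refine ⟨S ∪ T, fun S' h => ?_⟩
    rw [map_add, mul_add, hS S' (Finset.union_subset_left h), hT S' (Finset.union_subset_right h)]
  | hsmul c p =>
    obtain ⟨a, b, p⟩ := p
    -- Only the trivial path at the end point `b` fixes `p` from the left; all others kill it.
    refine ⟨{b}, fun S' h => ?_⟩
    rw [map_smul, mul_smul_comm, Finset.sum_mul, Finset.sum_eq_single_of_mem b (h (by simp))]
    · rw [idem, ← mk_mul, ← PathAlgebra.ofPath_comp, Quiver.Path.comp_nil]
    · intro v _ hv
      rw [idem, ← mk_mul, PathAlgebra.ofPath_mul_ofPath, PathAlgebra.pathMul_eq_zero _ _ hv.symm,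
        map_zero]

end QuiverAlgebra

/-! ### Unital modules, finite generation and finite control -/

open QuiverAlgebra

/-- The condition `Λ M = M`: every element is fixed by the sum of finitely many trivial paths. -/
def IsUnitalModule (M : Type*) [AddCommGroup M] [Module (OneAdjoined k ρ) M] : Prop :=
  ∀ m : M, ∃ S : Finset Q, ∀ S' : Finset Q, S ⊆ S' →
    ((∑ v ∈ S', idem k ρ v : QuiverAlgebra k ρ) : OneAdjoined k ρ) • m = m

variable {k ρ}

section

variable {M N : Type*} [AddCommGroup M] [Module (OneAdjoined k ρ) M]
  [AddCommGroup N] [Module (OneAdjoined k ρ) N]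

theorem IsUnitalModule.submodule (hM : IsUnitalModule k ρ M) (N : Submodule (OneAdjoined k ρ) M) :
    IsUnitalModule k ρ N := fun m => by
  obtain ⟨S, hS⟩ := hM m
  exact ⟨S, fun S' h => Subtype.ext (hS S' h)⟩

theorem IsUnitalModule.of_equiv (hM : IsUnitalModule k ρ M) (e : M ≃ₗ[OneAdjoined k ρ] N) :
    IsUnitalModule k ρ N := fun m => by
  obtain ⟨S, hS⟩ := hM (e.symm m)
  refine ⟨S, fun S' h => e.symm.injective ?_⟩
  rw [map_smul, hS S' h]

theorem IsUnitalModule.exists_common_add {x y : M}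
    (hx : ∃ S : Finset Q, ∀ S' : Finset Q, S ⊆ S' →
      ((∑ v ∈ S', idem k ρ v : QuiverAlgebra k ρ) : OneAdjoined k ρ) • x = x)
    (hy : ∃ S : Finset Q, ∀ S' : Finset Q, S ⊆ S' →
      ((∑ v ∈ S', idem k ρ v : QuiverAlgebra k ρ) : OneAdjoined k ρ) • y = y) :
    ∃ S : Finset Q, ∀ S' : Finset Q, S ⊆ S' →
      ((∑ v ∈ S', idem k ρ v : QuiverAlgebra k ρ) : OneAdjoined k ρ) • (x + y) = x + y := by
  classical
  obtain ⟨S, hS⟩ := hx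
  obtain ⟨T, hT⟩ := hy
  refine ⟨S ∪ T, fun S' h => ?_⟩
  rw [smul_add, hS S' (Finset.union_subset_left h), hT S' (Finset.union_subset_right h)]

theorem IsUnitalModule.directSum {ι : Type*} {N : ι → Type*} [∀ i, AddCommGroup (N i)]
    [∀ i, Module (OneAdjoined k ρ) (N i)] (h : ∀ i, IsUnitalModule k ρ (N i)) :
    IsUnitalModule k ρ (⨁ i, N i) := by
  classical
  intro m
  induction m using DirectSum.induction_on with
  | zero => exact ⟨∅, fun S' _ => smul_zero _⟩
  | add x y hx hy => exact IsUnitalModule.exists_common_add hx hy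
  | of i x =>
    obtain ⟨S, hS⟩ := h i x
    refine ⟨S, fun S' hS' => ?_⟩
    rw [← DirectSum.lof_eq_of (OneAdjoined k ρ), ← map_smul, hS S' hS']

/-- A sum of trivial paths that fixes `z` can be multiplied into any expression of `z` in the
generators. As `Λ` is an ideal of the ring with adjoined one, this moves all coefficients into `Λ`.
-/
theorem IsUnitalModule.isFinitelyGenerated_iff (hM : IsUnitalModule k ρ M) :
    IsFinitelyGenerated k ρ M ↔ Module.Finite (OneAdjoined k ρ) M := by
  classical
  constructor
  · rintro ⟨n, m, hm⟩
    refine ⟨⟨Finset.univ.image m, eq_top_iff.2 fun z _ => ?_⟩⟩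
    obtain ⟨a, rfl⟩ := hm z
    exact Submodule.sum_mem _ fun i _ => Submodule.smul_mem _ _ (Submodule.subset_span (by simp))
  · intro h
    obtain ⟨n, m, hm⟩ := Module.Finite.exists_fin (R := OneAdjoined k ρ) (M := M)
    refine ⟨n, m, fun z => ?_⟩
    obtain ⟨S, hS⟩ := hM z
    have hz : z ∈ Submodule.span (OneAdjoined k ρ) (Set.range m) := hm ▸ Submodule.mem_top
    obtain ⟨r, hr⟩ := (Submodule.mem_span_range_iff_exists_fun _).1 hz
    have h' : ∀ i, ∃ a : QuiverAlgebra k ρ, (a : OneAdjoined k ρ) =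
        ((∑ v ∈ S, idem k ρ v : QuiverAlgebra k ρ) : OneAdjoined k ρ) * r i := by
      intro i
      -- This is `e (c + a) = c e + e a` for the scalar part `c` and the `Λ`-part `a` of `r i`.
      refine ⟨(r i).fst • (∑ v ∈ S, idem k ρ v) + (∑ v ∈ S, idem k ρ v) * (r i).snd, ?_⟩
      ext <;> simp
    choose a ha using h'
    refine ⟨a, ?_⟩
    rw [← hS S subset_rfl, ← hr, Finset.smul_sum]
    exact Finset.sum_congr rfl fun i _ => by rw [ha, mul_smul]

/-- A unital module is finitely controlled if every `e_v M` lies in a finitely generated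
submodule. -/
theorem IsUnitalModule.isFinitelyControlled_iff (hM : IsUnitalModule k ρ M) :
    IsFinitelyControlled k ρ M ↔ ∀ v : Q, ∃ N : Submodule (OneAdjoined k ρ) M,
      N.FG ∧ ∀ m : M, (idem k ρ v : OneAdjoined k ρ) • m ∈ N := by
  have key : ∀ N : Submodule (OneAdjoined k ρ) M, IsFinitelyGenerated k ρ N ↔ N.FG := fun N => by
    rw [(hM.submodule N).isFinitelyGenerated_iff, Module.Finite.iff_fg]
  constructor
  · intro h v
    obtain ⟨N, hN, hm⟩ := h (idem k ρ v)
    exact ⟨N, (key N).1 hN, hm⟩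
  · intro h a
    choose N hN hm using h
    obtain ⟨S, hS⟩ := exists_sum_idem_mul k ρ a
    -- Since `a` is fixed by the finite sum of the `e_v` with `v ∈ S`, the set `a M` lies in the sum
    -- of the `e_v M`.
    refine ⟨⨆ v ∈ S, N v, (key _).2 (Submodule.fg_biSup S N fun v _ => hN v), fun m => ?_⟩
    rw [← hS S subset_rfl, Unitization.inr_mul, mul_smul]
    have h' : ((∑ v ∈ S, idem k ρ v : QuiverAlgebra k ρ) : OneAdjoined k ρ) =
        ∑ v ∈ S, (idem k ρ v : OneAdjoined k ρ) :=
      map_sum (Unitization.inrHom k k (QuiverAlgebra k ρ)) _ S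
    rw [h', Finset.sum_smul]
    exact Submodule.sum_mem _ fun v hv =>
      Submodule.mem_iSup_of_mem v (Submodule.mem_iSup_of_mem hv (hm v _))

end

end Generators

/-! ## Walking along words -/

section WordCombinatorics

variable {Q : Type*} [Quiver Q] {ρ : Set (QPath Q)}

/-- The step to the right (`true`) or to the left (`false`). -/
def dirStep (δ : Bool) : ℤ := cond δ 1 (-1)

@[simp] theorem dirStep_true : dirStep true = 1 := rfl

@[simp] theorem dirStep_false : dirStep false = -1 := rfl

theorem dirStep_not (δ : Bool) : dirStep (!δ) = -dirStep δ := by cases δ <;> rfl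

theorem dirStep_mul_self (δ : Bool) : dirStep δ * dirStep δ = 1 := by cases δ <;> rfl

theorem Letter.inv_ne (l : Letter Q) : l.inv ≠ l := by
  cases l <;> simp [Letter.inv]

theorem Option.map_inv_inv (o : Option (Letter Q)) :
    (o.map Letter.inv).map Letter.inv = o := by
  cases o <;> simp [Letter.inv_inv]

theorem Shape.zero_mem_idx (s : Shape) : (0 : ℤ) ∈ s.idx := by
  cases s <;> simp [Shape.idx]

theorem Shape.ordConnected_idx (s : Shape) : s.idx.OrdConnected := by
  cases s <;> simp only [Shape.idx] <;> infer_instance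

namespace Word

variable (C D : Word ρ)

/-- The letter with which a walk along `C` leaves the position `i` in the direction `δ`. -/
def side (δ : Bool) (i : ℤ) : Option (Letter Q) :=
  match δ with
  | true => C.letter (i + 1)
  | false => (C.letter i).map Letter.inv

variable {C D}

/-- Looking back after a step, one sees the inverse of the letter just passed. -/
theorem side_step (δ : Bool) (i : ℤ) :
    C.side (!δ) (i + dirStep δ) = (C.side δ i).map Letter.inv := by
  cases δ
  · simp only [side, Bool.not_false, dirStep_false, Option.map_inv_inv]
    congr 1; ring
  · rfl

theorem side_step_of_eq {δ : Bool} {i : ℤ} {l : Letter Q} (h : C.side δ i = some l) :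
    C.side (!δ) (i + dirStep δ) = some l.inv := by
  rw [side_step, h]; rfl

/-- The two letters leaving `i` are `C_i⁻¹` and `C_{i+1}`, so this is reducedness. -/
theorem side_ne_side {δ : Bool} {i : ℤ} {l : Letter Q} (h : C.side δ i = some l) :
    C.side (!δ) i ≠ some l := by
  intro h'
  cases δ
  · obtain ⟨m, hm, rfl⟩ := Option.map_eq_some_iff.1 h
    exact C.reduced i _ _ hm h' rfl
  · obtain ⟨m, hm, rfl⟩ := Option.map_eq_some_iff.1 h'
    exact C.reduced i _ _ hm h rfl

theorem eq_of_side_eq {δ δ' : Bool} {i : ℤ} {l : Letter Q} (h : C.side δ i = some l)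
    (h' : C.side δ' i = some l) : δ' = δ := by
  by_contra hne
  rw [Bool.eq_not_of_ne hne] at h'
  exact side_ne_side h h'

theorem mem_of_side {δ : Bool} {i : ℤ} {l : Letter Q} (h : C.side δ i = some l) :
    i ∈ C.shape.idx ∧ i + dirStep δ ∈ C.shape.idx := by
  cases δ
  · obtain ⟨m, hm, rfl⟩ := Option.map_eq_some_iff.1 h
    exact mem_of_letter hm
  · have := mem_of_letter (C := C) (i := i + 1) h
    rw [add_sub_cancel_right] at this
    exact this.symm

theorem exists_side {δ : Bool} {i : ℤ} (h : i ∈ C.shape.idx) (h' : i + dirStep δ ∈ C.shape.idx) :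
    ∃ l, C.side δ i = some l := by
  cases δ
  · obtain ⟨l, hl⟩ := Option.isSome_iff_exists.1 ((C.letter_isSome i).2 ⟨h, h'⟩)
    exact ⟨l.inv, by simp [side, hl]⟩
  · exact Option.isSome_iff_exists.1 ((C.letter_isSome (i + 1)).2 ⟨h', by simpa using h⟩)

theorem exists_vertex {i : ℤ} (hi : i ∈ C.shape.idx) : ∃ v, C.vertex i = some v := by
  cases h : C.letter i with
  | some l => exact ⟨_, vertex_of_letter h⟩
  | none =>
    cases h' : C.letter (i + 1) with
    | some l => exact ⟨_, vertex_of_letter_succ h'⟩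
    | none =>
      have h1 : ¬ (i ∈ C.shape.idx ∧ i - 1 ∈ C.shape.idx) := by
        rw [← C.letter_isSome, h]; simp
      have h2 : ¬ (i + 1 ∈ C.shape.idx ∧ i + 1 - 1 ∈ C.shape.idx) := by
        rw [← C.letter_isSome, h']; simp
      -- Neither neighbour of `i` is in the index set, which is therefore `{0}`; the vertex is then
      -- stored in `base`.
      have h3 : C.shape = Shape.fin 0 := by
        cases hs : C.shape <;> rw [hs] at h1 h2 hi <;> simp [Shape.idx] at h1 h2 hi ⊢ <;> omega
      obtain ⟨b, hb⟩ := Option.isSome_iff_exists.1 (C.base_isSome.2 h3)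
      exact ⟨b.1, by simp [vertex, h, h', hb]⟩

theorem inv_inv : C.inv.inv = C := by
  obtain ⟨s, letter, base⟩ := C
  ext1
  · cases s <;> rfl
  · funext i
    have h : s.inv.mirror = s.mirror := by cases s <;> rfl
    simp only [inv, Option.map_inv_inv, h]
    congr 1; ring
  · cases base <;> simp [inv]

/-! ### Positions at which a word looks the same -/

variable (C) in
/-- Translation by `j - i` preserves the letters of `C`. -/
def SameAt (i j : ℤ) : Prop :=
  i ∈ C.shape.idx ∧ j ∈ C.shape.idx ∧ ∀ m, C.letter (i + m) = C.letter (j + m)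

theorem SameAt.refl {i : ℤ} (hi : i ∈ C.shape.idx) : C.SameAt i i := ⟨hi, hi, fun _ => rfl⟩

theorem SameAt.symm {i j : ℤ} (h : C.SameAt i j) : C.SameAt j i :=
  ⟨h.2.1, h.1, fun m => (h.2.2 m).symm⟩

theorem SameAt.trans {i j l : ℤ} (h : C.SameAt i j) (h' : C.SameAt j l) : C.SameAt i l :=
  ⟨h.1, h'.2.1, fun m => (h.2.2 m).trans (h'.2.2 m)⟩

theorem SameAt.side {i j : ℤ} (h : C.SameAt i j) (δ : Bool) : C.side δ i = C.side δ j := by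
  cases δ
  · have := h.2.2 0
    simp only [add_zero] at this
    simp only [Word.side, this]
  · exact h.2.2 1

theorem SameAt.vertex {i j : ℤ} (h : C.SameAt i j) : C.vertex i = C.vertex j := by
  have h0 := h.2.2 0
  simp only [add_zero] at h0
  simp only [Word.vertex, h0, h.2.2 1]

theorem SameAt.step {i j : ℤ} (h : C.SameAt i j) {δ : Bool} {l : Letter Q}
    (hl : C.side δ i = some l) : C.SameAt (i + dirStep δ) (j + dirStep δ) :=
  ⟨(mem_of_side hl).2, (mem_of_side ((h.side δ).symm.trans hl)).2, fun m => by
    rw [add_assoc, h.2.2, add_assoc]⟩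

theorem sameAt_iff_side {i j : ℤ} : C.SameAt i j ↔
    i ∈ C.shape.idx ∧ j ∈ C.shape.idx ∧ ∀ δ m, C.side δ (i + m) = C.side δ (j + m) := by
  refine and_congr_right fun _ => and_congr_right fun _ => ⟨fun h δ m => ?_, fun h m => ?_⟩
  · cases δ
    · simp only [Word.side, h m]
    · simp only [Word.side, add_assoc, h (m + 1)]
  · have h' := h true (m - 1)
    simpa only [Word.side, add_assoc, sub_add_cancel] using h'

/-- The letters of `C` are invariant under translation by `d ≠ 0` only if `C` is periodic. -/
theorem SameAt.isPeriodic {i j : ℤ} (h : C.SameAt i j) (hij : i ≠ j) : C.IsPeriodic := by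
  wlog hlt : i < j generalizing i j
  · exact this h.symm hij.symm (by omega)
  have hd : ∀ m, C.letter (m + (j - i)) = C.letter m := fun m => by
    have := h.2.2 (m - i)
    rw [show i + (m - i) = m by ring, show j + (m - i) = m + (j - i) by ring] at this
    exact this.symm
  -- The set of places that carry a letter is invariant too. Every index set other than `ℤ` has the
  -- end point `0`, and the letter next to `0` would be translated beyond it.
  have hsome : ∀ m, (m ∈ C.shape.idx ∧ m - 1 ∈ C.shape.idx) ↔
      (m + (j - i) ∈ C.shape.idx ∧ m + (j - i) - 1 ∈ C.shape.idx) := fun m => by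
    rw [← C.letter_isSome, ← C.letter_isSome, hd]
  have hi := h.1
  have hj := h.2.1
  have hshape : C.shape = Shape.int := by
    cases hs : C.shape with
    | int => rfl
    | fin n =>
      exfalso
      have h1 := hsome (1 - (j - i))
      rw [hs] at hi hj h1
      simp only [Shape.idx, Set.mem_Icc] at hi hj h1
      omega
    | nat =>
      exfalso
      have h1 := hsome (1 - (j - i))
      rw [hs] at hi hj h1
      simp only [Shape.idx, Set.mem_Ici] at hi hj h1
      omega
    | negNat =>
      exfalso
      have h1 := hsome 0
      rw [hs] at hi hj h1
      simp only [Shape.idx, Set.mem_Iic] at hi hj h1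
      omega
  refine ⟨hshape, (j - i).toNat, by omega, ?_⟩
  ext1
  · rfl
  · funext m
    simp only [shift, hshape, Shape.offset]
    rw [Int.toNat_of_nonneg (by omega), hd]
  · rfl

/-! ### Matching words -/

variable (C D) in
/-- A translation or a reflection of `ℤ` that identifies the words `C` and `D`. -/
structure Match where
  flip : Bool
  offset : ℤ
  side_eq : ∀ δ i, C.side δ i = D.side (xor δ flip) (offset + dirStep (!flip) * i)
  vertex_eq : ∀ i, C.vertex i = D.vertex (offset + dirStep (!flip) * i)
  mem_iff : ∀ i, i ∈ C.shape.idx ↔ offset + dirStep (!flip) * i ∈ D.shape.idx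

/-- The position of `D` that corresponds to the position `i` of `C`. -/
def Match.pos (e : Match C D) (i : ℤ) : ℤ := e.offset + dirStep (!e.flip) * i

theorem Match.pos_step (e : Match C D) (δ : Bool) (i : ℤ) :
    e.pos (i + dirStep δ) = e.pos i + dirStep (xor δ e.flip) := by
  unfold Match.pos
  cases δ <;> cases e.flip <;> simp <;> ring

theorem Match.pos_add (e : Match C D) (i m : ℤ) :
    e.pos (i + m) = e.pos i + dirStep (!e.flip) * m := by
  unfold Match.pos; ring

theorem Match.side_eq_pos (e : Match C D) (δ : Bool) (i : ℤ) :
    C.side δ i = D.side (xor δ e.flip) (e.pos i) := e.side_eq δ i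

theorem Match.mem_iff_pos (e : Match C D) (i : ℤ) :
    i ∈ C.shape.idx ↔ e.pos i ∈ D.shape.idx := e.mem_iff i

theorem Match.sameAt_iff (e : Match C D) {i j : ℤ} :
    C.SameAt i j ↔ D.SameAt (e.pos i) (e.pos j) := by
  rw [sameAt_iff_side, sameAt_iff_side, ← e.mem_iff_pos, ← e.mem_iff_pos]
  refine and_congr_right fun _ => and_congr_right fun _ => ⟨fun h δ m => ?_, fun h δ m => ?_⟩
  · have h' := h (xor δ e.flip) (dirStep (!e.flip) * m)
    simpa only [e.side_eq_pos, e.pos_add, Bool.xor_assoc, Bool.xor_self, Bool.xor_false,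
      ← mul_assoc, dirStep_mul_self, one_mul] using h'
  · rw [e.side_eq_pos, e.side_eq_pos, e.pos_add, e.pos_add, h]

theorem Match.pos_injective (e : Match C D) : Function.Injective e.pos := fun i j h => by
  have h' := congrArg (dirStep (!e.flip) * ·) (add_left_cancel h)
  simpa only [← mul_assoc, dirStep_mul_self, one_mul] using h'

theorem Match.pos_surjective (e : Match C D) : Function.Surjective e.pos := fun j => by
  unfold Match.pos
  cases e.flip
  · exact ⟨j - e.offset, by simp⟩
  · exact ⟨e.offset - j, by simp⟩

variable (C) in
/-- The identification of `C` with `C[n]`. -/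
def Match.shift (n : ℤ) : Match C (C.shift n) where
  flip := false
  offset := -C.shape.offset n
  side_eq δ i := by
    cases δ <;> simp only [side, Word.shift, Bool.not_false, dirStep_true, Bool.xor_false] <;>
      congr 1
    · congr 1; ring
    · ring
  vertex_eq i := by
    simp only [vertex, Word.shift, Bool.not_false, dirStep_true]
    rw [show -C.shape.offset n + 1 * i + C.shape.offset n = i by ring,
      show -C.shape.offset n + 1 * i + 1 + C.shape.offset n = i + 1 by ring]
  mem_iff i := by
    change _ ↔ _ ∈ C.shape.idx
    rw [← C.shape.mem_idx_offset n (_ + _)]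
    simp only [Bool.not_false, dirStep_true]
    rw [show -C.shape.offset n + 1 * i + C.shape.offset n = i by ring]

theorem vertex_inv (i : ℤ) : C.inv.vertex (C.shape.mirror - i) = C.vertex i := by
  have h1 : C.inv.letter (C.shape.mirror - i) = (C.letter (i + 1)).map Letter.inv := by
    simp only [inv]; congr 2; ring
  have h2 : C.inv.letter (C.shape.mirror - i + 1) = (C.letter i).map Letter.inv := by
    simp only [inv]; congr 2; ring
  cases h : C.letter i with
  | some l =>
    rw [h] at h2
    rw [vertex_of_letter_succ h2, vertex_of_letter h, Letter.head_inv]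
  | none =>
    cases h' : C.letter (i + 1) with
    | some l =>
      rw [h'] at h1
      rw [vertex_of_letter h1, vertex_of_letter_succ h', Letter.tail_inv]
    | none =>
      rw [h] at h2
      rw [h'] at h1
      rw [vertex, h1, h2, vertex, h, h']
      cases hb : C.base <;> simp [inv, hb]

variable (C) in
/-- The identification of `C` with `C⁻¹[n]`. -/
def Match.invShift (n : ℤ) : Match C (C.inv.shift n) where
  flip := true
  offset := C.shape.mirror - C.inv.shape.offset n
  side_eq δ i := by
    cases δ
    · simp only [side, Word.shift, inv, Bool.not_true, dirStep_false, Bool.false_xor]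
      congr 2; ring
    · simp only [side, Word.shift, inv, Bool.not_true, dirStep_false, Bool.xor_self,
        Option.map_inv_inv]
      congr 1; ring
  vertex_eq i := by
    rw [← vertex_inv]
    simp only [vertex, Word.shift, Bool.not_true, dirStep_false]
    rw [show C.shape.mirror - C.inv.shape.offset n + -1 * i + C.inv.shape.offset n =
        C.shape.mirror - i by ring,
      show C.shape.mirror - C.inv.shape.offset n + -1 * i + 1 + C.inv.shape.offset n =
        C.shape.mirror - i + 1 by ring]
  mem_iff i := by
    change _ ↔ _ ∈ C.inv.shape.idx
    rw [← C.inv.shape.mem_idx_offset n (_ + _)]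
    change _ ↔ _ ∈ C.shape.inv.idx
    rw [C.shape.mem_idx_inv]
    simp only [Bool.not_true, dirStep_false]
    rw [show C.shape.mirror - (C.shape.mirror - C.inv.shape.offset n + -1 * i +
      C.inv.shape.offset n) = i by ring]

theorem Equivalent.nonempty_match (h : C.Equivalent D) : Nonempty (Match C D) := by
  obtain ⟨n, rfl | rfl⟩ := h
  exacts [⟨Match.shift C n⟩, ⟨Match.invShift C n⟩]

/-- Words whose letters agree up to a translation are equivalent. -/
theorem equivalent_of_letter_eq {i j : ℤ} (hi : i ∈ C.shape.idx) (hj : j ∈ D.shape.idx)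
    (hl : ∀ m, C.letter (i + m) = D.letter (j + m)) (hv : C.vertex i = D.vertex j) :
    C.Equivalent D := by
  have hsome : ∀ m, (i + m ∈ C.shape.idx ∧ i + m - 1 ∈ C.shape.idx) ↔
      (j + m ∈ D.shape.idx ∧ j + m - 1 ∈ D.shape.idx) := fun m => by
    rw [← C.letter_isSome, ← D.letter_isSome, hl]
  -- The places that carry letters determine the index set up to translation. All index sets with an
  -- end have it at `0`, so only for `ℤ` can the translation be nontrivial. The cases test `hsome`
  -- next to the end points.
  have hs : D.shape = C.shape ∧ (i = j ∨ C.shape = Shape.int) := by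
    cases hC : C.shape with
    | fin a =>
      cases hD : D.shape with
      | fin b =>
        have h1 := hsome (1 - i)
        have h2 := hsome (a - i)
        have h3 := hsome (1 - j)
        have h4 := hsome (b - j)
        rw [hC, hD] at h1 h2 h3 h4
        rw [hC] at hi
        rw [hD] at hj
        simp only [Shape.idx, Set.mem_Icc] at hi hj h1 h2 h3 h4
        have hab : a = b := by omega
        exact ⟨by rw [hab], Or.inl (by omega)⟩
      | nat =>
        have h1 := hsome (a + 1)
        rw [hC, hD] at h1
        rw [hC] at hi
        rw [hD] at hj
        simp only [Shape.idx, Set.mem_Icc, Set.mem_Ici] at hi hj h1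
        omega
      | negNat =>
        have h1 := hsome (-i)
        rw [hC, hD] at h1
        rw [hC] at hi
        rw [hD] at hj
        simp only [Shape.idx, Set.mem_Icc, Set.mem_Iic] at hi hj h1
        omega
      | int =>
        have h1 := hsome (-i)
        rw [hC, hD] at h1
        simp only [Shape.idx, Set.mem_Icc, Set.mem_univ, and_self, iff_true] at h1
        omega
    | nat =>
      cases hD : D.shape with
      | fin b =>
        have h1 := hsome (b + 1)
        rw [hC, hD] at h1
        rw [hC] at hi
        rw [hD] at hj
        simp only [Shape.idx, Set.mem_Icc, Set.mem_Ici] at hi hj h1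
        omega
      | nat =>
        have h1 := hsome (1 - i)
        have h2 := hsome (1 - j)
        rw [hC, hD] at h1 h2
        simp only [Shape.idx, Set.mem_Ici] at h1 h2
        exact ⟨rfl, Or.inl (by omega)⟩
      | negNat =>
        have h1 := hsome (-i)
        rw [hC, hD] at h1
        rw [hC] at hi
        rw [hD] at hj
        simp only [Shape.idx, Set.mem_Ici, Set.mem_Iic] at hi hj h1
        omega
      | int =>
        have h1 := hsome (-i)
        rw [hC, hD] at h1
        simp only [Shape.idx, Set.mem_Ici, Set.mem_univ, and_self, iff_true] at h1
        omega
    | negNat =>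
      cases hD : D.shape with
      | fin b =>
        have h1 := hsome (-j)
        rw [hC, hD] at h1
        rw [hC] at hi
        rw [hD] at hj
        simp only [Shape.idx, Set.mem_Icc, Set.mem_Iic] at hi hj h1
        omega
      | nat =>
        have h1 := hsome (-j)
        rw [hC, hD] at h1
        rw [hC] at hi
        rw [hD] at hj
        simp only [Shape.idx, Set.mem_Ici, Set.mem_Iic] at hi hj h1
        omega
      | negNat =>
        have h1 := hsome (-i)
        have h2 := hsome (-j)
        rw [hC, hD] at h1 h2
        simp only [Shape.idx, Set.mem_Iic] at h1 h2
        exact ⟨rfl, Or.inl (by omega)⟩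
      | int =>
        have h1 := hsome (1 - i)
        rw [hC, hD] at h1
        simp only [Shape.idx, Set.mem_Iic, Set.mem_univ, and_self, iff_true] at h1
        omega
    | int =>
      cases hD : D.shape with
      | int => exact ⟨rfl, Or.inr rfl⟩
      | fin b =>
        have h1 := hsome (-j)
        rw [hC, hD] at h1
        simp only [Shape.idx, Set.mem_Icc, Set.mem_univ, and_self, true_iff] at h1
        omega
      | nat =>
        have h1 := hsome (-j)
        rw [hC, hD] at h1
        simp only [Shape.idx, Set.mem_Ici, Set.mem_univ, and_self, true_iff] at h1
        omega
      | negNat =>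
        have h1 := hsome (1 - j)
        rw [hC, hD] at h1
        simp only [Shape.idx, Set.mem_Iic, Set.mem_univ, and_self, true_iff] at h1
        omega
  obtain ⟨hshape, hij⟩ := hs
  have hletter : D.letter = fun m => C.letter (m + C.shape.offset (i - j)) := by
    funext m
    have h := hl (m - j)
    rw [show j + (m - j) = m by ring] at h
    rw [← h]
    congr 1
    rcases hij with rfl | hshape
    · have : C.shape.offset (i - i) = 0 := by cases C.shape <;> simp [Shape.offset]
      rw [this]; ring
    · rw [hshape, Shape.offset]; ring
  -- Without letters only the vertex is known. The sign of `D` is that of `C` or of `C⁻¹`, and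
  -- either is allowed.
  by_cases h0 : C.shape = Shape.fin 0
  · obtain ⟨⟨v, ε⟩, hb⟩ := Option.isSome_iff_exists.1 (C.base_isSome.2 h0)
    obtain ⟨⟨w, ε'⟩, hb'⟩ := Option.isSome_iff_exists.1 (D.base_isSome.2 (hshape.trans h0))
    have hnC : ∀ m, C.letter m = none := fun m => by
      rw [← Option.not_isSome_iff_eq_none, C.letter_isSome, h0]
      simp only [Shape.idx, Set.mem_Icc]; omega
    have hnD : ∀ m, D.letter m = none := fun m => by rw [hletter]; exact hnC _
    have hvw : v = w := by simpa [vertex, hnC, hnD, hb, hb'] using hv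
    subst hvw
    have hε : ε' = ε ∨ ε' = -ε := by
      rcases Int.units_eq_one_or ε with rfl | rfl <;>
        rcases Int.units_eq_one_or ε' with rfl | rfl <;> simp
    refine ⟨i - j, hε.imp (fun h => ?_) fun h => ?_⟩ <;> subst h <;> ext1
    · exact hshape
    · exact hletter
    · exact hb'.trans hb.symm
    · change D.shape = C.shape.inv
      rw [hshape, h0]; rfl
    · funext m
      rw [hnD, shift, inv]
      simp [hnC]
    · rw [hb', shift, inv]; simp [hb]
  · refine ⟨i - j, Or.inl ?_⟩
    ext1
    · exact hshape
    · exact hletter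
    · have h1 : C.base = none := by
        rw [← Option.not_isSome_iff_eq_none, C.base_isSome]; exact h0
      have h2 : D.base = none := by
        rw [← Option.not_isSome_iff_eq_none, D.base_isSome, hshape]; exact h0
      exact h2.trans h1.symm

theorem equivalent_of_inv_equivalent (h : C.inv.Equivalent D) : C.Equivalent D := by
  obtain ⟨n, h | h⟩ := h
  · exact ⟨n, Or.inr h⟩
  · rw [inv_inv] at h
    exact ⟨n, Or.inl h⟩

end Word

/-! ### Signs of letters -/

/-- Single out one element `a`; two distinct elements besides it would make three. -/
theorem Set.exists_injOn_bool {α : Type*} {s : Set α} (hs : s.encard ≤ 2) :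
    ∃ f : α → Bool, Set.InjOn f s := by
  classical
  rcases s.eq_empty_or_nonempty with rfl | ⟨a, ha⟩
  · exact ⟨fun _ => true, Set.injOn_empty _⟩
  · refine ⟨fun x => decide (x = a), fun x hx y hy hxy => ?_⟩
    have hxy' : x = a ↔ y = a := by simpa using hxy
    by_contra hne
    have hxa : x ≠ a := fun h => hne (h.trans (hxy'.1 h).symm)
    have hya : y ≠ a := fun h => hxa (hxy'.2 h)
    have h3 : ({x, y, a} : Set α).encard = 3 := Set.encard_eq_three.2 ⟨x, y, a, hne, hxa, hya, rfl⟩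
    have h4 : ({x, y, a} : Set α).encard ≤ s.encard := Set.encard_le_encard (by
      rintro z (rfl | rfl | rfl) <;> assumption)
    rw [h3] at h4
    exact absurd (h4.trans hs) (by decide)

variable (ρ) in
/-- A choice of signs for the letters such that two letters with the same head and the same sign
are equal, or of the form `x⁻¹` and `y` with `xy` in `ρ`. -/
structure IsLetterSign (σ : Letter Q → Bool) : Prop where
  direct : ∀ x y : Quiver.Total Q, x.right = y.right → x ≠ y →
    σ (.direct x) ≠ σ (.direct y)
  inverse : ∀ x y : Quiver.Total Q, x.left = y.left → x ≠ y →
    σ (.inverse x) ≠ σ (.inverse y)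
  mixed : ∀ {a b c : Q} (y : a ⟶ b) (x : b ⟶ c), (⟨a, c, y.toPath.cons x⟩ : QPath Q) ∉ ρ →
    σ (.direct ⟨a, b, y⟩) ≠ σ (.inverse ⟨b, c, x⟩)

/-- Signs are chosen at each vertex `b` separately: `f` separates the arrows into `b` and `g` the
arrows out of `b`. The paths of length two through `b` outside `ρ` form a partial matching between
these arrows, so exchanging the values of `g`, if necessary, makes matched arrows have opposite
signs. -/
theorem IsStringAlgebra.exists_isLetterSign (hρ : IsStringAlgebra ρ) :
    ∃ σ : Letter Q → Bool, IsLetterSign ρ σ := by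
  choose f hf using fun v => Set.exists_injOn_bool (hρ.heads v)
  have hg : ∀ b : Q, ∃ g : Quiver.Total Q → Bool, Set.InjOn g {x | x.left = b} ∧
      ∀ {a c : Q} (y : a ⟶ b) (x : b ⟶ c), (⟨a, c, y.toPath.cons x⟩ : QPath Q) ∉ ρ →
        f b ⟨a, b, y⟩ ≠ g ⟨b, c, x⟩ := by
    intro b
    obtain ⟨g, hg⟩ := Set.exists_injOn_bool (hρ.tails b)
    by_cases h : ∃ (a c : Q) (y : a ⟶ b) (x : b ⟶ c), (⟨a, c, y.toPath.cons x⟩ : QPath Q) ∉ ρ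
    · obtain ⟨a, c, y, x, hyx⟩ := h
      -- With this `t` the twisted sign of `x` is the negative of the sign of `y`.
      let t : Bool := xor (f b ⟨a, b, y⟩) (!g ⟨b, c, x⟩)
      refine ⟨fun z => xor t (g z), fun z hz w hw hzw => hg hz hw (by simpa using hzw), ?_⟩
      intro a' c' y' x' h'
      by_cases hx : (⟨b, c, x⟩ : Quiver.Total Q) = ⟨b, c', x'⟩
      · cases hx
        have hy := hρ.unique_before x y y' hyx h'
        rw [← hy]
        simp [t]
      -- A second matched pair differs from the first in both arrows, so both signs change and
      -- remain opposite.
      · have hy : (⟨a, b, y⟩ : Quiver.Total Q) ≠ ⟨a', b, y'⟩ := fun hy => by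
          cases hy
          exact hx (hρ.unique_after y x x' hyx h')
        have h1 : f b ⟨a, b, y⟩ ≠ f b ⟨a', b, y'⟩ := fun h => hy (hf b rfl rfl h)
        have h2 : g ⟨b, c, x⟩ ≠ g ⟨b, c', x'⟩ := fun h => hx (hg rfl rfl h)
        revert h1 h2
        simp only [t]
        generalize f b ⟨a, b, y⟩ = p
        generalize f b ⟨a', b, y'⟩ = p'
        generalize g ⟨b, c, x⟩ = q
        generalize g ⟨b, c', x'⟩ = q'
        revert p p' q q'
        decide
    · exact ⟨g, hg, fun y x hyx => absurd ⟨_, _, y, x, hyx⟩ h⟩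
  choose g hg hfg using hg
  refine ⟨fun l => match l with
    | .direct x => f x.right x
    | .inverse x => g x.left x, ?_, ?_, ?_⟩
  · intro x y hxy hne h
    simp only [← hxy] at h
    exact hne (hf x.right rfl hxy.symm h)
  · intro x y hxy hne h
    simp only [← hxy] at h
    exact hne (hg x.left rfl hxy.symm h)
  · intro a b c y x h
    exact hfg b y x h

/-- Both letters leave the same position and so have the same head. If one is direct and the other
inverse, they come from a path of length two occurring in `C` or `C⁻¹`, which is not in `ρ`;
otherwise they are distinct by reducedness. -/
theorem IsLetterSign.ne {σ : Letter Q → Bool} (hσ : IsLetterSign ρ σ) {C : Word ρ} {i : ℤ}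
    {l l' : Letter Q} (h : C.letter i = some l) (h' : C.letter (i + 1) = some l') :
    σ l.inv ≠ σ l' := by
  have hred := C.reduced i l l' h h'
  have hcomp := C.composable i l l' h h'
  cases l with
  | direct x =>
    cases l' with
    | direct y =>
      obtain ⟨b, c, x⟩ := x
      obtain ⟨a, b', y⟩ := y
      cases hcomp
      refine (hσ.mixed y x fun hρ => C.no_relation _ hρ ⟨i, fun r hr => ?_⟩).symm
      have hr' : r < 2 := hr
      interval_cases r
      · simpa [arrowList, Quiver.Hom.toPath] using h
      · simpa [arrowList, Quiver.Hom.toPath] using h'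
    | inverse y =>
      exact hσ.inverse x y hcomp fun h => hred (by rw [h]; rfl)
  | inverse x =>
    cases l' with
    | direct y =>
      exact hσ.direct x y hcomp fun h => hred (by rw [h]; rfl)
    | inverse y =>
      obtain ⟨a, b, x⟩ := x
      obtain ⟨b', c, y⟩ := y
      cases hcomp
      refine hσ.mixed x y fun hρ => C.no_inverse_relation _ hρ ⟨i, fun r hr => ?_⟩
      have hr' : r < 2 := by simpa [arrowList, Quiver.Hom.toPath] using hr
      interval_cases r
      · simpa [arrowList, Quiver.Hom.toPath] using h
      · simpa [arrowList, Quiver.Hom.toPath] using h'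

theorem IsLetterSign.side_ne {σ : Letter Q → Bool} (hσ : IsLetterSign ρ σ) {C : Word ρ} {δ : Bool}
    {i : ℤ} {l l' : Letter Q} (h : C.side δ i = some l) (h' : C.side (!δ) i = some l') :
    σ l ≠ σ l' := by
  cases δ
  · obtain ⟨m, hm, rfl⟩ := Option.map_eq_some_iff.1 h
    exact hσ.ne hm h'
  · obtain ⟨m, hm, rfl⟩ := Option.map_eq_some_iff.1 h'
    exact (hσ.ne hm h).symm

end WordCombinatorics

/-! ## The order on half words -/

section HalfWords

variable {Q : Type*} [Quiver Q] {ρ : Set (QPath Q)}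

/-- The order on half words: they are equal, or where they first differ, the first one ends or
continues with an inverse letter, and the second one ends or continues with a direct letter. -/
def HalfLE (a b : ℕ → Option (Letter Q)) : Prop :=
  a = b ∨ ∃ r, (∀ s < r, a s = b s) ∧ a r ≠ b r ∧ (∀ x, a r ≠ some (Letter.direct x)) ∧
    ∀ x, b r ≠ some (Letter.inverse x)

/-- The order is lexicographic for inverse < end < direct. If both relations break off at the same
place, both half words end there and so agree after all. -/
theorem HalfLE.antisymm {a b : ℕ → Option (Letter Q)} (h : HalfLE a b) (h' : HalfLE b a) :
    a = b := by
  rcases h with h | ⟨r, hr, hne, ha, hb⟩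
  · exact h
  rcases h' with h' | ⟨s, hs, hne', hb', ha'⟩
  · exact h'.symm
  exfalso
  rcases lt_trichotomy r s with hrs | rfl | hrs
  · exact hne (hs r hrs).symm
  · have h1 : a r = none := by
      rcases h1 : a r with - | (x | x)
      exacts [rfl, absurd h1 (ha x), absurd h1 (ha' x)]
    have h2 : b r = none := by
      rcases h2 : b r with - | (x | x)
      exacts [rfl, absurd h2 (hb' x), absurd h2 (hb x)]
    exact hne (h1.trans h2.symm)
  · exact hne' (hr s hrs).symm

theorem HalfLE.trans {a b c : ℕ → Option (Letter Q)} (h : HalfLE a b) (h' : HalfLE b c) :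
    HalfLE a c := by
  rcases h with rfl | ⟨r, hr, hne, ha, hb⟩
  · exact h'
  rcases h' with rfl | ⟨s, hs, hne', hb', hc⟩
  · exact Or.inr ⟨r, hr, hne, ha, hb⟩
  rcases lt_trichotomy r s with hrs | rfl | hrs
  · refine Or.inr ⟨r, fun t ht => (hr t ht).trans (hs t (ht.trans hrs)), ?_, ha, ?_⟩
    · rwa [← hs r hrs]
    · rwa [← hs r hrs]
  · have h2 : b r = none := by
      rcases h2 : b r with - | (x | x)
      exacts [rfl, absurd h2 (hb' x), absurd h2 (hb x)]
    refine Or.inr ⟨r, fun t ht => (hr t ht).trans (hs t ht), fun h => ?_, ha, hc⟩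
    rcases h1 : a r with - | (x | x)
    · exact hne (h1.trans h2.symm)
    · exact ha x h1
    · exact hc x (h ▸ h1)
  · refine Or.inr ⟨s, fun t ht => (hr t (ht.trans hrs)).trans (hs t ht), ?_, ?_, hc⟩
    · rwa [hr s hrs]
    · rwa [hr s hrs]

namespace Word

variable (C D : Word ρ)

/-- The letters of a walk along `C` from the position `i` in the direction `δ`. -/
def half (δ : Bool) (i : ℤ) : ℕ → Option (Letter Q) := fun r => C.side δ (i + dirStep δ * r)

variable (σ : Letter Q → Bool)

/-- The sign of the side `δ` of the position `i` of `C`. -/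
def sideSign (δ : Bool) (i : ℤ) : Bool :=
  match C.side δ i, C.side (!δ) i with
  | some l, _ => σ l
  | none, some l => !σ l
  | none, none => δ

variable {C D σ}

theorem sideSign_of_side {δ : Bool} {i : ℤ} {l : Letter Q} (h : C.side δ i = some l) :
    C.sideSign σ δ i = σ l := by
  simp [sideSign, h]

/-- A side without a letter receives the sign left over by the other side, and `δ` if there are no
letters at all. Thus a side is determined by its sign, even at the end of a word. -/
theorem sideSign_not (hσ : IsLetterSign ρ σ) (δ : Bool) (i : ℤ) :
    C.sideSign σ (!δ) i = !C.sideSign σ δ i := by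
  cases h : C.side δ i with
  | some l =>
    cases h' : C.side (!δ) i with
    | some l' =>
      rw [sideSign_of_side h, sideSign_of_side h']
      exact Bool.eq_not_of_ne (hσ.side_ne h h').symm
    | none => simp [sideSign, h, h']
  | none =>
    cases h' : C.side (!δ) i with
    | some l' => simp [sideSign, h, h']
    | none => simp [sideSign, h, h']

theorem sideSign_xor (hσ : IsLetterSign ρ σ) (δ t : Bool) (i : ℤ) :
    C.sideSign σ (xor δ t) i = xor (C.sideSign σ δ i) t := by
  cases t
  · simp
  · simp [sideSign_not hσ]

variable (C D σ) in
/-- The comparison of a position of `C` with a position of `D`, by means of the half words of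
the same sign. -/
def Below (i j : ℤ) : Prop :=
  C.vertex i = D.vertex j ∧ ∀ δ δ', C.sideSign σ δ i = D.sideSign σ δ' j →
    HalfLE (C.half δ i) (D.half δ' j)

theorem exists_sideSign_eq (hσ : IsLetterSign ρ σ) (i : ℤ) (s : Bool) :
    ∃ δ, C.sideSign σ δ i = s := by
  refine ⟨xor true (xor (C.sideSign σ true i) s), ?_⟩
  rw [sideSign_xor hσ]
  simp

/-- Compare through the side of `j` that has the given sign. -/
theorem Below.trans (hσ : IsLetterSign ρ σ) {E : Word ρ} {i j l : ℤ} (h : Below C D σ i j)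
    (h' : Below D E σ j l) : Below C E σ i l := by
  refine ⟨h.1.trans h'.1, fun δ δ'' hδ => ?_⟩
  obtain ⟨δ', hδ'⟩ := exists_sideSign_eq (C := D) hσ j (C.sideSign σ δ i)
  exact (h.2 δ δ' hδ'.symm).trans (h'.2 δ' δ'' (hδ'.trans hδ))

/-- Positions that are comparable both ways have the same letters to both sides. -/
theorem Below.exists_flip (hσ : IsLetterSign ρ σ) {i j : ℤ} (h : Below C D σ i j)
    (h' : Below D C σ j i) : ∃ t : Bool, C.sideSign σ true i = D.sideSign σ (xor true t) j ∧
      ∀ δ, C.half δ i = D.half (xor δ t) j := by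
  -- The flip records whether the right-hand sides of `i` and `j` have opposite signs.
  have hs : ∀ δ, C.sideSign σ δ i =
      D.sideSign σ (xor δ (xor (C.sideSign σ true i) (D.sideSign σ true j))) j := by
    intro δ
    rw [sideSign_xor hσ]
    have h1 := sideSign_not (C := C) hσ true i
    have h2 := sideSign_not (C := D) hσ true j
    rw [Bool.not_true] at h1 h2
    cases δ
    · rw [h1, h2]
      cases C.sideSign σ true i <;> cases D.sideSign σ true j <;> rfl
    · cases C.sideSign σ true i <;> cases D.sideSign σ true j <;> rfl
  exact ⟨_, hs true, fun δ => (h.2 δ _ (hs δ)).antisymm (h'.2 _ δ (hs δ).symm)⟩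

theorem letter_eq_of_half_eq {i j : ℤ} (h : ∀ δ, C.half δ i = D.half δ j) (m : ℤ) :
    C.letter (i + m) = D.letter (j + m) := by
  rcases le_or_gt m 0 with hm | hm
  · have := congrFun (h false) (-m).toNat
    simp only [half, side, dirStep_false] at this
    rw [Int.toNat_of_nonneg (by omega)] at this
    have h' := congrArg (Option.map Letter.inv) this
    rw [Option.map_inv_inv, Option.map_inv_inv] at h'
    convert h' using 2 <;> ring
  · have := congrFun (h true) (m - 1).toNat
    simp only [half, side, dirStep_true] at this
    rw [Int.toNat_of_nonneg (by omega)] at this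
    convert this using 2 <;> ring

/-- The extra `1` arises because `C_i` sits between the positions `i - 1` and `i`, which a
reflection exchanges. -/
theorem letter_eq_of_half_eq_not {i j : ℤ} (h : ∀ δ, C.half δ i = D.half (!δ) j) (m : ℤ) :
    C.letter (i + m) = (D.letter (j + 1 - m)).map Letter.inv := by
  rcases le_or_gt m 0 with hm | hm
  · have := congrFun (h false) (-m).toNat
    simp only [half, side, dirStep_false, Bool.not_false, dirStep_true] at this
    rw [Int.toNat_of_nonneg (by omega)] at this
    have h' := congrArg (Option.map Letter.inv) this
    rw [Option.map_inv_inv] at h'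
    convert h' using 2
    · ring
    · congr 1; ring
  · have := congrFun (h true) (m - 1).toNat
    simp only [half, side, dirStep_true, Bool.not_true, dirStep_false] at this
    rw [Int.toNat_of_nonneg (by omega)] at this
    convert this using 2
    · ring
    · congr 1; ring

/-- By antisymmetry of the order the half words at `i` and `j` agree, either side by side or
crosswise; this gives a translation of `C` or of `C⁻¹` onto `D`. -/
theorem Below.equivalent (hσ : IsLetterSign ρ σ) {i j : ℤ} (hi : i ∈ C.shape.idx)
    (hj : j ∈ D.shape.idx) (h : Below C D σ i j) (h' : Below D C σ j i) : C.Equivalent D := by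
  obtain ⟨t, -, ht⟩ := h.exists_flip hσ h'
  cases t
  · exact equivalent_of_letter_eq hi hj (letter_eq_of_half_eq fun δ => by simpa using ht δ) h.1
  · have hl := letter_eq_of_half_eq_not (fun δ => by simpa using ht δ)
    refine equivalent_of_inv_equivalent
      (equivalent_of_letter_eq (i := C.shape.mirror - i) ?_ hj (fun m => ?_) ?_)
    · change _ ∈ C.shape.inv.idx
      rw [Shape.mem_idx_inv]
      simpa using hi
    · have h1 := hl (1 - m)
      simp only [inv]
      rw [show C.shape.mirror + 1 - (C.shape.mirror - i + m) = i + (1 - m) by ring, h1,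
        Option.map_inv_inv]
      congr 1; ring
    · rw [vertex_inv, h.1]

/-- The half words give a translation or a reflection of `C` taking `i` to `j`. A reflection is
impossible: at its centre a letter would be its own inverse, or two adjacent letters would be
inverse to each other. -/
theorem Below.sameAt (hσ : IsLetterSign ρ σ) {i j : ℤ} (hi : i ∈ C.shape.idx)
    (hj : j ∈ C.shape.idx) (h : Below C C σ i j) (h' : Below C C σ j i) : C.SameAt i j := by
  obtain ⟨t, hs, ht⟩ := h.exists_flip hσ h'
  cases t
  · exact ⟨hi, hj, letter_eq_of_half_eq fun δ => by simpa using ht δ⟩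
  · exfalso
    have hl : ∀ p q, p + q = i + j + 1 → C.letter p = (C.letter q).map Letter.inv := by
      intro p q hpq
      have := letter_eq_of_half_eq_not (fun δ => by simpa using ht δ) (p - i)
      rw [show i + (p - i) = p by ring, show j + 1 - (p - i) = q by linarith] at this
      exact this
    -- Here the reflection would exchange the two sides of one position, but these have opposite
    -- signs.
    by_cases hij : i = j
    · subst hij
      rw [Bool.xor_self, show false = !true from rfl, sideSign_not hσ] at hs
      simp at hs
    have hmem : ∀ p, min i j < p → p ≤ max i j → ∃ l, C.letter p = some l := by
      intro p h1 h2
      have hmin : min i j ∈ C.shape.idx := by rcases min_choice i j with h | h <;> rwa [h]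
      have hmax : max i j ∈ C.shape.idx := by rcases max_choice i j with h | h <;> rwa [h]
      exact Option.isSome_iff_exists.1 ((C.letter_isSome p).2
        ⟨C.shape.ordConnected_idx.out hmin hmax ⟨h1.le, h2⟩,
          C.shape.ordConnected_idx.out hmin hmax ⟨by omega, by omega⟩⟩)
    -- The reflection pairs the letters whose indices add up to `i + j + 1`, so the parity decides
    -- whether its centre is a letter or a position. The centre lies between `i` and `j`, where
    -- letters exist.
    obtain ⟨p, hp | hp⟩ := Int.even_or_odd' (i + j + 1)
    · obtain ⟨l, hl'⟩ := hmem p (by omega) (by omega)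
      have := hl p p (by omega)
      rw [hl'] at this
      exact l.inv_ne (Option.some.inj this).symm
    · obtain ⟨l, hl'⟩ := hmem (p + 1) (by omega) (by omega)
      have := hl p (p + 1) (by omega)
      rw [hl'] at this
      exact C.reduced p _ _ this hl' l.inv_inv

end Word

end HalfWords

/-! ## Modules with coordinates indexed by the positions of a word -/

section Coordinates

open QuiverAlgebra

variable {k : Type*} [Field k] {Q : Type*} [Quiver Q] {ρ : Set (QPath Q)}

variable (k) in
/-- Coordinates on a `Λ`-module `M` with respect to a word `C` and a coefficient module `V`: maps
`β i : V → M`, where `β i v` behaves like a multiple of the basis element `b_i` of `M(C)`, and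
coordinate functions `π i : M → V`. -/
structure WordCoord (C : Word ρ) (A V M : Type*) [CommRing A] [Algebra k A] [AddCommGroup V]
    [Module A V] [AddCommGroup M] [Module (OneAdjoined k ρ) M] where
  β : ℤ → V →+ M
  π : ℤ → M →+ V
  π_β_self : ∀ {i}, i ∈ C.shape.idx → ∀ v, π i (β i v) = v
  β_of_notMem : ∀ {i}, i ∉ C.shape.idx → ∀ v, β i v = 0
  π_of_notMem : ∀ {i}, i ∉ C.shape.idx → ∀ z, π i z = 0
  span : AddSubmonoid.closure (Set.range fun p : ℤ × V => β p.1 p.2) = ⊤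
  ext_zero : ∀ z, (∀ i, π i z = 0) → z = 0
  smul_β : ∀ (c : k) i v, (Unitization.inl c : OneAdjoined k ρ) • β i v =
    β i (algebraMap k A c • v)
  π_smul : ∀ (c : k) i z, π i ((Unitization.inl c : OneAdjoined k ρ) • z) =
    algebraMap k A c • π i z
  idem_β_of_eq : ∀ {w i}, C.vertex i = some w → ∀ v, (idem k ρ w : OneAdjoined k ρ) • β i v = β i v
  idem_β_of_ne : ∀ {w i}, C.vertex i ≠ some w → ∀ v, (idem k ρ w : OneAdjoined k ρ) • β i v = 0
  arrow_β : ∀ {x δ i}, C.side δ i = some (Letter.inverse x) → ∀ v,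
    (arrow k ρ x : OneAdjoined k ρ) • β i v = β (i + dirStep δ) v
  arrow_β_zero : ∀ {x i}, (∀ δ, C.side δ i ≠ some (Letter.inverse x)) → ∀ v,
    (arrow k ρ x : OneAdjoined k ρ) • β i v = 0

namespace WordCoord

variable {C D : Word ρ} {A A' A'' V V' V'' M M' M'' : Type*}
  [CommRing A] [Algebra k A] [AddCommGroup V] [Module A V]
  [CommRing A'] [Algebra k A'] [AddCommGroup V'] [Module A' V']
  [CommRing A''] [Algebra k A''] [AddCommGroup V''] [Module A'' V'']
  [AddCommGroup M] [Module (OneAdjoined k ρ) M]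
  [AddCommGroup M'] [Module (OneAdjoined k ρ) M']
  [AddCommGroup M''] [Module (OneAdjoined k ρ) M'']

theorem induction (B : WordCoord k C A V M) {P : M → Prop} (h0 : P 0)
    (hadd : ∀ x y, P x → P y → P (x + y)) (hβ : ∀ i v, P (B.β i v)) (z : M) : P z := by
  have hz : z ∈ AddSubmonoid.closure (Set.range fun p : ℤ × V => B.β p.1 p.2) := by
    rw [B.span]; trivial
  induction hz using AddSubmonoid.closure_induction with
  | mem z hz => obtain ⟨p, rfl⟩ := hz; exact hβ p.1 p.2
  | zero => exact h0
  | add x y _ _ hx hy => exact hadd x y hx hy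

theorem addHom_ext {N : Type*} [AddCommGroup N] (B : WordCoord k C A V M) {f g : M →+ N}
    (h : ∀ i v, f (B.β i v) = g (B.β i v)) (z : M) : f z = g z := by
  induction z using B.induction with
  | h0 => rw [map_zero, map_zero]
  | hadd x y hx hy => rw [map_add, map_add, hx, hy]
  | hβ i v => exact h i v

theorem isUnitalModule (B : WordCoord k C A V M) : IsUnitalModule k ρ M := by
  intro z
  induction z using B.induction with
  | h0 => exact ⟨∅, fun S' _ => smul_zero _⟩
  | hadd x y hx hy => exact IsUnitalModule.exists_common_add hx hy
  | hβ i v =>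
    by_cases hi : i ∈ C.shape.idx
    · obtain ⟨w, hw⟩ := C.exists_vertex hi
      refine ⟨{w}, fun S' hS' => ?_⟩
      have h' : ((∑ v ∈ S', idem k ρ v : QuiverAlgebra k ρ) : OneAdjoined k ρ) =
          ∑ v ∈ S', (idem k ρ v : OneAdjoined k ρ) :=
        map_sum (Unitization.inrHom k k (QuiverAlgebra k ρ)) _ S'
      rw [h', Finset.sum_smul, Finset.sum_eq_single_of_mem w (hS' (by simp)), B.idem_β_of_eq hw]
      intro u _ hu
      exact B.idem_β_of_ne (fun h => hu (Option.some.inj (h.symm.trans hw))) v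
    · exact ⟨∅, fun S' _ => by rw [B.β_of_notMem hi, smul_zero]⟩

theorem nontrivial (B : WordCoord k C A V M) [Nontrivial V] : Nontrivial M := by
  obtain ⟨v, hv⟩ := exists_ne (0 : V)
  refine nontrivial_of_ne (B.β 0 v) 0 fun h => hv ?_
  rw [← B.π_β_self C.shape.zero_mem_idx v, h, map_zero]

/-! ### Transport of coordinates -/

/-- The transport of coordinates along an isomorphism of modules. -/
noncomputable def map (B : WordCoord k C A V M) (e : M ≃ₗ[OneAdjoined k ρ] M') :
    WordCoord k C A V M' where
  β i := (e : M →+ M').comp (B.β i)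
  π i := (B.π i).comp (e.symm : M' →+ M)
  π_β_self hi v := by simpa using B.π_β_self hi v
  β_of_notMem hi v := by simpa using B.β_of_notMem hi v
  π_of_notMem hi z := by simpa using B.π_of_notMem hi (e.symm z)
  span := by
    have h := congrArg (AddSubmonoid.map (e : M →+ M')) B.span
    rw [AddMonoidHom.map_mclosure, ← Set.range_comp] at h
    refine h.trans (eq_top_iff.2 fun z _ => ⟨e.symm z, trivial, by simp⟩)
  ext_zero z hz := by simpa using B.ext_zero (e.symm z) hz
  smul_β c i v := by simpa using congrArg e (B.smul_β c i v)
  π_smul c i z := by simpa using B.π_smul c i (e.symm z)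
  idem_β_of_eq h v := by simpa using congrArg e (B.idem_β_of_eq h v)
  idem_β_of_ne h v := by simpa using congrArg e (B.idem_β_of_ne h v)
  arrow_β h v := by simpa using congrArg e (B.arrow_β h v)
  arrow_β_zero h v := by simpa using congrArg e (B.arrow_β_zero h v)

/-- The transport of coordinates along an identification of words. -/
def reindex (B : WordCoord k D A V M) (e : Word.Match C D) : WordCoord k C A V M where
  β i := B.β (e.pos i)
  π i := B.π (e.pos i)
  π_β_self hi v := B.π_β_self ((e.mem_iff _).1 hi) v
  β_of_notMem hi v := B.β_of_notMem (fun h => hi ((e.mem_iff _).2 h)) v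
  π_of_notMem hi z := B.π_of_notMem (fun h => hi ((e.mem_iff _).2 h)) z
  span := by
    rw [← B.span]
    congr 1
    ext z
    constructor
    · rintro ⟨⟨i, v⟩, rfl⟩
      exact ⟨(e.pos i, v), rfl⟩
    · rintro ⟨⟨j, v⟩, rfl⟩
      obtain ⟨i, rfl⟩ := e.pos_surjective j
      exact ⟨(i, v), rfl⟩
  ext_zero z hz := B.ext_zero z fun j => by
    obtain ⟨i, rfl⟩ := e.pos_surjective j
    exact hz i
  smul_β c i v := B.smul_β c _ v
  π_smul c i z := B.π_smul c _ z
  idem_β_of_eq h v := B.idem_β_of_eq ((e.vertex_eq _).symm.trans h) v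
  idem_β_of_ne h v := B.idem_β_of_ne (fun h' => h ((e.vertex_eq _).trans h')) v
  arrow_β h v := by
    rw [e.pos_step]
    exact B.arrow_β ((e.side_eq _ _).symm.trans h) v
  arrow_β_zero {x i} h v := B.arrow_β_zero (fun δ h' => h (xor δ e.flip) (by
    rw [e.side_eq, Bool.xor_assoc, Bool.xor_self, Bool.xor_false]; exact h')) v

/-! ### Isomorphisms from coordinates -/

/-- Both modules are images of the finitely supported families `ℤ →₀ V`. By `ext_zero` the relations
among the `β i v` are detected by the maps `π j ∘ β i`; as these correspond under `e`, the kernel of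
one map lies in that of the other. -/
theorem exists_linearMap (B : WordCoord k C A V M) (B' : WordCoord k C A' V' M') (e : V ≃+ V')
    (hc : ∀ (c : k) v, e (algebraMap k A c • v) = algebraMap k A' c • e v)
    (he : ∀ i j v, B'.π j (B'.β i (e v)) = e (B.π j (B.β i v))) :
    ∃ f : M →ₗ[OneAdjoined k ρ] M', ∀ i v, f (B.β i v) = B'.β i (e v) := by
  let Φ : (ℤ →₀ V) →+ M := Finsupp.liftAddHom B.β
  let Φ' : (ℤ →₀ V) →+ M' := Finsupp.liftAddHom fun i => (B'.β i).comp (e : V →+ V')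
  have hΦ : ∀ i v, Φ (Finsupp.single i v) = B.β i v := fun i v => by
    simp [Φ]
  have hΦ' : ∀ i v, Φ' (Finsupp.single i v) = B'.β i (e v) := fun i v => by
    simp [Φ']
  have hsurj : Function.Surjective Φ := fun z => by
    induction z using B.induction with
    | h0 => exact ⟨0, map_zero _⟩
    | hadd x y hx hy =>
      obtain ⟨a, rfl⟩ := hx
      obtain ⟨b, rfl⟩ := hy
      exact ⟨a + b, map_add _ _ _⟩
    | hβ i v => exact ⟨_, hΦ i v⟩
  have hπ : ∀ j w, B'.π j (Φ' w) = e (B.π j (Φ w)) := by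
    intro j w
    induction w using Finsupp.induction_linear with
    | zero => simp
    | add x y hx hy => simp only [map_add, hx, hy]
    | single i v => rw [hΦ, hΦ', he]
  have hker : Φ.ker ≤ Φ'.ker := fun w hw => by
    rw [AddMonoidHom.mem_ker] at hw ⊢
    refine B'.ext_zero _ fun j => ?_
    rw [hπ, hw, map_zero, map_zero]
  let f : M →+ M' := Φ.liftOfSurjective hsurj ⟨Φ', hker⟩
  have hf : ∀ i v, f (B.β i v) = B'.β i (e v) := fun i v => by
    rw [← hΦ, ← hΦ']
    exact AddMonoidHom.liftOfRightInverse_comp_apply Φ _ _ ⟨Φ', hker⟩ _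
  refine ⟨{ f with map_smul' := map_smul_of_generators f ?_ ?_ ?_ }, hf⟩
  · intro c m
    refine B.addHom_ext (f := f.comp (DistribSMul.toAddMonoidHom M (Unitization.inl c)))
      (g := (DistribSMul.toAddMonoidHom M' (Unitization.inl c)).comp f) (fun i v => ?_) m
    simp [B.smul_β, hf, hc, B'.smul_β]
  · intro w m
    refine B.addHom_ext (f := f.comp (DistribSMul.toAddMonoidHom M _))
      (g := (DistribSMul.toAddMonoidHom M' _).comp f) (fun i v => ?_) m
    simp only [AddMonoidHom.comp_apply, DistribSMul.toAddMonoidHom_apply, hf]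
    by_cases h : C.vertex i = some w
    · rw [B.idem_β_of_eq h, B'.idem_β_of_eq h, hf]
    · rw [B.idem_β_of_ne h, B'.idem_β_of_ne h, map_zero]
  · intro x m
    refine B.addHom_ext (f := f.comp (DistribSMul.toAddMonoidHom M _))
      (g := (DistribSMul.toAddMonoidHom M' _).comp f) (fun i v => ?_) m
    simp only [AddMonoidHom.comp_apply, DistribSMul.toAddMonoidHom_apply, hf]
    by_cases h : ∃ δ, C.side δ i = some (Letter.inverse x)
    · obtain ⟨δ, h⟩ := h
      rw [B.arrow_β h, B'.arrow_β h, hf]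
    · have h : ∀ δ, C.side δ i ≠ some (Letter.inverse x) := not_exists.1 h
      rw [B.arrow_β_zero h, B'.arrow_β_zero h, map_zero]

/-- Modules with the same coordinates are isomorphic. -/
theorem nonempty_linearEquiv (B : WordCoord k C A V M) (B' : WordCoord k C A' V' M') (e : V ≃+ V')
    (hc : ∀ (c : k) v, e (algebraMap k A c • v) = algebraMap k A' c • e v)
    (he : ∀ i j v, B'.π j (B'.β i (e v)) = e (B.π j (B.β i v))) :
    Nonempty (M ≃ₗ[OneAdjoined k ρ] M') := by
  obtain ⟨f, hf⟩ := exists_linearMap B B' e hc he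
  obtain ⟨g, hg⟩ := exists_linearMap B' B e.symm
    (fun c v => e.injective (by simp [hc])) (fun i j v => e.injective (by simp [← he]))
  refine ⟨LinearEquiv.ofLinearMap f g (LinearMap.ext fun z => ?_) (LinearMap.ext fun z => ?_)⟩
  · exact B'.addHom_ext (f := (f.comp g : M' →+ M')) (g := AddMonoidHom.id M')
      (fun i v => by simp [hf, hg]) z
  · exact B.addHom_ext (f := (g.comp f : M →+ M)) (g := AddMonoidHom.id M)
      (fun i v => by simp [hf, hg]) z

/-! ### Rigid coordinates -/

/-- Coordinates for which `β i` and `β j` are independent, unless `C` looks the same at `i` and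
`j`. -/
structure Rigid (B : WordCoord k C A V M) : Prop where
  π_β_of_not : ∀ {i j}, ¬ C.SameAt i j → ∀ v, B.π i (B.β j v) = 0
  β_π_β : ∀ {i j}, C.SameAt i j → ∀ v, B.β i (B.π i (B.β j v)) = B.β j v
  π_β_add_one : ∀ {i j}, C.SameAt i j → i + 1 ∈ C.shape.idx → j + 1 ∈ C.shape.idx → ∀ v,
    B.π (i + 1) (B.β (j + 1) v) = B.π i (B.β j v)

theorem Rigid.map {B : WordCoord k C A V M} (hB : B.Rigid) (e : M ≃ₗ[OneAdjoined k ρ] M') :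
    (B.map e).Rigid where
  π_β_of_not h v := by simpa [WordCoord.map] using hB.π_β_of_not h v
  β_π_β h v := by simpa [WordCoord.map] using hB.β_π_β h v
  π_β_add_one h h1 h2 v := by simpa [WordCoord.map] using hB.π_β_add_one h h1 h2 v

namespace Rigid

variable {B : WordCoord k C A V M} (hB : B.Rigid)

include hB

theorem π_β_step {i j : ℤ} (h : C.SameAt i j) {δ : Bool} {l : Letter Q}
    (hl : C.side δ i = some l) (v : V) :
    B.π (i + dirStep δ) (B.β (j + dirStep δ) v) = B.π i (B.β j v) := by
  have h' := h.step hl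
  cases δ
  · have := hB.π_β_add_one h' (by simpa using h.1) (by simpa using h.2.1) v
    simpa using this.symm
  · exact hB.π_β_add_one h h'.1 h'.2.1 v

/-- This is `arrow_β` read off in coordinates. An element `β i v` that `x` carries to the class of
`j` arrives along a letter `x` of `j`, and only the side `δ` of `j` has that letter. -/
theorem π_arrow {x : Quiver.Total Q} {δ : Bool} {j : ℤ}
    (h : C.side δ j = some (Letter.direct x)) (z : M) :
    B.π j ((arrow k ρ x : OneAdjoined k ρ) • z) = B.π (j + dirStep δ) z := by
  refine B.addHom_ext (f := (B.π j).comp (DistribSMul.toAddMonoidHom M _))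
    (g := B.π (j + dirStep δ)) (fun i v => ?_) z
  simp only [AddMonoidHom.comp_apply, DistribSMul.toAddMonoidHom_apply]
  have h' : C.side (!δ) (j + dirStep δ) = some (Letter.inverse x) := Word.side_step_of_eq h
  by_cases hs : C.SameAt (j + dirStep δ) i
  · have hi : C.side (!δ) i = some (Letter.inverse x) := (hs.side _).symm.trans h'
    rw [B.arrow_β hi, ← hB.π_β_step hs h', dirStep_not, add_neg_cancel_right]
  · rw [hB.π_β_of_not hs]
    by_cases hx : ∃ δ', C.side δ' i = some (Letter.inverse x)
    · obtain ⟨δ', hδ'⟩ := hx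
      rw [B.arrow_β hδ']
      refine hB.π_β_of_not (fun hs' => hs ?_) v
      have h1 : C.side (!δ') (i + dirStep δ') = some (Letter.direct x) :=
        Word.side_step_of_eq hδ'
      have h2 : (!δ') = δ := Word.eq_of_side_eq h ((hs'.side _).trans h1)
      have h3 := hs'.step h
      rwa [← h2, dirStep_not, add_neg_cancel_right, ← dirStep_not, h2] at h3
    · rw [B.arrow_β_zero (not_exists.1 hx), map_zero]

theorem π_arrow_zero {x : Quiver.Total Q} {j : ℤ}
    (h : ∀ δ, C.side δ j ≠ some (Letter.direct x)) (z : M) :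
    B.π j ((arrow k ρ x : OneAdjoined k ρ) • z) = 0 := by
  refine B.addHom_ext (f := (B.π j).comp (DistribSMul.toAddMonoidHom M _))
    (g := 0) (fun i v => ?_) z
  simp only [AddMonoidHom.comp_apply, DistribSMul.toAddMonoidHom_apply, AddMonoidHom.zero_apply]
  by_cases hx : ∃ δ', C.side δ' i = some (Letter.inverse x)
  · obtain ⟨δ', hδ'⟩ := hx
    rw [B.arrow_β hδ']
    exact hB.π_β_of_not (fun hs =>
      h (!δ') ((hs.side _).trans (Word.side_step_of_eq hδ'))) v
  · rw [B.arrow_β_zero (not_exists.1 hx), map_zero]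

theorem π_idem_of_ne {w : Q} {j : ℤ} (h : C.vertex j ≠ some w) (z : M) :
    B.π j ((idem k ρ w : OneAdjoined k ρ) • z) = 0 := by
  refine B.addHom_ext (f := (B.π j).comp (DistribSMul.toAddMonoidHom M _))
    (g := 0) (fun i v => ?_) z
  simp only [AddMonoidHom.comp_apply, DistribSMul.toAddMonoidHom_apply, AddMonoidHom.zero_apply]
  by_cases hi : C.vertex i = some w
  · rw [B.idem_β_of_eq hi]
    exact hB.π_β_of_not (fun hs => h (hs.vertex.trans hi)) v
  · rw [B.idem_β_of_ne hi, map_zero]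

theorem π_β_π {i j : ℤ} (h : C.SameAt i j) (z : M) : B.π i (B.β j (B.π j z)) = B.π i z := by
  refine B.addHom_ext (f := ((B.π i).comp (B.β j)).comp (B.π j)) (g := B.π i) (fun l v => ?_) z
  simp only [AddMonoidHom.comp_apply]
  by_cases hs : C.SameAt j l
  · rw [hB.β_π_β hs]
  · rw [hB.π_β_of_not hs, map_zero, map_zero,
      hB.π_β_of_not fun h' => hs (h.symm.trans h')]

/-- Every element is a finite sum of its components at inequivalent positions, among which one
position can be prescribed. -/
theorem exists_eq_sum {i : ℤ} (hi : i ∈ C.shape.idx) (z : M) :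
    ∃ F : Finset ℤ, i ∈ F ∧ (∀ j ∈ F, j ∈ C.shape.idx) ∧
      (∀ j ∈ F, ∀ l ∈ F, C.SameAt j l → j = l) ∧ z = ∑ j ∈ F, B.β j (B.π j z) := by
  classical
  -- A choice of representatives of the classes of `SameAt` in which `i` represents its own class.
  let r : ℤ → ℤ := fun j => Classical.epsilon fun s => C.SameAt s j ∧ (C.SameAt i j → s = i)
  have hr : ∀ j ∈ C.shape.idx, C.SameAt (r j) j ∧ (C.SameAt i j → r j = i) := fun j hj =>
    Classical.epsilon_spec (p := fun s => C.SameAt s j ∧ (C.SameAt i j → s = i)) <| by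
      by_cases h : C.SameAt i j
      · exact ⟨i, h, fun _ => rfl⟩
      · exact ⟨j, Word.SameAt.refl hj, fun h' => absurd h' h⟩
  have hrr : ∀ {j l}, C.SameAt j l → r j = r l := fun {j l} h => by
    simp only [r]
    congr 1
    funext s
    have h1 : C.SameAt s j ↔ C.SameAt s l := ⟨fun h' => h'.trans h, fun h' => h'.trans h.symm⟩
    have h2 : C.SameAt i j ↔ C.SameAt i l := ⟨fun h' => h'.trans h, fun h' => h'.trans h.symm⟩
    rw [h1, h2]
  -- Any larger set of representatives must serve as well, so that the expansions of two elements
  -- can be added over a common set.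
  have key : ∃ F : Finset ℤ, (∀ j ∈ F, j ∈ C.shape.idx ∧ r j = j) ∧ ∀ F' : Finset ℤ, F ⊆ F' →
      (∀ j ∈ F', j ∈ C.shape.idx ∧ r j = j) → z = ∑ j ∈ F', B.β j (B.π j z) := by
    induction z using B.induction with
    | h0 => exact ⟨∅, by simp, fun F' _ _ => by simp⟩
    | hadd x y hx hy =>
      obtain ⟨F, hF, hF'⟩ := hx
      obtain ⟨G, hG, hG'⟩ := hy
      refine ⟨F ∪ G, fun j hj => (Finset.mem_union.1 hj).elim (hF j) (hG j), fun F' h h' => ?_⟩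
      simp only [map_add, Finset.sum_add_distrib]
      rw [← hF' F' (Finset.union_subset_left h) h', ← hG' F' (Finset.union_subset_right h) h']
    | hβ l v =>
      by_cases hl : l ∈ C.shape.idx
      · have hs := (hr l hl).1
        refine ⟨{r l}, fun j hj => ?_, fun F' h h' => ?_⟩
        · rw [Finset.mem_singleton.1 hj]
          exact ⟨hs.1, hrr hs⟩
        · rw [Finset.sum_eq_single_of_mem (r l) (h (by simp)), hB.β_π_β hs]
          intro j hj hne
          rw [hB.π_β_of_not, map_zero]
          intro h''
          exact hne ((h' j hj).2.symm.trans (hrr h''))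
      · exact ⟨∅, by simp, fun F' _ _ => by simp [B.β_of_notMem hl]⟩
  obtain ⟨F, hF, hF'⟩ := key
  have hins : ∀ j ∈ insert i F, j ∈ C.shape.idx ∧ r j = j := fun j hj => by
    rcases Finset.mem_insert.1 hj with rfl | hj
    · exact ⟨hi, (hr j hi).2 (Word.SameAt.refl hi)⟩
    · exact hF j hj
  refine ⟨insert i F, Finset.mem_insert_self _ _, fun j hj => (hins j hj).1, ?_,
    hF' _ (Finset.subset_insert _ _) hins⟩
  intro j hj l hl h
  rw [← (hins j hj).2, ← (hins l hl).2, hrr h]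

end Rigid

/-- A reflection turns a step to the right into one to the left, so the last condition is taken from
`π_β_step`, which covers both directions. -/
theorem Rigid.reindex {B : WordCoord k D A V M} (hB : B.Rigid) (e : Word.Match C D) :
    (B.reindex e).Rigid := by
  have hs : ∀ {i j}, C.SameAt i j ↔ D.SameAt (e.pos i) (e.pos j) := e.sameAt_iff
  refine ⟨fun h v => hB.π_β_of_not (fun h' => h (hs.2 h')) v, fun h v => hB.β_π_β (hs.1 h) v,
    fun {i j} h h1 h2 v => ?_⟩
  obtain ⟨l, hl⟩ := C.exists_side (δ := true) h.1 h1
  have h3 := hB.π_β_step (hs.1 h) ((e.side_eq _ _).symm.trans hl) v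
  rw [← e.pos_step, ← e.pos_step] at h3
  exact h3

end WordCoord

end Coordinates

/-! ## Homomorphisms are triangular -/

section Triangular

open QuiverAlgebra

variable {k : Type*} [Field k] {Q : Type*} [Quiver Q] {ρ : Set (QPath Q)}

/-- Index sets are convex, so a walk does not resume after it has ended. -/
theorem Word.half_isSome_of_le {C : Word ρ} {δ : Bool} {i : ℤ} (hi : i ∈ C.shape.idx) {r s : ℕ}
    (hrs : r ≤ s) {l : Letter Q} (h : C.half δ i s = some l) : ∃ l', C.half δ i r = some l' := by
  have h1 := (Word.mem_of_side h).2
  have hconv : ∀ t : ℤ, 0 ≤ t → t ≤ s + 1 → i + dirStep δ * t ∈ C.shape.idx := by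
    intro t h0 ht
    cases δ
    · simp only [dirStep_false] at h1 ⊢
      exact C.shape.ordConnected_idx.out h1 hi ⟨by omega, by omega⟩
    · simp only [dirStep_true] at h1 ⊢
      exact C.shape.ordConnected_idx.out hi h1 ⟨by omega, by omega⟩
  refine Word.exists_side (hconv r (by omega) (by omega)) ?_
  have := hconv (r + 1) (by omega) (by omega)
  rwa [mul_add, mul_one, ← add_assoc] at this

namespace WordCoord

variable {C D : Word ρ} {A A' A'' V V' V'' M M' M'' : Type*}
  [CommRing A] [Algebra k A] [AddCommGroup V] [Module A V]
  [CommRing A'] [Algebra k A'] [AddCommGroup V'] [Module A' V']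
  [CommRing A''] [Algebra k A''] [AddCommGroup V''] [Module A'' V'']
  [AddCommGroup M] [Module (OneAdjoined k ρ) M]
  [AddCommGroup M'] [Module (OneAdjoined k ρ) M']
  [AddCommGroup M''] [Module (OneAdjoined k ρ) M'']

section

variable (B : WordCoord k C A V M) {B' : WordCoord k D A' V' M'} (hB' : B'.Rigid)
  (f : M →ₗ[OneAdjoined k ρ] M')

include hB'

/-- The entries of a homomorphism do not change along a common letter. -/
theorem entry_step {i j : ℤ} {δ δ' : Bool} {l : Letter Q} (h : C.side δ i = some l)
    (h' : D.side δ' j = some l) (v : V) :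
    B'.π (j + dirStep δ') (f (B.β (i + dirStep δ) v)) = B'.π j (f (B.β i v)) := by
  have hs := Word.side_step_of_eq h
  have hs' := Word.side_step_of_eq h'
  cases l with
  | direct x =>
    have h1 := B.arrow_β hs v
    rw [dirStep_not, add_neg_cancel_right] at h1
    rw [← h1, map_smul, hB'.π_arrow h']
  | inverse x =>
    rw [← B.arrow_β h, map_smul, hB'.π_arrow hs', dirStep_not, add_neg_cancel_right]

variable {σ : Letter Q → Bool} (hσ : IsLetterSign ρ σ)

include hσ

/-- Here `β i v` is `x` times an element, and so is its image. A nonzero coordinate of this image at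
`j` requires a letter `x` at `j`, and its sign places it on the side `δ'`. -/
theorem side_eq_of_direct {i j : ℤ} {δ δ' : Bool} {v : V} (hne : B'.π j (f (B.β i v)) ≠ 0)
    (hs : C.sideSign σ δ i = D.sideSign σ δ' j) {x : Quiver.Total Q}
    (h : C.side δ i = some (Letter.direct x)) : D.side δ' j = some (Letter.direct x) := by
  have h1 := B.arrow_β (Word.side_step_of_eq h) v
  rw [dirStep_not, add_neg_cancel_right] at h1
  rw [← h1, map_smul] at hne
  by_contra hD
  refine hne (hB'.π_arrow_zero (fun δ'' h'' => ?_) _)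
  by_cases hδ : δ'' = δ'
  · exact hD (hδ ▸ h'')
  · have h2 := Word.sideSign_of_side (σ := σ) h''
    rw [Bool.eq_not_of_ne hδ, Word.sideSign_not hσ, ← hs, Word.sideSign_of_side h] at h2
    simp at h2

/-- Dually, the coordinate at `j` can be read off after multiplication by `x`, so `x` must not kill
`β i v`. The sign of the letter `x⁻¹` then determines the side. -/
theorem side_eq_of_inverse {i j : ℤ} {δ δ' : Bool} {v : V} (hne : B'.π j (f (B.β i v)) ≠ 0)
    (hs : C.sideSign σ δ i = D.sideSign σ δ' j) {x : Quiver.Total Q}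
    (h : D.side δ' j = some (Letter.inverse x)) : C.side δ i = some (Letter.inverse x) := by
  by_contra hC
  refine hne ?_
  have h1 := hB'.π_arrow (Word.side_step_of_eq h) (f (B.β i v))
  rw [dirStep_not, add_neg_cancel_right] at h1
  rw [← h1, ← map_smul, B.arrow_β_zero, map_zero, map_zero]
  intro δ'' h''
  by_cases hδ : δ'' = δ
  · exact hC (hδ ▸ h'')
  · have h2 := Word.sideSign_of_side (σ := σ) h''
    rw [Bool.eq_not_of_ne hδ, Word.sideSign_not hσ, hs, Word.sideSign_of_side h] at h2
    simp at h2

/-- If a homomorphism has a nonzero entry between two positions, then these are comparable. -/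
theorem below_of_entry_ne_zero {i j : ℤ} {v : V} (hne : B'.π j (f (B.β i v)) ≠ 0) :
    Word.Below C D σ i j := by
  have hi : i ∈ C.shape.idx := by
    by_contra hi
    rw [B.β_of_notMem hi, map_zero, map_zero] at hne
    exact hne rfl
  have hj : j ∈ D.shape.idx := by
    by_contra hj
    exact hne (B'.π_of_notMem hj _)
  refine ⟨?_, fun δ δ' hs => ?_⟩
  · obtain ⟨w, hw⟩ := C.exists_vertex hi
    by_contra hv
    refine hne ?_
    rw [← B.idem_β_of_eq hw, map_smul]
    exact hB'.π_idem_of_ne (fun h => hv (hw.trans h.symm)) _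
  · classical
    by_cases heq : C.half δ i = D.half δ' j
    · exact Or.inl heq
    have hex : ∃ r, C.half δ i r ≠ D.half δ' j r := by
      by_contra hcon
      push Not at hcon
      exact heq (funext hcon)
    obtain ⟨r, hr, hlt⟩ : ∃ r, C.half δ i r ≠ D.half δ' j r ∧
        ∀ s < r, C.half δ i s = D.half δ' j s :=
      ⟨Nat.find hex, Nat.find_spec hex, fun s hs => not_not.1 (Nat.find_min hex hs)⟩
    -- At the first difference at least one of the walks goes on, so both have letters before it.
    have hsome : ∀ s < r, ∃ l, C.half δ i s = some l := by
      intro s hs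
      cases h1 : C.half δ i r with
      | some l => exact Word.half_isSome_of_le hi hs.le h1
      | none =>
        cases h2 : D.half δ' j r with
        | some l => rw [hlt s hs]; exact Word.half_isSome_of_le hj hs.le h2
        | none => exact absurd (h1.trans h2.symm) hr
    -- Along the common letters the entry stays the same and the sides stay matched: looking back,
    -- both walks see `l.inv`, so their forward sides have the same sign.
    have hwalk : ∀ s ≤ r,
        B'.π (j + dirStep δ' * s) (f (B.β (i + dirStep δ * s) v)) ≠ 0 ∧
        C.sideSign σ δ (i + dirStep δ * s) = D.sideSign σ δ' (j + dirStep δ' * s) := by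
      intro s
      induction s with
      | zero => intro _; simpa using ⟨hne, hs⟩
      | succ s ih =>
        intro hsr
        obtain ⟨h1, h2⟩ := ih (by omega)
        obtain ⟨l, hl⟩ := hsome s (by omega)
        have hl' := (hlt s (by omega)).symm.trans hl
        have e1 : i + dirStep δ * ((s + 1 : ℕ) : ℤ) = i + dirStep δ * s + dirStep δ := by
          push_cast; ring
        have e2 : j + dirStep δ' * ((s + 1 : ℕ) : ℤ) = j + dirStep δ' * s + dirStep δ' := by
          push_cast; ring
        rw [e1, e2]
        refine ⟨by rwa [entry_step B hB' f hl hl'], ?_⟩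
        have h3 := Word.sideSign_of_side (σ := σ) (Word.side_step_of_eq hl)
        have h4 := Word.sideSign_of_side (σ := σ) (Word.side_step_of_eq hl')
        rw [Word.sideSign_not hσ] at h3 h4
        exact Bool.not_inj (h3.trans h4.symm)
    obtain ⟨h1, h2⟩ := hwalk r le_rfl
    -- A direct letter of `C`, or an inverse letter of `D`, would have to occur in the other word as
    -- well, and there would be no difference at `r`.
    refine Or.inr ⟨r, hlt, hr, fun x hx => hr ?_, fun x hx => hr ?_⟩
    · exact hx.trans (side_eq_of_direct B hB' f hσ h1 h2 hx).symm
    · exact (side_eq_of_inverse B hB' f hσ h1 h2 hx).trans hx.symm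

end

variable {σ : Letter Q → Bool} (hσ : IsLetterSign ρ σ)

include hσ in
/-- Modules with coordinates for two words are isomorphic only if the words are equivalent. -/
theorem equivalent_of_linearEquiv [Nontrivial V] {B : WordCoord k C A V M} (hB : B.Rigid)
    {B' : WordCoord k D A' V' M'} (hB' : B'.Rigid) (φ : M ≃ₗ[OneAdjoined k ρ] M') :
    C.Equivalent D := by
  obtain ⟨v, hv⟩ := exists_ne (0 : V)
  have h0 := C.shape.zero_mem_idx
  obtain ⟨F, -, hF, -, hsum⟩ := hB'.exists_eq_sum D.shape.zero_mem_idx (φ (B.β 0 v))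
  -- Expand `v = π 0 (φ⁻¹ (φ (β 0 v)))` over positions of `D`. A nonzero summand passes through a
  -- nonzero entry of `φ` and one of `φ⁻¹` between the same two positions.
  have h1 : ∑ j ∈ F, B.π 0 (φ.symm (B'.β j (B'.π j (φ (B.β 0 v))))) = v := by
    rw [← map_sum, ← map_sum, ← hsum, LinearEquiv.symm_apply_apply, B.π_β_self h0]
  obtain ⟨j, hj, hne⟩ : ∃ j ∈ F, B.π 0 (φ.symm (B'.β j (B'.π j (φ (B.β 0 v))))) ≠ 0 := by
    by_contra hcon
    push Not at hcon
    exact hv (h1.symm.trans (Finset.sum_eq_zero hcon))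
  have hne' : B'.π j (φ (B.β 0 v)) ≠ 0 := fun h => hne (by
    rw [h, map_zero, map_zero, map_zero])
  exact (below_of_entry_ne_zero B hB' (φ : M →ₗ[OneAdjoined k ρ] M') hσ hne').equivalent hσ h0
    (hF j hj) (below_of_entry_ne_zero B' hB (φ.symm : M' →ₗ[OneAdjoined k ρ] M) hσ hne)

/-! ### The diagonal of a homomorphism -/

section Diagonal

variable {B : WordCoord k C A V M} (hB : B.Rigid) {B' : WordCoord k C A' V' M'} (hB' : B'.Rigid)
  {B'' : WordCoord k C A'' V'' M''} (hB'' : B''.Rigid)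

variable (B B') in
/-- The diagonal entry of a homomorphism at the position `0`. -/
noncomputable def diag (f : M →ₗ[OneAdjoined k ρ] M') : V →+ V' :=
  ((B'.π 0).comp (f : M →+ M')).comp (B.β 0)

theorem diag_apply (f : M →ₗ[OneAdjoined k ρ] M') (v : V) :
    diag B B' f v = B'.π 0 (f (B.β 0 v)) := rfl

theorem diag_smul (f : M →ₗ[OneAdjoined k ρ] M') (c : k) (v : V) :
    diag B B' f (algebraMap k A c • v) = algebraMap k A' c • diag B B' f v := by
  rw [diag_apply, diag_apply, ← B.smul_β, map_smul, B'.π_smul]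

include hB' in
/-- All diagonal entries of a homomorphism are equal. -/
theorem entry_self_eq_diag (f : M →ₗ[OneAdjoined k ρ] M') {i : ℤ} (hi : i ∈ C.shape.idx) (v : V) :
    B'.π i (f (B.β i v)) = diag B B' f v := by
  -- Walk from `0` along `C` with both indices of the entry at once.
  have key : ∀ δ : Bool, ∀ n : ℕ, dirStep δ * n ∈ C.shape.idx →
      B'.π (dirStep δ * n) (f (B.β (dirStep δ * n) v)) = diag B B' f v := by
    intro δ n
    induction n with
    | zero => intro _; simp [diag_apply]
    | succ n ih =>
      intro h
      have h' : dirStep δ * (n : ℤ) ∈ C.shape.idx := by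
        cases δ
        · exact C.shape.ordConnected_idx.out h C.shape.zero_mem_idx
            ⟨by simp, by simp⟩
        · exact C.shape.ordConnected_idx.out C.shape.zero_mem_idx h
            ⟨by simp, by simp⟩
      have e : dirStep δ * ((n + 1 : ℕ) : ℤ) = dirStep δ * n + dirStep δ := by push_cast; ring
      rw [e] at h ⊢
      obtain ⟨l, hl⟩ := Word.exists_side h' h
      rw [entry_step B hB' f hl hl, ih h']
  rcases Int.eq_nat_or_neg i with ⟨n, rfl | rfl⟩
  · simpa using key true n (by simpa using hi)
  · simpa using key false n (by simpa using hi)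

include hB hB' in
/-- The diagonal of a homomorphism is compatible with the translations that fix the word. -/
theorem diag_π_β (f : M →ₗ[OneAdjoined k ρ] M') {i j : ℤ} (h : C.SameAt i j) (v : V) :
    diag B B' f (B.π i (B.β j v)) = B'.π i (B'.β j (diag B B' f v)) := by
  -- Take the left diagonal entry at `i` and the right one at `j`: both sides become the coordinate
  -- at `i` of `f (β j v)`.
  rw [← entry_self_eq_diag hB' f h.1, ← entry_self_eq_diag hB' f h.2.1, hB.β_π_β h, hB'.π_β_π h]

include hB' hB'' hσ in
/-- The diagonal is multiplicative. -/
theorem diag_comp (g : M' →ₗ[OneAdjoined k ρ] M'') (f : M →ₗ[OneAdjoined k ρ] M') (v : V) :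
    diag B B'' (g.comp f) v = diag B' B'' g (diag B B' f v) := by
  have h0 := C.shape.zero_mem_idx
  obtain ⟨F, h0F, hF, hFF, hsum⟩ := hB'.exists_eq_sum h0 (f (B.β 0 v))
  have h1 : diag B B'' (g.comp f) v =
      ∑ j ∈ F, B''.π 0 (g (B'.β j (B'.π j (f (B.β 0 v))))) := by
    rw [← map_sum, ← map_sum, ← hsum]; rfl
  rw [h1, Finset.sum_eq_single_of_mem 0 h0F]
  · rfl
  · intro j hj hj0
    -- A nonzero term makes `0` and `j` comparable both ways, so they are in the same class; `F`
    -- contains only one position of each class.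
    by_contra hne
    have hne' : B'.π j (f (B.β 0 v)) ≠ 0 := fun h => hne (by
      rw [h, map_zero, map_zero, map_zero])
    exact hj0 (hFF j hj 0 h0F ((below_of_entry_ne_zero B' hB'' g hσ hne).sameAt hσ (hF j hj) h0
      (below_of_entry_ne_zero B hB' f hσ hne')))

include hB hσ in
/-- An endomorphism with zero diagonal fixes no nonzero element. -/
theorem eq_zero_of_diag_eq_zero (f : M →ₗ[OneAdjoined k ρ] M) (hf : diag B B f = 0) {z : M}
    (hz : f z = z) : z = 0 := by
  classical
  obtain ⟨F, -, hF, hFF, hsum⟩ := hB.exists_eq_sum C.shape.zero_mem_idx z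
  by_contra hne
  -- The support of `z` among the representatives; a minimal position in it will give the
  -- contradiction.
  let G := F.filter fun j => B.π j z ≠ 0
  have hG : G.Nonempty := by
    by_contra hG
    refine hne (hsum.trans (Finset.sum_eq_zero fun j hj => ?_))
    have hj' : j ∉ G := fun h => hG ⟨j, h⟩
    have h' : B.π j z = 0 := by
      by_contra h'
      exact hj' (Finset.mem_filter.2 ⟨hj, h'⟩)
    rw [h', map_zero]
  let r : G → G → Prop := fun i j => Word.Below C C σ i j ∧ ¬ Word.Below C C σ j i
  have : IsTrans G r := ⟨fun a b c hab hbc =>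
    ⟨hab.1.trans hσ hbc.1, fun h => hab.2 (hbc.1.trans hσ h)⟩⟩
  have : Std.Irrefl r := ⟨fun a ha => ha.2 ha.1⟩
  obtain ⟨g, hg⟩ := hG
  obtain ⟨⟨j, hj⟩, -, hmin⟩ :=
    (Finite.wellFounded_of_trans_of_irrefl r).has_min Set.univ ⟨⟨g, hg⟩, trivial⟩
  obtain ⟨hjF, hjz⟩ := Finset.mem_filter.1 hj
  refine hjz ?_
  -- A nonzero term comes from a position `l` of the support below `j`. By minimality `j` is also
  -- below `l`, so `l = j`, and the entry is the diagonal one, which is zero.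
  have h1 : B.π j z = ∑ l ∈ F, B.π j (f (B.β l (B.π l z))) := by
    rw [← map_sum, ← map_sum, ← hsum, hz]
  rw [h1]
  refine Finset.sum_eq_zero fun l hl => ?_
  by_contra hent
  have hlz : B.π l z ≠ 0 := fun h => hent (by rw [h, map_zero, map_zero, map_zero])
  have hlG : l ∈ G := Finset.mem_filter.2 ⟨hl, hlz⟩
  have hlj := below_of_entry_ne_zero B hB f hσ hent
  have hjl : Word.Below C C σ j l := by
    by_contra hjl
    exact hmin ⟨l, hlG⟩ trivial ⟨hlj, hjl⟩
  have heq := hFF l hl j hjF (hlj.sameAt hσ (hF l hl) (hF j hjF) hjl)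
  subst heq
  rw [entry_self_eq_diag hB f (hF l hl), hf] at hent
  exact hent rfl

include hB hσ in
/-- A module with coordinates is indecomposable if its coefficient module has only trivial
idempotents. -/
theorem isIndecomposableModule [Nontrivial V]
    (hV : ∀ d : V →+ V, (∀ (c : k) v, d (algebraMap k A c • v) = algebraMap k A c • d v) →
      (∀ i j v, C.SameAt i j → d (B.π i (B.β j v)) = B.π i (B.β j (d v))) →
      (∀ v, d (d v) = d v) → d = 0 ∨ d = AddMonoidHom.id V) :
    IsIndecomposableModule (OneAdjoined k ρ) M := by
  refine ⟨B.nontrivial, fun N N' hN => ?_⟩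
  -- The projection onto `N` fixes every element of `N`.
  have hid : ∀ {N N' : Submodule (OneAdjoined k ρ) M} (h : IsCompl N N'),
      diag B B (N.projection N' h) = 0 → N = ⊥ := by
    intro N N' h hd
    refine (Submodule.eq_bot_iff _).2 fun z hz => eq_zero_of_diag_eq_zero hσ hB _ hd ?_
    exact Submodule.projection_apply_of_mem_left h hz
  rcases hV (diag B B (N.projection N' hN)) (diag_smul _)
    (fun i j v h => diag_π_β hB hB _ h v) (fun v => by
      rw [← diag_comp hσ hB hB]
      congr 2
      ext z
      simp) with h | h
  · exact Or.inl (hid hN h)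
  · refine Or.inr (hid hN.symm (AddMonoidHom.ext fun v => ?_))
    -- The two projections add up to the identity, so if one has diagonal one, the other has
    -- diagonal zero.
    have h1 := congrArg (B.π 0) (Submodule.projection_add_projection_eq_self hN (B.β 0 v))
    rw [map_add, ← diag_apply, ← diag_apply, h, B.π_β_self C.shape.zero_mem_idx] at h1
    simpa using h1

include hB hB' hσ in
/-- Isomorphic modules with coordinates for the same word have isomorphic coefficients. -/
theorem exists_addEquiv (φ : M ≃ₗ[OneAdjoined k ρ] M') :
    ∃ d : V ≃+ V', (∀ (c : k) v, d (algebraMap k A c • v) = algebraMap k A' c • d v) ∧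
      ∀ i j v, C.SameAt i j → d (B.π i (B.β j v)) = B'.π i (B'.β j (d v)) := by
  have h0 := C.shape.zero_mem_idx
  refine ⟨{ diag B B' (φ : M →ₗ[OneAdjoined k ρ] M') with
    invFun := diag B' B (φ.symm : M' →ₗ[OneAdjoined k ρ] M)
    left_inv := fun v => ?_
    right_inv := fun v => ?_ }, diag_smul _, fun i j v h => diag_π_β hB hB' _ h v⟩
  · refine (diag_comp hσ hB' hB _ _ v).symm.trans ?_
    simp [diag_apply, B.π_β_self h0]
  · refine (diag_comp hσ hB hB' _ _ v).symm.trans ?_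
    simp [diag_apply, B'.π_β_self h0]

end Diagonal

end WordCoord

end Triangular

/-! ## Coordinates on string and band modules -/

section Instances

open QuiverAlgebra

variable {k : Type*} [Field k] {Q : Type*} [Quiver Q] {ρ : Set (QPath Q)}

namespace StringModule

variable {C : Word ρ}

theorem idem_smul (v : Q) (m : StringModule k C) :
    (idem k ρ v : OneAdjoined k ρ) • m = vertexOp k C v m := by
  rw [inr_smul, action, idem, QuiverAlgebra.lift_mk, PathAlgebra.lift_ofPath]
  rfl

theorem smul_smul_comm_inl (r : OneAdjoined k ρ) (c : k) (m : StringModule k C) :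
    r • (Unitization.inl c : OneAdjoined k ρ) • m =
      (Unitization.inl c : OneAdjoined k ρ) • r • m := by
  rw [← Unitization.algebraMap_eq_inl, ← mul_smul, ← Algebra.commutes, mul_smul]

/-- As a path, `x` acts through `pathOp`, which starts with the trivial path at the tail of `x`;
this removes that factor. -/
theorem arrowOp_mul_vertexOp (x : Quiver.Total Q) :
    arrowOp k C x * vertexOp k C x.left = arrowOp k C x := by
  refine hom_ext fun i => ?_
  rw [Module.End.mul_apply]
  by_cases h : C.letter i = some (Letter.direct x)
  · rw [vertexOp_b_of_eq]
    exact Word.vertex_of_letter h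
  · by_cases h' : C.letter (i + 1) = some (Letter.inverse x)
    · rw [vertexOp_b_of_eq]
      exact Word.vertex_of_letter_succ h'
    · rw [arrowOp_b_zero h h']
      by_cases hv : C.vertex i = some x.left
      · rw [vertexOp_b_of_eq hv, arrowOp_b_zero h h']
      · rw [vertexOp_b_of_ne hv, map_zero]

theorem arrow_smul (x : Quiver.Total Q) (m : StringModule k C) :
    (arrow k ρ x : OneAdjoined k ρ) • m = arrowOp k C x m := by
  rw [inr_smul, action, arrow, QuiverAlgebra.lift_mk, PathAlgebra.lift_ofPath]
  conv_rhs => rw [← arrowOp_mul_vertexOp]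
  rfl

variable (k C) in
open Classical in
/-- The basis element `b_i` if `i` is in `I`, and otherwise zero. -/
noncomputable def bz (i : ℤ) : StringModule k C :=
  if h : i ∈ C.shape.idx then b k ⟨i, h⟩ else 0

theorem bz_of_mem {i : ℤ} (h : i ∈ C.shape.idx) : bz k C i = b k ⟨i, h⟩ := dif_pos h

theorem bz_of_notMem {i : ℤ} (h : i ∉ C.shape.idx) : bz k C i = 0 := dif_neg h

theorem bz_coe (i : C.shape.idx) : bz k C i = b k i := bz_of_mem i.2

theorem idem_smul_bz_of_eq {w : Q} {i : ℤ} (h : C.vertex i = some w) :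
    (idem k ρ w : OneAdjoined k ρ) • bz k C i = bz k C i := by
  by_cases hi : i ∈ C.shape.idx
  · rw [bz_of_mem hi, idem_smul]
    exact vertexOp_b_of_eq h
  · rw [bz_of_notMem hi, smul_zero]

theorem idem_smul_bz_of_ne {w : Q} {i : ℤ} (h : C.vertex i ≠ some w) :
    (idem k ρ w : OneAdjoined k ρ) • bz k C i = 0 := by
  by_cases hi : i ∈ C.shape.idx
  · rw [bz_of_mem hi, idem_smul]
    exact vertexOp_b_of_ne h
  · rw [bz_of_notMem hi, smul_zero]

theorem arrow_smul_bz {x : Quiver.Total Q} {δ : Bool} {i : ℤ}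
    (h : C.side δ i = some (Letter.inverse x)) :
    (arrow k ρ x : OneAdjoined k ρ) • bz k C i = bz k C (i + dirStep δ) := by
  have hm := Word.mem_of_side h
  rw [bz_of_mem hm.1, bz_of_mem hm.2, arrow_smul]
  cases δ
  · obtain ⟨l, hl, hl'⟩ := Option.map_eq_some_iff.1 h
    have : l = Letter.direct x := by
      rw [← l.inv_inv, hl']; rfl
    subst this
    exact arrowOp_b_direct (i := ⟨i, hm.1⟩) hl
  · exact arrowOp_b_inverse (i := ⟨i, hm.1⟩) h

theorem arrow_smul_bz_zero {x : Quiver.Total Q} {i : ℤ}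
    (h : ∀ δ, C.side δ i ≠ some (Letter.inverse x)) :
    (arrow k ρ x : OneAdjoined k ρ) • bz k C i = 0 := by
  by_cases hi : i ∈ C.shape.idx
  · rw [bz_of_mem hi, arrow_smul]
    refine arrowOp_b_zero (i := ⟨i, hi⟩) (fun h' => h false ?_) (h true)
    simp only [Word.side, h']
    rfl
  · rw [bz_of_notMem hi, smul_zero]

theorem bz_induction {P : StringModule k C → Prop} (h0 : P 0)
    (hadd : ∀ x y, P x → P y → P (x + y)) (hb : ∀ (c : k) i, P (c • bz k C i))
    (z : StringModule k C) : P z := by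
  induction z using Finsupp.induction_linear with
  | zero => exact h0
  | add x y hx hy => exact hadd x y hx hy
  | single i c =>
    have h : (Finsupp.single i c : StringModule k C) = c • bz k C i := by
      rw [bz_coe]
      refine (?_ : Finsupp.single i c = c • Finsupp.single i (1 : k))
      simp
    rw [h]
    exact hb c i

/-- The coefficient at `b_i`. -/
noncomputable def coeffAt (i : C.shape.idx) : StringModule k C →+ k := Finsupp.applyAddHom i

variable (k C) in
open Classical in
/-- The coefficient at `b_i`, and zero if `i` is not in `I`. -/
noncomputable def coeffHom (i : ℤ) : StringModule k C →+ k :=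
  if h : i ∈ C.shape.idx then coeffAt ⟨i, h⟩ else 0

theorem coeffHom_of_mem {i : ℤ} (h : i ∈ C.shape.idx) (z : StringModule k C) :
    coeffHom k C i z = coeffAt ⟨i, h⟩ z := by
  rw [coeffHom, dif_pos h]

theorem coeffHom_of_notMem {i : ℤ} (h : i ∉ C.shape.idx) (z : StringModule k C) :
    coeffHom k C i z = 0 := by
  rw [coeffHom, dif_neg h]; rfl

theorem coeffHom_smul (c : k) (i : ℤ) (z : StringModule k C) :
    coeffHom k C i (c • z) = c * coeffHom k C i z := by
  by_cases h : i ∈ C.shape.idx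
  · rw [coeffHom_of_mem h, coeffHom_of_mem h]; rfl
  · rw [coeffHom_of_notMem h, coeffHom_of_notMem h, mul_zero]

theorem coeffHom_bz_self {i : ℤ} (h : i ∈ C.shape.idx) : coeffHom k C i (bz k C i) = 1 := by
  rw [coeffHom_of_mem h, bz_of_mem h]
  exact Finsupp.single_eq_same

theorem coeffHom_bz_of_ne {i j : ℤ} (h : i ≠ j) : coeffHom k C i (bz k C j) = 0 := by
  by_cases hi : i ∈ C.shape.idx
  · by_cases hj : j ∈ C.shape.idx
    · rw [coeffHom_of_mem hi, bz_of_mem hj]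
      exact Finsupp.single_eq_of_ne fun h' => h (congrArg Subtype.val h')
    · rw [bz_of_notMem hj, map_zero]
  · exact coeffHom_of_notMem hi _

theorem coeffHom_ext {z : StringModule k C} (h : ∀ i, coeffHom k C i z = 0) : z = 0 :=
  Finsupp.ext fun i => (coeffHom_of_mem i.2 z).symm.trans (h i)

variable (k C) in
/-- The coordinates on the string module `M(C)` given by its basis. -/
noncomputable def coord : WordCoord k C k k (StringModule k C) where
  β i := (LinearMap.toSpanSingleton k (StringModule k C) (bz k C i)).toAddMonoidHom
  π i := coeffHom k C i
  π_β_self hi v := by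
    change coeffHom k C _ (v • bz k C _) = v
    rw [coeffHom_smul, coeffHom_bz_self hi, mul_one]
  β_of_notMem hi v := by
    change v • bz k C _ = 0
    rw [bz_of_notMem hi, smul_zero]
  π_of_notMem hi z := coeffHom_of_notMem hi z
  span := by
    refine eq_top_iff.2 fun z _ => ?_
    induction z using bz_induction with
    | h0 => exact zero_mem _
    | hadd x y hx hy => exact add_mem (hx trivial) (hy trivial)
    | hb c i => exact AddSubmonoid.subset_closure ⟨(i, c), rfl⟩
  ext_zero z hz := coeffHom_ext hz
  smul_β c i v := by
    change (Unitization.inl c : OneAdjoined k ρ) • v • bz k C i = (c • v) • bz k C i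
    rw [inl_smul, smul_assoc]
  π_smul c i z := by
    rw [inl_smul, coeffHom_smul]; rfl
  idem_β_of_eq h v := by
    change (idem k ρ _ : OneAdjoined k ρ) • v • bz k C _ = v • bz k C _
    rw [← inl_smul v, smul_smul_comm_inl, idem_smul_bz_of_eq h]
  idem_β_of_ne h v := by
    change (idem k ρ _ : OneAdjoined k ρ) • v • bz k C _ = 0
    rw [← inl_smul v, smul_smul_comm_inl, idem_smul_bz_of_ne h, smul_zero]
  arrow_β h v := by
    change (arrow k ρ _ : OneAdjoined k ρ) • v • bz k C _ = v • bz k C _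
    rw [← inl_smul v, smul_smul_comm_inl, arrow_smul_bz h, inl_smul]
  arrow_β_zero h v := by
    change (arrow k ρ _ : OneAdjoined k ρ) • v • bz k C _ = 0
    rw [← inl_smul v, smul_smul_comm_inl, arrow_smul_bz_zero h, smul_zero]

theorem coord_π_β (i j : ℤ) (c : k) :
    (coord k C).π i ((coord k C).β j c) = c * coeffHom k C i (bz k C j) :=
  coeffHom_smul c i _

/-- For a nonperiodic word `SameAt` is equality, so rigidity only says that the `b_i` form a basis.
For a periodic word these coordinates are not rigid, since distinct `b_i` at equivalent positions
are independent. -/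
theorem coord_rigid (hC : ¬ C.IsPeriodic) : (coord k C).Rigid := by
  have heq : ∀ {i j}, C.SameAt i j → i = j := fun h => by
    by_contra hne
    exact hC (h.isPeriodic hne)
  refine ⟨fun {i j} h v => ?_, fun {i j} h v => ?_, fun {i j} h _ _ v => ?_⟩
  · rw [coord_π_β]
    by_cases hij : i = j
    · subst hij
      rw [coeffHom_of_notMem fun hi => h (Word.SameAt.refl hi), mul_zero]
    · rw [coeffHom_bz_of_ne hij, mul_zero]
  · obtain rfl := heq h
    rw [(coord k C).π_β_self h.1]
  · obtain rfl := heq h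
    rw [(coord k C).π_β_self h.1, (coord k C).π_β_self]
    assumption

end StringModule

end Instances

/-! ### Coordinates on band modules -/

section BandCoordinates

open QuiverAlgebra

variable {k : Type*} [Field k] {Q : Type*} [Quiver Q] {ρ : Set (QPath Q)} {C : Word ρ}

namespace Word

theorem shift_eq_self_iff (hC : C.shape = Shape.int) (n : ℤ) :
    C.shift n = C ↔ ∀ i, C.letter (i + n) = C.letter i := by
  constructor
  · intro h i
    have h' := congrFun (congrArg Word.letter h) i
    simpa [Word.shift, hC, Shape.offset] using h'
  · intro h
    ext1
    · rfl
    · funext i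
      simp only [Word.shift, hC, Shape.offset, h i]
    · rfl

theorem IsPeriodic.period_pos (hC : C.IsPeriodic) : 0 < C.period := (Nat.sInf_mem hC.2).1

/-- Invariance under `i - j` implies invariance under its remainder modulo the period, which
vanishes because the period is minimal. -/
theorem IsPeriodic.sameAt_iff (hC : C.IsPeriodic) {i j : ℤ} :
    C.SameAt i j ↔ (C.period : ℤ) ∣ i - j := by
  constructor
  · intro h
    by_contra hdvd
    have hpos : (0 : ℤ) < C.period := by exact_mod_cast hC.period_pos
    set d := (i - j) % C.period with hd
    have hd0 : d ≠ 0 := fun h0 => hdvd (Int.dvd_of_emod_eq_zero h0)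
    have hd1 : 0 ≤ d := Int.emod_nonneg _ hpos.ne'
    have hd2 : d < C.period := Int.emod_lt_of_pos _ hpos
    have hdiv : i - j = d + (i - j) / C.period * C.period := by
      rw [hd]; exact (Int.emod_add_ediv_mul _ _).symm
    have hper : ∀ m, C.letter (m + d) = C.letter m := fun m => by
      rw [← PeriodicStringModule.letter_add_mul_period hC (m + d) ((i - j) / C.period),
        add_assoc, ← hdiv]
      have := h.2.2 (m - j)
      rw [show i + (m - j) = m + (i - j) by ring, show j + (m - j) = m by ring] at this
      exact this
    have hle : C.period ≤ d.toNat := Nat.sInf_le ⟨by omega, by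
      rw [shift_eq_self_iff hC.1, Int.toNat_of_nonneg hd1]
      exact hper⟩
    omega
  · rintro ⟨m, hm⟩
    refine ⟨PeriodicStringModule.mem_idx hC i, PeriodicStringModule.mem_idx hC j, fun r => ?_⟩
    rw [← PeriodicStringModule.letter_add_mul_period hC (j + r) m]
    congr 1
    linarith

end Word

namespace PeriodicStringModule

variable (hC : C.IsPeriodic)

/-- The basis element `b_i` of `M(C)`. -/
noncomputable def basisVec (i : ℤ) : PeriodicStringModule k hC := StringModule.bz k C i

theorem T_smul (m : ℤ) (z : PeriodicStringModule k hC) :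
    (LaurentPolynomial.T m : k[T;T⁻¹]) • z = shiftEnd k hC m z := by
  change laurentHom k hC (LaurentPolynomial.T m) z = _
  rw [laurentHom, LaurentPolynomial.T, AddMonoidAlgebra.lift_single, one_smul]
  rfl

theorem C_smul (a : k) (z : PeriodicStringModule k hC) :
    (LaurentPolynomial.C a : k[T;T⁻¹]) • z = a • z := by
  change laurentHom k hC (LaurentPolynomial.C a) z = _
  rw [LaurentPolynomial.C_eq_algebraMap, AlgHom.commutes]
  rfl

theorem T_smul_basisVec (m i : ℤ) :
    (LaurentPolynomial.T m : k[T;T⁻¹]) • basisVec (k := k) hC i =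
      basisVec hC (i - m * C.period) := by
  rw [T_smul, basisVec, basisVec, StringModule.bz_of_mem (mem_idx hC _),
    StringModule.bz_of_mem (mem_idx hC _)]
  exact shiftLin_b (hC := hC) m _

theorem basisVec_induction {P : PeriodicStringModule k hC → Prop} (h0 : P 0)
    (hadd : ∀ x y, P x → P y → P (x + y)) (hb : ∀ (c : k) i, P (c • basisVec hC i))
    (z : PeriodicStringModule k hC) : P z :=
  StringModule.bz_induction (P := P) h0 hadd hb z

open Classical in
/-- The coefficients at the `b_j` with `j` congruent to `i` modulo the period of `C`, as a `k`-linear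
map to Laurent polynomials. -/
noncomputable def coeffLin (i : ℤ) : PeriodicStringModule k hC →ₗ[k] k[T;T⁻¹] :=
  StringModule.linExt k C fun j =>
    if (C.period : ℤ) ∣ i - j then LaurentPolynomial.T ((i - j) / C.period) else 0

theorem coeffLin_of_dvd {i j : ℤ} (h : (C.period : ℤ) ∣ i - j) :
    coeffLin hC i (basisVec (k := k) hC j) = LaurentPolynomial.T ((i - j) / C.period) := by
  rw [basisVec, StringModule.bz_of_mem (mem_idx hC _)]
  refine (StringModule.linExt_b _ _).trans ?_
  rw [if_pos h]

theorem coeffLin_of_not_dvd {i j : ℤ} (h : ¬ (C.period : ℤ) ∣ i - j) :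
    coeffLin hC i (basisVec (k := k) hC j) = 0 := by
  rw [basisVec, StringModule.bz_of_mem (mem_idx hC _)]
  refine (StringModule.linExt_b _ _).trans ?_
  rw [if_neg h]

theorem coeffLin_T_smul (i m : ℤ) (z : PeriodicStringModule k hC) :
    coeffLin hC i ((LaurentPolynomial.T m : k[T;T⁻¹]) • z) =
      LaurentPolynomial.T m * coeffLin hC i z := by
  have hpos : (C.period : ℤ) ≠ 0 := by exact_mod_cast hC.period_pos.ne'
  induction z using basisVec_induction with
  | h0 => rw [smul_zero, map_zero, mul_zero]
  | hadd x y hx hy => rw [smul_add, map_add, map_add, mul_add, hx, hy]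
  | hb c j =>
    rw [← C_smul, smul_comm, C_smul, C_smul, T_smul_basisVec, map_smul, map_smul, mul_smul_comm]
    congr 1
    have hij : i - (j - m * C.period) = i - j + m * C.period := by ring
    by_cases h : (C.period : ℤ) ∣ i - j
    · have h' : (C.period : ℤ) ∣ i - (j - m * C.period) := by
        rw [hij]; exact dvd_add h (dvd_mul_left _ _)
      rw [coeffLin_of_dvd hC h, coeffLin_of_dvd hC h', ← LaurentPolynomial.T_add, hij,
        Int.add_mul_ediv_right _ _ hpos, add_comm]
    · have h' : ¬ (C.period : ℤ) ∣ i - (j - m * C.period) := by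
        rw [hij]; exact fun h' => h ((dvd_add_left (dvd_mul_left _ _)).1 h')
      rw [coeffLin_of_not_dvd hC h, coeffLin_of_not_dvd hC h', mul_zero]

/-- The coefficients at the `b_j` with `j` congruent to `i` modulo the period of `C`, as a linear
map to Laurent polynomials. -/
noncomputable def coeffLaurent (i : ℤ) : PeriodicStringModule k hC →ₗ[k[T;T⁻¹]] k[T;T⁻¹] where
  toFun := coeffLin hC i
  map_add' := map_add _
  map_smul' f z := by
    rw [RingHom.id_apply, smul_eq_mul]
    induction f using LaurentPolynomial.induction_on' with
    | add p q hp hq => rw [add_smul, map_add, hp, hq, add_mul]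
    | C_mul_T m a =>
      rw [mul_smul, C_smul, map_smul, coeffLin_T_smul, LaurentPolynomial.C_eq_algebraMap,
        mul_assoc, ← Algebra.smul_def]

end PeriodicStringModule

namespace BandModule

open PeriodicStringModule

variable (hC : C.IsPeriodic) {V : Type*} [AddCommGroup V] [Module k[T;T⁻¹] V]

/-- The map `v ↦ b_i ⊗ v`. -/
noncomputable def incl (i : ℤ) : V →ₗ[k[T;T⁻¹]] BandModule k hC V :=
  TensorProduct.mk k[T;T⁻¹] (PeriodicStringModule k hC) V (basisVec hC i)

/-- The coordinate of an element of `M(C, V)` at `b_i`. -/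
noncomputable def proj (i : ℤ) : BandModule k hC V →ₗ[k[T;T⁻¹]] V :=
  (TensorProduct.lid k[T;T⁻¹] V).toLinearMap.comp ((coeffLaurent hC i).rTensor V)

/-- With `n` the period, `b_j = T^((i-j)/n) b_i`, because `T` lowers indices by `n`. -/
theorem proj_incl_of_dvd {i j : ℤ} (h : (C.period : ℤ) ∣ i - j) (v : V) :
    proj (k := k) hC i (incl hC j v) =
      (LaurentPolynomial.T ((i - j) / C.period) : k[T;T⁻¹]) • v := by
  change coeffLin (k := k) hC i (basisVec hC j) • v = _
  rw [coeffLin_of_dvd hC h]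

theorem proj_incl_of_not_dvd {i j : ℤ} (h : ¬ (C.period : ℤ) ∣ i - j) (v : V) :
    proj (k := k) hC i (incl hC j v) = 0 := by
  change coeffLin (k := k) hC i (basisVec hC j) • v = _
  rw [coeffLin_of_not_dvd hC h, zero_smul]

theorem incl_T_smul (i m : ℤ) (v : V) :
    incl (k := k) hC i ((LaurentPolynomial.T m : k[T;T⁻¹]) • v) =
      incl hC (i - m * C.period) v := by
  change basisVec hC i ⊗ₜ (_ • v) = basisVec hC _ ⊗ₜ v
  rw [← TensorProduct.smul_tmul, T_smul_basisVec]

theorem incl_proj_incl {i j : ℤ} (h : (C.period : ℤ) ∣ i - j) (v : V) :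
    incl (k := k) hC i (proj (k := k) hC i (incl hC j v)) = incl hC j v := by
  rw [proj_incl_of_dvd hC h, incl_T_smul, Int.ediv_mul_cancel h, sub_sub_cancel]

theorem incl_induction {P : BandModule k hC V → Prop} (h0 : P 0)
    (hadd : ∀ x y, P x → P y → P (x + y)) (hb : ∀ i v, P (incl hC i v))
    (z : BandModule k hC V) : P z := by
  induction z using TensorProduct.induction_on with
  | zero => exact h0
  | add x y hx hy => exact hadd x y hx hy
  | tmul m v =>
    induction m using basisVec_induction with
    | h0 => rw [TensorProduct.zero_tmul]; exact h0
    | hadd x y hx hy => rw [TensorProduct.add_tmul]; exact hadd _ _ hx hy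
    | hb c i =>
      rw [← C_smul, TensorProduct.smul_tmul]
      exact hb i _

/-- Every element of `M(C, V)` is the sum of its components at the positions of one period. -/
theorem sum_incl_proj (z : BandModule k hC V) :
    ∑ i ∈ Finset.Ico (0 : ℤ) C.period, incl hC i (proj hC i z) = z := by
  have hpos : (0 : ℤ) < C.period := by exact_mod_cast hC.period_pos
  induction z using incl_induction with
  | h0 => simp
  | hadd x y hx hy => simp only [map_add, Finset.sum_add_distrib, hx, hy]
  | hb j v =>
    -- The remainder of `j` is the only position of the chosen period at which `b_j ⊗ v` has a
    -- component.
    have hdvd : (C.period : ℤ) ∣ j % C.period - j :=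
      dvd_sub_comm.1 (Int.dvd_self_sub_emod)
    rw [Finset.sum_eq_single_of_mem (j % C.period)
      (Finset.mem_Ico.2 ⟨Int.emod_nonneg _ hpos.ne', Int.emod_lt_of_pos _ hpos⟩),
      incl_proj_incl hC hdvd]
    intro i hi hne
    rw [proj_incl_of_not_dvd, map_zero]
    intro h
    rw [Finset.mem_Ico] at hi
    exact hne (by rw [← Int.emod_eq_emod_iff_emod_sub_eq_zero.2 (Int.emod_eq_zero_of_dvd h),
      Int.emod_eq_of_lt hi.1 hi.2])

theorem smul_incl (r : OneAdjoined k ρ) (i : ℤ) (v : V) :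
    r • incl (k := k) hC i v = (r • basisVec (k := k) hC i) ⊗ₜ v :=
  TensorProduct.smul_tmul' r _ v

theorem inl_smul_incl (c : k) (i : ℤ) (v : V) :
    (Unitization.inl c : OneAdjoined k ρ) • incl (k := k) hC i v =
      incl hC i (algebraMap k k[T;T⁻¹] c • v) := by
  have h : (Unitization.inl c : OneAdjoined k ρ) • basisVec (k := k) hC i =
      c • basisVec (k := k) hC i := StringModule.inl_smul c _
  rw [smul_incl, h, ← C_smul, TensorProduct.smul_tmul, LaurentPolynomial.C_eq_algebraMap]
  rfl

variable (V) in
/-- The coordinates on `M(C, V)`. -/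
noncomputable def coord : WordCoord k C k[T;T⁻¹] V (BandModule k hC V) where
  β i := (incl hC i).toAddMonoidHom
  π i := (proj hC i).toAddMonoidHom
  π_β_self {i} _ v := by
    change proj hC i (incl hC i v) = v
    rw [proj_incl_of_dvd hC (by simp)]
    simp
  β_of_notMem hi v := absurd (mem_idx hC _) hi
  π_of_notMem hi z := absurd (mem_idx hC _) hi
  span := by
    refine eq_top_iff.2 fun z _ => ?_
    induction z using incl_induction with
    | h0 => exact zero_mem _
    | hadd x y hx hy => exact add_mem (hx trivial) (hy trivial)
    | hb i v => exact AddSubmonoid.subset_closure ⟨(i, v), rfl⟩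
  ext_zero z hz := by
    rw [← sum_incl_proj hC z]
    refine Finset.sum_eq_zero fun i _ => ?_
    have h : proj hC i z = 0 := hz i
    rw [h, map_zero]
  smul_β c i v := inl_smul_incl hC c i v
  π_smul c i z := by
    change proj hC i _ = _ • proj hC i z
    induction z using incl_induction with
    | h0 => simp
    | hadd x y hx hy => rw [smul_add, map_add, map_add, hx, hy, smul_add]
    | hb j v => rw [inl_smul_incl, map_smul, map_smul]
  idem_β_of_eq {w i} h v := by
    change (idem k ρ w : OneAdjoined k ρ) • incl hC i v = incl hC i v
    rw [smul_incl]
    exact congrArg (fun m : PeriodicStringModule k hC => m ⊗ₜ[k[T;T⁻¹]] v)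
      (StringModule.idem_smul_bz_of_eq h)
  idem_β_of_ne {w i} h v := by
    change (idem k ρ w : OneAdjoined k ρ) • incl hC i v = 0
    rw [smul_incl]
    exact (congrArg (fun m : PeriodicStringModule k hC => m ⊗ₜ[k[T;T⁻¹]] v)
      (StringModule.idem_smul_bz_of_ne h)).trans
      (TensorProduct.zero_tmul _ _)
  arrow_β {x δ i} h v := by
    change (arrow k ρ x : OneAdjoined k ρ) • incl hC i v = incl hC (i + dirStep δ) v
    rw [smul_incl]
    exact congrArg (fun m : PeriodicStringModule k hC => m ⊗ₜ[k[T;T⁻¹]] v)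
      (StringModule.arrow_smul_bz h)
  arrow_β_zero {x i} h v := by
    change (arrow k ρ x : OneAdjoined k ρ) • incl hC i v = 0
    rw [smul_incl]
    exact (congrArg (fun m : PeriodicStringModule k hC => m ⊗ₜ[k[T;T⁻¹]] v)
      (StringModule.arrow_smul_bz_zero h)).trans
      (TensorProduct.zero_tmul _ _)

/-- The classes of `SameAt` are the residue classes modulo the period, and `π i ∘ β j` is a power of
`T` that depends only on `i - j`. -/
theorem coord_rigid : (coord (k := k) hC V).Rigid where
  π_β_of_not h v := proj_incl_of_not_dvd hC (fun h' => h (hC.sameAt_iff.2 h')) v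
  β_π_β h v := incl_proj_incl hC (hC.sameAt_iff.1 h) v
  π_β_add_one {i j} h _ _ v := by
    have h' := hC.sameAt_iff.1 h
    have e : i + 1 - (j + 1) = i - j := by ring
    refine (proj_incl_of_dvd hC (by rwa [e]) v).trans ?_
    rw [e]
    exact (proj_incl_of_dvd hC h' v).symm

theorem coord_π_β_sub (i m : ℤ) (v : V) :
    (coord (k := k) hC V).π i ((coord (k := k) hC V).β (i - m * C.period) v) =
      (LaurentPolynomial.T m : k[T;T⁻¹]) • v := by
  have e : i - (i - m * C.period) = m * C.period := by ring
  refine (proj_incl_of_dvd hC (by rw [e]; exact dvd_mul_left _ _) v).trans ?_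
  rw [e, Int.mul_ediv_cancel _ (by exact_mod_cast hC.period_pos.ne')]

variable (k) in
/-- The string module of a periodic word is `M(C) ⊗ k[T, T⁻¹]`. -/
noncomputable def ridEquiv : BandModule k hC k[T;T⁻¹] ≃ₗ[OneAdjoined k ρ] StringModule k C :=
  { (TensorProduct.rid k[T;T⁻¹] (PeriodicStringModule k hC)).toAddEquiv with
    map_smul' := fun r z => by
      change TensorProduct.rid k[T;T⁻¹] (PeriodicStringModule k hC) (r • z) =
        r • TensorProduct.rid k[T;T⁻¹] (PeriodicStringModule k hC) z
      induction z using TensorProduct.induction_on with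
      | zero => simp
      | add x y hx hy => rw [smul_add, map_add, map_add, hx, hy, smul_add]
      | tmul m v =>
        rw [TensorProduct.smul_tmul', TensorProduct.rid_tmul, TensorProduct.rid_tmul,
          smul_comm] }

end BandModule

end BandCoordinates

/-! ## Indecomposability and isomorphisms -/

section Classification

open QuiverAlgebra LaurentPolynomial

variable {k : Type*} [Field k] {Q : Type*} [Quiver Q] {ρ : Set (QPath Q)} {C D : Word ρ}

/-- The twist `θ` will be the identity for a translation of words and `T ↦ T⁻¹` for a reflection. -/
theorem LaurentPolynomial.map_smul_of_T {V U : Type*} [AddCommGroup V] [Module k[T;T⁻¹] V]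
    [AddCommGroup U] [Module k[T;T⁻¹] U] (θ : k[T;T⁻¹] →ₐ[k] k[T;T⁻¹]) (d : V →+ U)
    (hc : ∀ (c : k) v, d (algebraMap k k[T;T⁻¹] c • v) = algebraMap k k[T;T⁻¹] c • d v)
    (hT : ∀ m v, d ((T m : k[T;T⁻¹]) • v) = θ (T m) • d v) (f : k[T;T⁻¹]) (v : V) :
    d (f • v) = θ f • d v := by
  induction f using LaurentPolynomial.induction_on' with
  | add p q hp hq => rw [add_smul, map_add, map_add, add_smul, hp, hq]
  | C_mul_T m a =>
    rw [mul_smul, C_eq_algebraMap, hc, hT, map_mul, AlgHom.commutes, mul_smul]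

theorem LaurentPolynomial.not_moduleFinite : ¬ Module.Finite k k[T;T⁻¹] := by
  intro h
  have := Module.Finite.finite_basis
    (Module.Basis.ofRepr (AddMonoidAlgebra.coeffLinearEquiv (S := k) (M := ℤ) k))
  exact not_finite ℤ

/-- Two nonzero ideals of a domain meet in the product of nonzero elements. -/
theorem isIndecomposableModule_self {A : Type*} [CommRing A] [IsDomain A] :
    IsIndecomposableModule A A := by
  refine ⟨inferInstance, fun N N' h => ?_⟩
  by_contra! hne
  obtain ⟨a, ha, ha0⟩ := Submodule.exists_mem_ne_zero_of_ne_bot hne.1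
  obtain ⟨b, hb, hb0⟩ := Submodule.exists_mem_ne_zero_of_ne_bot hne.2
  have h1 : a * b ∈ N ⊓ N' := ⟨by rw [mul_comm]; exact N.smul_mem b ha, N'.smul_mem a hb⟩
  rw [h.inf_eq_bot, Submodule.mem_bot] at h1
  exact mul_ne_zero ha0 hb0 h1

/-- An idempotent endomorphism of an indecomposable module is zero or the identity. -/
theorem IsIndecomposableModule.eq_zero_or_eq_id {A V : Type*} [Ring A] [AddCommGroup V]
    [Module A V] (hV : IsIndecomposableModule A V) (e : V →ₗ[A] V) (he : ∀ v, e (e v) = e v) :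
    e = 0 ∨ e = LinearMap.id := by
  have hid : IsIdempotentElem e := LinearMap.ext he
  rcases hV.2 _ _ (LinearMap.IsIdempotentElem.isCompl hid) with h | h
  · exact Or.inl (LinearMap.range_eq_bot.1 h)
  · refine Or.inr (LinearMap.ext fun v => ?_)
    refine LinearMap.ker_eq_bot.1 h ?_
    exact he v

/-! ### Monodromy of coordinates for periodic words -/

namespace WordCoord

variable {V U M M' : Type*} [AddCommGroup V] [Module k[T;T⁻¹] V] [AddCommGroup U]
  [Module k[T;T⁻¹] U] [AddCommGroup M] [Module (OneAdjoined k ρ) M] [AddCommGroup M']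
  [Module (OneAdjoined k ρ) M']

/-- Translation of positions by the period of the word corresponds to the action of `θ(T)`. -/
def HasMonodromy (B : WordCoord k C k[T;T⁻¹] V M) (θ : k[T;T⁻¹] →ₐ[k] k[T;T⁻¹]) : Prop :=
  ∀ i m v, B.π i (B.β (i - m * C.period) v) = θ (T m) • v

theorem HasMonodromy.map {B : WordCoord k C k[T;T⁻¹] V M} {θ : k[T;T⁻¹] →ₐ[k] k[T;T⁻¹]}
    (hB : B.HasMonodromy θ) (e : M ≃ₗ[OneAdjoined k ρ] M') : (B.map e).HasMonodromy θ :=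
  fun i m v => by simpa [WordCoord.map] using hB i m v

variable {σ : Letter Q → Bool} (hσ : IsLetterSign ρ σ)

include hσ in
-- Compatibility of the diagonal with the positions `0` and `-mn`, for the period `n`, says that it
-- commutes with `T^m`. So the diagonal of a projection is an idempotent endomorphism of the
-- `k[T;T⁻¹]`-module `V`.
theorem isIndecomposableModule_of_hasMonodromy (hC : C.IsPeriodic)
    {B : WordCoord k C k[T;T⁻¹] V M} (hB : B.Rigid) (hT : B.HasMonodromy (AlgHom.id k _))
    (hV : IsIndecomposableModule k[T;T⁻¹] V) : IsIndecomposableModule (OneAdjoined k ρ) M := by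
  have := hV.1
  refine isIndecomposableModule hσ hB fun d hc hd hdd => ?_
  have hlin := map_smul_of_T (AlgHom.id k _) d hc fun m v => by
    have h := hd 0 (0 - m * C.period) v (hC.sameAt_iff.2 (by simp))
    rwa [hT, hT] at h
  let e : V →ₗ[k[T;T⁻¹]] V := { d with map_smul' := hlin }
  exact (hV.eq_zero_or_eq_id e hdd).imp (fun h => AddMonoidHom.ext (LinearMap.congr_fun h))
    (fun h => AddMonoidHom.ext (LinearMap.congr_fun h))

include hσ in
theorem exists_addEquiv_of_hasMonodromy (hC : C.IsPeriodic) {B : WordCoord k C k[T;T⁻¹] V M}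
    (hB : B.Rigid) (hT : B.HasMonodromy (AlgHom.id k _)) {B' : WordCoord k C k[T;T⁻¹] U M'}
    (hB' : B'.Rigid) {θ : k[T;T⁻¹] →ₐ[k] k[T;T⁻¹]} (hT' : B'.HasMonodromy θ)
    (φ : M ≃ₗ[OneAdjoined k ρ] M') :
    ∃ d : V ≃+ U, ∀ (f : k[T;T⁻¹]) v, d (f • v) = θ f • d v := by
  obtain ⟨d, hc, hd⟩ := exists_addEquiv hσ hB hB' φ
  refine ⟨d, map_smul_of_T θ (d : V →+ U) hc fun m v => ?_⟩
  have h := hd 0 (0 - m * C.period) v (hC.sameAt_iff.2 (by simp))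
  rw [hT, hT'] at h
  exact h

/-- Rigidity and monodromy determine all maps `π j ∘ β i`: they are zero, or powers of `θ(T)`. -/
theorem nonempty_linearEquiv_of_hasMonodromy (hC : C.IsPeriodic)
    {B : WordCoord k C k[T;T⁻¹] V M} (hB : B.Rigid) (hT : B.HasMonodromy (AlgHom.id k _))
    {B' : WordCoord k C k[T;T⁻¹] U M'} (hB' : B'.Rigid) {θ : k[T;T⁻¹] →ₐ[k] k[T;T⁻¹]}
    (hT' : B'.HasMonodromy θ) (d : V ≃+ U) (hd : ∀ (f : k[T;T⁻¹]) v, d (f • v) = θ f • d v) :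
    Nonempty (M ≃ₗ[OneAdjoined k ρ] M') := by
  refine nonempty_linearEquiv B B' d (fun c v => by rw [hd, AlgHom.commutes]) fun i j v => ?_
  by_cases h : C.SameAt j i
  · obtain ⟨m, hm⟩ := hC.sameAt_iff.1 h
    obtain rfl : i = j - m * C.period := by linarith
    rw [hT, hT', hd]
    rfl
  · rw [hB.π_β_of_not h, hB'.π_β_of_not h, map_zero]

end WordCoord

/-- The positions of `C` matched with `0` and with the period of `D` are distinct and look the same.
-/
theorem Word.Match.isPeriodic (e : Word.Match C D) (hD : D.IsPeriodic) : C.IsPeriodic := by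
  obtain ⟨i, hi⟩ := e.pos_surjective 0
  obtain ⟨j, hj⟩ := e.pos_surjective D.period
  have h : D.SameAt (e.pos i) (e.pos j) := hD.sameAt_iff.2 (by rw [hi, hj]; simp)
  refine (e.sameAt_iff.2 h).isPeriodic fun hij => ?_
  have hpos := hD.period_pos
  rw [hij, hj] at hi
  omega

/-- The multiples of the period are the differences of positions that look the same, and a match
preserves these up to sign. -/
theorem Word.Match.period_eq (e : Word.Match C D) (hC : C.IsPeriodic) (hD : D.IsPeriodic) :
    D.period = C.period := by
  have h : ∀ m : ℤ, (C.period : ℤ) ∣ m ↔ (D.period : ℤ) ∣ m := fun m => by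
    have h1 := e.sameAt_iff (i := 0 + m) (j := 0)
    rw [hC.sameAt_iff, hD.sameAt_iff, e.pos_add, add_sub_cancel_left, add_sub_cancel_left] at h1
    rw [h1]
    cases e.flip <;> simp
  exact Nat.dvd_antisymm (Int.natCast_dvd_natCast.1 ((h _).1 dvd_rfl))
    (Int.natCast_dvd_natCast.1 ((h _).2 dvd_rfl))

/-! ### Monodromy and indecomposability of band modules -/

namespace BandModule

variable (hC : C.IsPeriodic) (hD : D.IsPeriodic) (V : Type*) [AddCommGroup V]
  [Module k[T;T⁻¹] V]

theorem coord_hasMonodromy : (coord (k := k) hC V).HasMonodromy (AlgHom.id k _) :=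
  fun i m v => coord_π_β_sub hC i m v

include hC in
theorem reindex_hasMonodromy (e : Word.Match C D) (he : e.flip = false) :
    ((coord (k := k) hD V).reindex e).HasMonodromy (AlgHom.id k _) := by
  intro i m v
  have h := coord_π_β_sub (k := k) hD (e.pos i) m v
  rw [e.period_eq hC hD] at h
  rw [AlgHom.id_apply, ← h]
  change (coord hD V).π (e.pos i) ((coord hD V).β (e.pos (i - m * C.period)) v) = _
  rw [sub_eq_add_neg, e.pos_add, he]
  simp [sub_eq_add_neg]

include hC in
-- A reflection reverses the direction of translations, so `T` and `T⁻¹` change places.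
theorem reindex_hasMonodromy_invert (e : Word.Match C D) (he : e.flip = true) :
    ((coord (k := k) hD V).reindex e).HasMonodromy (invert (R := k) : k[T;T⁻¹] →ₐ[k] k[T;T⁻¹]) := by
  intro i m v
  have h := coord_π_β_sub (k := k) hD (e.pos i) (-m) v
  rw [e.period_eq hC hD] at h
  change (coord hD V).π (e.pos i) ((coord hD V).β (e.pos (i - m * C.period)) v) =
    invert (R := k) (T m) • v
  rw [invert_T, ← h, sub_eq_add_neg, e.pos_add, he]
  simp

variable {σ : Letter Q → Bool} (hσ : IsLetterSign ρ σ)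

include hσ in
theorem isIndecomposableModule {V} [AddCommGroup V] [Module k[T;T⁻¹] V]
    (hV : IsIndecomposableModule k[T;T⁻¹] V) :
    IsIndecomposableModule (OneAdjoined k ρ) (BandModule k hC V) :=
  WordCoord.isIndecomposableModule_of_hasMonodromy hσ hC (coord_rigid hC)
    (coord_hasMonodromy hC V) hV

end BandModule

/-! ### Classification of string modules -/

namespace StringModule

variable (k) in
/-- The coordinates on the string module of a periodic word with coefficients in `k[T, T⁻¹]`. -/
noncomputable def laurentCoord (hC : C.IsPeriodic) :
    WordCoord k C k[T;T⁻¹] k[T;T⁻¹] (StringModule k C) :=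
  (BandModule.coord hC k[T;T⁻¹]).map (BandModule.ridEquiv k hC)

theorem laurentCoord_rigid (hC : C.IsPeriodic) : (laurentCoord k hC).Rigid :=
  (BandModule.coord_rigid hC).map _

variable {σ : Letter Q → Bool} (hσ : IsLetterSign ρ σ)

include hσ

/-- The coefficients are `k` or, for a periodic word, `k[T;T⁻¹]`; both are domains and hence
indecomposable over themselves. -/
theorem isIndecomposableModule (C : Word ρ) :
    IsIndecomposableModule (OneAdjoined k ρ) (StringModule k C) := by
  by_cases hC : C.IsPeriodic
  · exact WordCoord.isIndecomposableModule_of_hasMonodromy hσ hC (laurentCoord_rigid hC)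
      ((BandModule.coord_hasMonodromy hC _).map _) isIndecomposableModule_self
  · refine WordCoord.isIndecomposableModule hσ (coord_rigid hC) fun d hc _ hdd => ?_
    let e : k →ₗ[k] k := { d with map_smul' := hc }
    exact (isIndecomposableModule_self.eq_zero_or_eq_id e hdd).imp
      (fun h => AddMonoidHom.ext (LinearMap.congr_fun h))
      (fun h => AddMonoidHom.ext (LinearMap.congr_fun h))

theorem equivalent_of_rigid {A V M : Type*} [CommRing A] [Algebra k A] [AddCommGroup V]
    [Module A V] [AddCommGroup M] [Module (OneAdjoined k ρ) M] {B : WordCoord k D A V M}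
    (hB : B.Rigid) (φ : StringModule k C ≃ₗ[OneAdjoined k ρ] M) : C.Equivalent D := by
  by_cases hC : C.IsPeriodic
  · exact WordCoord.equivalent_of_linearEquiv hσ (laurentCoord_rigid hC) hB φ
  · exact WordCoord.equivalent_of_linearEquiv hσ (coord_rigid hC) hB φ

/-- String modules are isomorphic if and only if their words are equivalent. -/
theorem nonempty_linearEquiv_iff (C D : Word ρ) :
    Nonempty (StringModule k C ≃ₗ[OneAdjoined k ρ] StringModule k D) ↔ C.Equivalent D := by
  constructor
  · rintro ⟨φ⟩
    by_cases hD : D.IsPeriodic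
    · exact equivalent_of_rigid hσ (laurentCoord_rigid hD) φ
    · exact equivalent_of_rigid hσ (coord_rigid hD) φ
  · intro h
    obtain ⟨e⟩ := h.nonempty_match
    -- This direction needs no rigidity, so the basis coordinates serve for periodic words too.
    refine WordCoord.nonempty_linearEquiv (coord k C) ((coord k D).reindex e) (AddEquiv.refl k)
      (fun c v => rfl) fun i j c => ?_
    change (coord k D).π (e.pos j) ((coord k D).β (e.pos i) c) =
      (coord k C).π j ((coord k C).β i c)
    rw [coord_π_β, coord_π_β]
    congr 1
    by_cases hij : j = i
    · subst hij
      by_cases hj : j ∈ C.shape.idx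
      · rw [coeffHom_bz_self hj, coeffHom_bz_self ((e.mem_iff_pos j).1 hj)]
      · rw [coeffHom_of_notMem hj, coeffHom_of_notMem fun h => hj ((e.mem_iff_pos j).2 h)]
    · rw [coeffHom_bz_of_ne hij, coeffHom_bz_of_ne fun h => hij (e.pos_injective h)]

/-- An isomorphism would make `C` periodic, and its diagonal would be a `k`-linear isomorphism from
`k[T;T⁻¹]` to the finite-dimensional `U`. -/
theorem isEmpty_linearEquiv_bandModule (C D : Word ρ) (hD : D.IsPeriodic) (U : Type*)
    [AddCommGroup U] [Module k[T;T⁻¹] U] (hU : IsBandCoefficient k U) :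
    IsEmpty (StringModule k C ≃ₗ[OneAdjoined k ρ] BandModule k hD U) := by
  refine ⟨fun φ => ?_⟩
  obtain ⟨e⟩ := (equivalent_of_rigid hσ (BandModule.coord_rigid hD) φ).nonempty_match
  have hC := e.isPeriodic hD
  obtain ⟨d, hd, -⟩ := WordCoord.exists_addEquiv hσ (laurentCoord_rigid hC)
    ((BandModule.coord_rigid hD).reindex e) φ
  have := hU.1
  let d' : k[T;T⁻¹] ≃ₗ[k] RestrictScalars k k[T;T⁻¹] U :=
    { d with
      map_smul' := fun c f => by
        rw [Algebra.smul_def]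
        exact hd c f }
  exact not_moduleFinite (Module.Finite.equiv d'.symm)

end StringModule

/-- The isomorphisms between band modules. -/
theorem BandModule.nonempty_linearEquiv_iff {σ : Letter Q → Bool} (hσ : IsLetterSign ρ σ)
    (hC : C.IsPeriodic) (hD : D.IsPeriodic) (V : Type*) [AddCommGroup V] [Module k[T;T⁻¹] V]
    (U : Type*) [AddCommGroup U] [Module k[T;T⁻¹] U] (hV : Nontrivial V) :
    Nonempty (BandModule k hC V ≃ₗ[OneAdjoined k ρ] BandModule k hD U) ↔
      ((∃ n : ℤ, D = C.shift n) ∧ Nonempty (U ≃ₗ[k[T;T⁻¹]] V)) ∨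
      ((∃ n : ℤ, D = C.inv.shift n) ∧ Nonempty (U ≃ₗ[k[T;T⁻¹]] InvModule V)) := by
  have hinv : ∀ f : k[T;T⁻¹], invert (R := k) (invert (R := k) f) = f := involutive_invert
  constructor
  · rintro ⟨φ⟩
    obtain ⟨n, rfl | rfl⟩ := WordCoord.equivalent_of_linearEquiv hσ (coord_rigid hC)
      (coord_rigid hD) φ
    · obtain ⟨d, hd⟩ := WordCoord.exists_addEquiv_of_hasMonodromy hσ hC (coord_rigid hC)
        (coord_hasMonodromy hC V) ((coord_rigid hD).reindex (Word.Match.shift C n))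
        (reindex_hasMonodromy hC hD U _ rfl) φ
      exact Or.inl ⟨⟨n, rfl⟩, ⟨({ d with map_smul' := hd } : V ≃ₗ[k[T;T⁻¹]] U).symm⟩⟩
    · obtain ⟨d, hd⟩ := WordCoord.exists_addEquiv_of_hasMonodromy hσ hC (coord_rigid hC)
        (coord_hasMonodromy hC V) ((coord_rigid hD).reindex (Word.Match.invShift C n))
        (reindex_hasMonodromy_invert hC hD U _ rfl) φ
      -- The diagonal is semilinear for `T ↦ T⁻¹`, that is, linear on `V⁻¹`.
      refine Or.inr ⟨⟨n, rfl⟩, ⟨({ d with map_smul' := fun f v => ?_ } :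
        InvModule V ≃ₗ[k[T;T⁻¹]] U).symm⟩⟩
      refine (hd (invert (R := k) f) v).trans ?_
      exact congrArg (· • d v) (hinv f)
  · rintro (⟨⟨n, rfl⟩, ⟨e⟩⟩ | ⟨⟨n, rfl⟩, ⟨e⟩⟩)
    · exact WordCoord.nonempty_linearEquiv_of_hasMonodromy hC (coord_rigid hC)
        (coord_hasMonodromy hC V) ((coord_rigid hD).reindex (Word.Match.shift C n))
        (reindex_hasMonodromy hC hD U _ rfl) e.symm.toAddEquiv fun f v => e.symm.map_smul f v
    · refine WordCoord.nonempty_linearEquiv_of_hasMonodromy hC (coord_rigid hC)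
        (coord_hasMonodromy hC V) ((coord_rigid hD).reindex (Word.Match.invShift C n))
        (reindex_hasMonodromy_invert hC hD U _ rfl) (e.symm.toAddEquiv : V ≃+ U) fun f v => ?_
      have h := e.symm.map_smul (invert (R := k) f) v
      refine Eq.trans ?_ h
      exact congrArg e.symm (congrArg (· • (v : V)) (hinv f).symm)

end Classification

/-! ## Finiteness conditions -/

section Finiteness

open QuiverAlgebra

variable {k : Type*} [Field k] {Q : Type*} [Quiver Q] {ρ : Set (QPath Q)} {C : Word ρ}

/-- Replaces finiteness by a bound, which is easy to carry along shifts and reflections of the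
index. -/
theorem Int.finite_pos_and_iff (P : ℤ → Prop) :
    {i : ℤ | 0 < i ∧ P i}.Finite ↔ ∃ n : ℤ, ∀ i, n ≤ i → ¬ P i := by
  constructor
  · intro h
    obtain ⟨b, hb⟩ := h.bddAbove
    refine ⟨max 1 (b + 1), fun i hi hP => ?_⟩
    have := hb (show i ∈ {i : ℤ | 0 < i ∧ P i} from ⟨by omega, hP⟩)
    omega
  · rintro ⟨n, hn⟩
    refine (Set.finite_Ioo 0 n).subset fun i hi => ⟨hi.1, ?_⟩
    by_contra h
    exact hn i (by omega) hi.2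

/-! ### Finiteness conditions on words, one direction at a time -/

namespace Word

variable (C) in
/-- Far out in the direction `δ`, the word `C` has no direct letters. -/
def EventuallyInverseAt (δ : Bool) : Prop :=
  ∃ n : ℤ, ∀ i, n ≤ i → ∀ x, C.side δ (dirStep δ * i) ≠ some (Letter.direct x)

variable (C) in
/-- Far out in the direction `δ`, the word `C` does not pass through `v`. -/
def LeavesAt (δ : Bool) (v : Q) : Prop :=
  ∃ n : ℤ, ∀ i, n ≤ i → dirStep δ * i ∈ C.shape.idx → C.vertex (dirStep δ * i) ≠ some v

theorem eventuallyInverse_iff : C.EventuallyInverse ↔ C.EventuallyInverseAt true := by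
  rw [EventuallyInverse, Int.finite_pos_and_iff]
  constructor
  · rintro ⟨n, hn⟩
    refine ⟨n, fun i hi x hx => hn (i + 1) (by omega) ⟨x, ?_⟩⟩
    simpa [side] using hx
  · rintro ⟨n, hn⟩
    refine ⟨n + 1, fun i hi ⟨x, hx⟩ => hn (i - 1) (by omega) x ?_⟩
    simpa [side] using hx

theorem eventuallyInverse_inv_iff : C.inv.EventuallyInverse ↔ C.EventuallyInverseAt false := by
  rw [EventuallyInverse, Int.finite_pos_and_iff]
  -- Reading `C⁻¹` to the right is walking along `C` to the left.
  have h : ∀ i, C.inv.letter i = C.side false (C.shape.mirror + 1 - i) := fun i => rfl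
  constructor
  · rintro ⟨n, hn⟩
    refine ⟨n - C.shape.mirror - 1, fun i hi x hx =>
      hn (i + C.shape.mirror + 1) (by omega) ⟨x, ?_⟩⟩
    rw [h, ← hx]
    congr 1
    simp only [dirStep_false]; ring
  · rintro ⟨n, hn⟩
    refine ⟨n + C.shape.mirror + 1, fun i hi ⟨x, hx⟩ =>
      hn (i - C.shape.mirror - 1) (by omega) x ?_⟩
    rw [h] at hx
    rw [← hx]
    congr 1
    simp only [dirStep_false]; ring

theorem vertexFinite_iff : C.VertexFinite ↔ ∀ v, C.LeavesAt true v := by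
  refine forall_congr' fun v => ?_
  rw [Int.finite_pos_and_iff]
  simp only [LeavesAt, dirStep_true, one_mul, not_and]

theorem vertexFinite_inv_iff : C.inv.VertexFinite ↔ ∀ v, C.LeavesAt false v := by
  refine forall_congr' fun v => ?_
  rw [Int.finite_pos_and_iff]
  have h1 : ∀ i, i ∈ C.inv.shape.idx ↔ C.shape.mirror - i ∈ C.shape.idx := C.shape.mem_idx_inv
  have h2 : ∀ i, C.inv.vertex i = C.vertex (C.shape.mirror - i) := fun i => by
    have := vertex_inv (C := C) (C.shape.mirror - i)
    rwa [sub_sub_cancel] at this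
  simp only [h1, h2, LeavesAt, dirStep_false, not_and]
  constructor
  · rintro ⟨n, hn⟩
    refine ⟨n - C.shape.mirror, fun i hi => ?_⟩
    have := hn (i + C.shape.mirror) (by omega)
    rwa [show C.shape.mirror - (i + C.shape.mirror) = -1 * i by ring] at this
  · rintro ⟨n, hn⟩
    refine ⟨n + C.shape.mirror, fun i hi => ?_⟩
    have := hn (i - C.shape.mirror) (by omega)
    rwa [show -1 * (i - C.shape.mirror) = C.shape.mirror - i by ring] at this

end Word

/-! ### Finitely generated and finitely controlled string modules -/

namespace StringModule

theorem isUnitalModule (C : Word ρ) : IsUnitalModule k ρ (StringModule k C) :=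
  (coord k C).isUnitalModule

variable (k C) in
/-- The span of the `b_j` up to the position `n` in the direction `δ`. -/
noncomputable def initialPart (δ : Bool) (n : ℤ) : AddSubgroup (StringModule k C) :=
  AddSubgroup.closure {z | ∃ (c : k) (i : ℤ), i ≤ n ∧ z = c • bz k C (dirStep δ * i)}

theorem smul_bz_mem_initialPart {δ : Bool} {n i : ℤ} (h : i ≤ n) (c : k) :
    c • bz k C (dirStep δ * i) ∈ initialPart k C δ n :=
  AddSubgroup.subset_closure ⟨c, i, h, rfl⟩

theorem coeffHom_of_mem_initialPart {δ : Bool} {n i : ℤ} (h : n < i) {z : StringModule k C}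
    (hz : z ∈ initialPart k C δ n) : coeffHom k C (dirStep δ * i) z = 0 := by
  induction hz using AddSubgroup.closure_induction with
  | mem z hz =>
    obtain ⟨c, j, hj, rfl⟩ := hz
    rw [coeffHom_smul, coeffHom_bz_of_ne, mul_zero]
    intro h'
    have : i = j := by cases δ <;> simpa using h'
    omega
  | zero => exact map_zero _
  | add x y _ _ hx hy => rw [map_add, hx, hy, add_zero]
  | neg x _ hx => rw [map_neg, hx, neg_zero]

theorem exists_mem_initialPart (δ : Bool) (z : StringModule k C) :
    ∃ n : ℤ, ∀ m, n ≤ m → z ∈ initialPart k C δ m := by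
  induction z using bz_induction with
  | h0 => exact ⟨0, fun m _ => zero_mem _⟩
  | hadd x y hx hy =>
    obtain ⟨a, ha⟩ := hx
    obtain ⟨b, hb⟩ := hy
    exact ⟨max a b, fun m hm => add_mem (ha m (by omega)) (hb m (by omega))⟩
  | hb c j =>
    refine ⟨dirStep δ * j, fun m hm => ?_⟩
    have := smul_bz_mem_initialPart (k := k) (C := C) (δ := δ) hm c
    rwa [← mul_assoc, dirStep_mul_self, one_mul] at this

/-- The span of the `b_j` in front of a direct letter is a submodule. -/
theorem smul_mem_initialPart {δ : Bool} {n : ℤ} {x : Quiver.Total Q}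
    (h : C.side δ (dirStep δ * n) = some (Letter.direct x)) (r : OneAdjoined k ρ) :
    ∀ z ∈ initialPart k C δ n, r • z ∈ initialPart k C δ n := by
  have key : ∀ s : OneAdjoined k ρ, (∀ i ≤ n, s • bz k C (dirStep δ * i) ∈ initialPart k C δ n ∧
      ∀ c : k, c • s • bz k C (dirStep δ * i) ∈ initialPart k C δ n) →
      ∀ z ∈ initialPart k C δ n, s • z ∈ initialPart k C δ n := by
    intro s hs z hz
    induction hz using AddSubgroup.closure_induction with
    | mem z hz =>
      obtain ⟨c, i, hi, rfl⟩ := hz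
      rw [← inl_smul c, smul_smul_comm_inl, inl_smul]
      exact (hs i hi).2 c
    | zero => rw [smul_zero]; exact zero_mem _
    | add x y _ _ hx hy => rw [smul_add]; exact add_mem hx hy
    | neg x _ hx => rw [smul_neg]; exact neg_mem hx
  refine smul_mem_of_generators _ (fun c => key _ fun i hi => ?_) (fun v => key _ fun i hi => ?_)
    (fun y => key _ fun i hi => ?_) r
  · rw [inl_smul]
    refine ⟨smul_bz_mem_initialPart hi c, fun c' => ?_⟩
    rw [smul_smul]
    exact smul_bz_mem_initialPart hi _
  · by_cases hv : C.vertex (dirStep δ * i) = some v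
    · rw [idem_smul_bz_of_eq hv]
      exact ⟨by simpa using smul_bz_mem_initialPart (k := k) (C := C) (δ := δ) hi 1,
        smul_bz_mem_initialPart hi⟩
    · rw [idem_smul_bz_of_ne hv]
      exact ⟨zero_mem _, fun c => by rw [smul_zero]; exact zero_mem _⟩
  · by_cases hy : ∃ δ', C.side δ' (dirStep δ * i) = some (Letter.inverse y)
    · obtain ⟨δ', hy⟩ := hy
      rw [arrow_smul_bz hy]
      -- The only way out of the span leads from `n` to `n + 1`, along an inverse letter; but the
      -- letter there is direct.
      obtain ⟨j, hj, hji⟩ : ∃ j ≤ n, dirStep δ * i + dirStep δ' = dirStep δ * j := by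
        by_cases hδ : δ' = δ
        · subst hδ
          refine ⟨i + 1, ?_, by ring⟩
          rcases hi.lt_or_eq with hi | rfl
          · omega
          · rw [h] at hy
            cases hy
        · refine ⟨i - 1, by omega, ?_⟩
          rw [Bool.eq_not_of_ne hδ, dirStep_not]
          ring
      rw [hji]
      exact ⟨by simpa using smul_bz_mem_initialPart (k := k) (C := C) (δ := δ) hj 1,
        smul_bz_mem_initialPart hj⟩
    · rw [arrow_smul_bz_zero (not_exists.1 hy)]
      exact ⟨zero_mem _, fun c => by rw [smul_zero]; exact zero_mem _⟩

/-- If `C` has infinitely many direct letters in the direction `δ`, then a finitely generated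
submodule of `M(C)` does not reach arbitrarily far in this direction. -/
theorem exists_coeffHom_eq_zero_of_fg {δ : Bool} (h : ¬ C.EventuallyInverseAt δ)
    {N : Submodule (OneAdjoined k ρ) (StringModule k C)} (hN : N.FG) :
    ∃ n : ℤ, ∀ i, n ≤ i → ∀ z ∈ N, coeffHom k C (dirStep δ * i) z = 0 := by
  obtain ⟨S, rfl⟩ := hN
  choose b hb using exists_mem_initialPart (k := k) (C := C) δ
  obtain ⟨m, hm⟩ : ∃ m : ℤ, ∀ s ∈ S, b s ≤ m := by
    obtain ⟨m, hm⟩ := (S.image b).bddAbove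
    exact ⟨m, fun s hs => hm (by simpa using ⟨s, hs, rfl⟩)⟩
  simp only [Word.EventuallyInverseAt, not_exists, not_forall, not_not] at h
  obtain ⟨n, hn, x, hx⟩ := h m
  -- The part in front of a direct letter that lies beyond all generators.
  let P : Submodule (OneAdjoined k ρ) (StringModule k C) :=
    { initialPart k C δ n with smul_mem' := fun r z => smul_mem_initialPart hx r z }
  have hP : Submodule.span (OneAdjoined k ρ) (S : Set (StringModule k C)) ≤ P :=
    Submodule.span_le.2 fun s hs => hb s n ((hm s hs).trans hn)
  exact ⟨n + 1, fun i hi z hz => coeffHom_of_mem_initialPart (by omega) (hP hz)⟩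

/-- Where `C` has no direct letters in the direction `δ`, the `b_j` are generated by one of
them. -/
theorem bz_mem_of_eventuallyInverse {δ : Bool} {n : ℤ} (hn : 0 ≤ n)
    (h : ∀ i, n ≤ i → ∀ x, C.side δ (dirStep δ * i) ≠ some (Letter.direct x))
    {N : Submodule (OneAdjoined k ρ) (StringModule k C)} (hN : bz k C (dirStep δ * n) ∈ N) (i : ℤ)
    (hi : n ≤ i) : bz k C (dirStep δ * i) ∈ N := by
  induction i, hi using Int.leInduction with
  | base => exact hN
  | succ i hi ih =>
    by_cases h1 : dirStep δ * (i + 1) ∈ C.shape.idx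
    · have h0 : dirStep δ * i ∈ C.shape.idx := by
        cases δ
        · exact C.shape.ordConnected_idx.out h1 C.shape.zero_mem_idx
            ⟨by simp, by simp; omega⟩
        · exact C.shape.ordConnected_idx.out C.shape.zero_mem_idx h1
            ⟨by simp; omega, by simp⟩
      rw [mul_add, mul_one] at h1 ⊢
      obtain ⟨l, hl⟩ := Word.exists_side h0 h1
      cases l with
      | direct x => exact absurd hl (h i hi x)
      -- The arrow of an inverse letter carries `b_i` on to the next basis element.
      | inverse x =>
        rw [← arrow_smul_bz hl]
        exact N.smul_mem _ ih
    · rw [bz_of_notMem h1]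
      exact N.zero_mem

variable (k C) in
/-- The submodule generated by the `b_j` with `|j| ≤ n`. -/
noncomputable def centralPart (n : ℤ) : Submodule (OneAdjoined k ρ) (StringModule k C) :=
  Submodule.span _ (bz k C '' Set.Icc (-n) n)

theorem centralPart_fg (n : ℤ) : (centralPart k C n).FG :=
  Submodule.fg_span ((Set.finite_Icc _ _).image _)

theorem bz_mem_centralPart {n j : ℤ} (h1 : -n ≤ j) (h2 : j ≤ n) : bz k C j ∈ centralPart k C n :=
  Submodule.subset_span ⟨j, ⟨h1, h2⟩, rfl⟩

theorem exists_dirStep_mul_eq {n j : ℤ} (h : ¬ (-n ≤ j ∧ j ≤ n)) :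
    ∃ δ i, n ≤ i ∧ j = dirStep δ * i := by
  by_cases hj : j ≤ n
  · exact ⟨false, -j, by omega, by simp⟩
  · exact ⟨true, j, by omega, by simp⟩

theorem bz_mem_centralPart_of_eventuallyInverse {δ : Bool} {n : ℤ} (hn : 0 ≤ n)
    (h : ∀ i, n ≤ i → ∀ x, C.side δ (dirStep δ * i) ≠ some (Letter.direct x)) {i : ℤ}
    (hi : n ≤ i) : bz k C (dirStep δ * i) ∈ centralPart k C n :=
  bz_mem_of_eventuallyInverse hn h
    (bz_mem_centralPart (by cases δ <;> simp; omega) (by cases δ <;> simp; omega)) i hi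

/-- The string module `M(C)` is finitely generated if and only if `C` is eventually inverse in
both directions. -/
theorem isFinitelyGenerated_iff (C : Word ρ) : IsFinitelyGenerated k ρ (StringModule k C) ↔
    ∀ δ, C.EventuallyInverseAt δ := by
  rw [(isUnitalModule C).isFinitelyGenerated_iff, Module.finite_def]
  constructor
  · intro h δ
    by_contra hδ
    obtain ⟨n, hn⟩ := exists_coeffHom_eq_zero_of_fg hδ h
    simp only [Word.EventuallyInverseAt, not_exists, not_forall, not_not] at hδ
    -- A direct letter beyond the bound `n` also provides a basis element there, which lies in the
    -- whole module.
    obtain ⟨i, hi, x, hx⟩ := hδ n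
    have := hn i hi (bz k C (dirStep δ * i)) trivial
    rw [coeffHom_bz_self (Word.mem_of_side hx).1] at this
    exact one_ne_zero this
  · intro h
    choose m hm using h
    -- Nonnegativity puts the boundary positions `n` and `-n` into the range of the generators.
    let n := max 0 (max (m true) (m false))
    have hmn : ∀ δ, m δ ≤ n := fun δ => by cases δ <;> simp [n]
    have hn : 0 ≤ n := le_max_left _ _
    have htop : centralPart k C n = ⊤ := by
      refine eq_top_iff.2 fun z _ => ?_
      induction z using bz_induction with
      | h0 => exact zero_mem _
      | hadd x y hx hy => exact add_mem (hx trivial) (hy trivial)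
      | hb c j =>
        rw [← inl_smul]
        refine Submodule.smul_mem _ _ ?_
        by_cases hj : -n ≤ j ∧ j ≤ n
        · exact bz_mem_centralPart hj.1 hj.2
        · obtain ⟨δ, i, hi, rfl⟩ := exists_dirStep_mul_eq hj
          exact bz_mem_centralPart_of_eventuallyInverse hn
            (fun i hi => hm δ i ((hmn δ).trans hi)) hi
    rw [← htop]
    exact centralPart_fg n

/-- The string module `M(C)` is finitely controlled if and only if, in both directions, `C` is
eventually inverse or leaves every vertex. -/
theorem isFinitelyControlled_iff (C : Word ρ) : IsFinitelyControlled k ρ (StringModule k C) ↔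
    ∀ δ, C.EventuallyInverseAt δ ∨ ∀ v, C.LeavesAt δ v := by
  rw [(isUnitalModule C).isFinitelyControlled_iff]
  constructor
  · intro h δ
    by_contra! hδ
    obtain ⟨hδ, v, hv⟩ := hδ
    obtain ⟨N, hN, hvN⟩ := h v
    obtain ⟨n, hn⟩ := exists_coeffHom_eq_zero_of_fg hδ hN
    simp only [Word.LeavesAt, not_exists, not_forall, not_not] at hv
    obtain ⟨i, hi, hmem, hvi⟩ := hv n
    -- This `b_i` belongs to `e_v M`, hence to `N`, although it lies beyond the bound for `N`.
    have h1 := hvN (bz k C (dirStep δ * i))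
    rw [idem_smul_bz_of_eq hvi] at h1
    have := hn i hi _ h1
    rw [coeffHom_bz_self hmem] at this
    exact one_ne_zero this
  · intro h v
    -- For a fixed `v`, either alternative gives a bound: beyond it the `b_j` are generated from the
    -- bound, or none of them is at `v`.
    have h' : ∀ δ, ∃ m : ℤ, (∀ i, m ≤ i → ∀ x,
        C.side δ (dirStep δ * i) ≠ some (Letter.direct x)) ∨
        ∀ i, m ≤ i → dirStep δ * i ∈ C.shape.idx → C.vertex (dirStep δ * i) ≠ some v := by
      intro δ
      rcases h δ with ⟨m, hm⟩ | h
      · exact ⟨m, Or.inl hm⟩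
      · obtain ⟨m, hm⟩ := h v
        exact ⟨m, Or.inr hm⟩
    choose m hm using h'
    let n := max 0 (max (m true) (m false))
    have hmn : ∀ δ, m δ ≤ n := fun δ => by cases δ <;> simp [n]
    have hn : 0 ≤ n := le_max_left _ _
    refine ⟨centralPart k C n, centralPart_fg n, fun z => ?_⟩
    induction z using bz_induction with
    | h0 => rw [smul_zero]; exact zero_mem _
    | hadd x y hx hy => rw [smul_add]; exact add_mem hx hy
    | hb c j =>
      rw [← inl_smul, smul_smul_comm_inl]
      refine Submodule.smul_mem _ _ ?_
      by_cases hv : C.vertex j = some v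
      · rw [idem_smul_bz_of_eq hv]
        by_cases hj : -n ≤ j ∧ j ≤ n
        · exact bz_mem_centralPart hj.1 hj.2
        · obtain ⟨δ, i, hi, rfl⟩ := exists_dirStep_mul_eq hj
          rcases hm δ with hm | hm
          · exact bz_mem_centralPart_of_eventuallyInverse hn
              (fun i hi => hm i ((hmn δ).trans hi)) hi
          · rw [bz_of_notMem fun hmem => hm i ((hmn δ).trans hi) hmem hv]
            exact zero_mem _
      · rw [idem_smul_bz_of_ne hv]
        exact zero_mem _

end StringModule

/-! ### Band modules and direct sums -/

/-- The elements `b_i ⊗ v`, for `i` in one period and `v` in a finite spanning set of `V`, generate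
already over the scalars. -/
theorem BandModule.moduleFinite (hC : C.IsPeriodic) (V : Type*) [AddCommGroup V]
    [Module k[T;T⁻¹] V] [Module.Finite k (RestrictScalars k k[T;T⁻¹] V)] :
    Module.Finite (OneAdjoined k ρ) (BandModule k hC V) := by
  classical
  obtain ⟨S, hS⟩ := Module.Finite.fg_top (R := k) (M := RestrictScalars k k[T;T⁻¹] V)
  let G : Set (BandModule k hC V) := Set.image2 (fun (i : ℤ) (v : V) => BandModule.incl hC i v)
    (Finset.Ico (0 : ℤ) C.period) (show Set V from (S : Set (RestrictScalars k k[T;T⁻¹] V)))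
  have hG : G.Finite := Set.Finite.image2 _ (Finset.finite_toSet _) (Finset.finite_toSet S)
  have hmem : ∀ i ∈ Finset.Ico (0 : ℤ) C.period, ∀ v : V,
      BandModule.incl hC i v ∈ Submodule.span (OneAdjoined k ρ) G := by
    intro i hi
    suffices h : ∀ v : RestrictScalars k k[T;T⁻¹] V,
        v ∈ Submodule.span k (S : Set (RestrictScalars k k[T;T⁻¹] V)) →
        BandModule.incl hC i (show V from v) ∈ Submodule.span (OneAdjoined k ρ) G from
      fun v => h v (hS ▸ Submodule.mem_top)
    intro v hv
    induction hv using Submodule.span_induction with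
    | mem v hv => exact Submodule.subset_span ⟨i, hi, v, hv, rfl⟩
    | zero => exact (map_zero (BandModule.incl (k := k) (V := V) hC i)).symm ▸ zero_mem _
    | add v w _ _ hv hw =>
      exact (map_add (BandModule.incl (k := k) (V := V) hC i) v w).symm ▸ add_mem hv hw
    | smul c v _ hv =>
      have h := BandModule.inl_smul_incl (ρ := ρ) (V := V) hC c i v
      exact h ▸ Submodule.smul_mem _ _ hv
  refine ⟨⟨hG.toFinset, eq_top_iff.2 fun z _ => ?_⟩⟩
  rw [Set.Finite.coe_toFinset, ← BandModule.sum_incl_proj hC z]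
  exact Submodule.sum_mem _ fun i hi => hmem i hi _

section DirectSum

variable {R ι : Type*} [Ring R] {N : ι → Type*} [∀ i, AddCommGroup (N i)] [∀ i, Module R (N i)]

/-- A finitely generated submodule of a direct sum involves only finitely many summands. -/
theorem DirectSum.exists_finset_of_fg {P : Submodule R (⨁ i, N i)} (hP : P.FG) :
    ∃ F : Finset ι, ∀ z ∈ P, ∀ i ∉ F, z i = 0 := by
  classical
  obtain ⟨S, rfl⟩ := hP
  refine ⟨S.biUnion fun s => DFinsupp.support s, fun z hz i hi => ?_⟩
  have h : Submodule.span R (S : Set (⨁ i, N i)) ≤ LinearMap.ker (DirectSum.component R ι N i) := by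
    refine Submodule.span_le.2 fun s hs => ?_
    by_contra hne
    exact hi (Finset.mem_biUnion.2 ⟨s, hs, DFinsupp.mem_support_iff.2 hne⟩)
  exact h hz

/-- Summands are quotients. The generators have finite total support, and every index occurs in it
because the summands are nonzero. -/
theorem DirectSum.moduleFinite_iff [∀ i, Nontrivial (N i)] :
    Module.Finite R (⨁ i, N i) ↔ (∀ i, Module.Finite R (N i)) ∧ Finite ι := by
  classical
  constructor
  · intro h
    refine ⟨fun i => Module.Finite.of_surjective (DirectSum.component R ι N i) fun z =>
      ⟨DirectSum.lof R ι N i z, DirectSum.component.lof_self R i z⟩, ?_⟩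
    obtain ⟨F, hF⟩ := DirectSum.exists_finset_of_fg h.fg_top
    refine Set.finite_univ_iff.1 (F.finite_toSet.subset fun i _ => ?_)
    by_contra hi
    obtain ⟨z, hz⟩ := exists_ne (0 : N i)
    have := hF (DirectSum.lof R ι N i z) trivial i hi
    exact hz ((DirectSum.component.lof_self R i z).symm.trans this)
  · rintro ⟨h, hι⟩
    have := Fintype.ofFinite ι
    exact Module.Finite.equiv (DirectSum.linearEquivFunOnFintype R ι N).symm

end DirectSum

section FinitelyControlled

variable {ι : Type*} {N : ι → Type*} [∀ i, AddCommGroup (N i)]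
  [∀ i, Module (OneAdjoined k ρ) (N i)]

/-- A finitely generated submodule containing `e_v` of the sum involves finitely many summands, and
these include all that are supported at `v`. Conversely, control of those finitely many summands
controls the sum at `v`. -/
theorem isFinitelyControlled_directSum_iff (hN : ∀ i, IsUnitalModule k ρ (N i)) :
    IsFinitelyControlled k ρ (⨁ i, N i) ↔
      (∀ i, IsFinitelyControlled k ρ (N i)) ∧ ∀ v : Q, {i | IsSupportedAt k ρ (N i) v}.Finite := by
  classical
  rw [(IsUnitalModule.directSum hN).isFinitelyControlled_iff]
  constructor
  · intro h
    refine ⟨fun i => (hN i).isFinitelyControlled_iff.2 fun v => ?_, fun v => ?_⟩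
    · obtain ⟨P, hP, hv⟩ := h v
      refine ⟨P.map (DirectSum.component (OneAdjoined k ρ) ι N i), hP.map _, fun m =>
        ⟨_, hv (DirectSum.lof (OneAdjoined k ρ) ι N i m), ?_⟩⟩
      rw [map_smul, DirectSum.component.lof_self]
    · obtain ⟨P, hP, hv⟩ := h v
      obtain ⟨F, hF⟩ := DirectSum.exists_finset_of_fg hP
      refine F.finite_toSet.subset fun i ⟨m, hm⟩ => ?_
      by_contra hi
      refine hm ?_
      have h1 := hF _ (hv (DirectSum.lof (OneAdjoined k ρ) ι N i m)) i hi
      rw [← map_smul] at h1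
      exact (DirectSum.component.lof_self (OneAdjoined k ρ) i _).symm.trans h1
  · rintro ⟨h, hfin⟩ v
    choose P hP hv using fun i => (hN i).isFinitelyControlled_iff.1 (h i) v
    refine ⟨⨆ i ∈ (hfin v).toFinset, (P i).map (DirectSum.lof (OneAdjoined k ρ) ι N i),
      Submodule.fg_biSup _ _ fun i _ => (hP i).map _, fun z => ?_⟩
    induction z using DirectSum.induction_on with
    | zero => rw [smul_zero]; exact zero_mem _
    | add x y hx hy => rw [smul_add]; exact add_mem hx hy
    | of i m =>
      rw [← DirectSum.lof_eq_of (OneAdjoined k ρ), ← map_smul]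
      by_cases hi : IsSupportedAt k ρ (N i) v
      · exact Submodule.mem_iSup_of_mem i (Submodule.mem_iSup_of_mem
          ((Set.Finite.mem_toFinset _).2 hi) ⟨_, hv i m, rfl⟩)
      · have h0 : (idem k ρ v : OneAdjoined k ρ) • m = 0 := by
          by_contra h0
          exact hi ⟨m, h0⟩
        rw [h0, map_zero]
        exact zero_mem _

end FinitelyControlled

theorem Module.Finite.isFinitelyControlled {M : Type*} [AddCommGroup M]
    [Module (OneAdjoined k ρ) M] [h : Module.Finite (OneAdjoined k ρ) M]
    (hM : IsUnitalModule k ρ M) : IsFinitelyControlled k ρ M :=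
  hM.isFinitelyControlled_iff.2 fun _ => ⟨⊤, h.fg_top, fun _ => trivial⟩

section Summands

variable {M : Type*} [AddCommGroup M] [Module (OneAdjoined k ρ) M]

theorem IsStringModule.isUnitalModule (h : IsStringModule k ρ M) : IsUnitalModule k ρ M := by
  obtain ⟨C, ⟨e⟩⟩ := h
  exact (StringModule.isUnitalModule C).of_equiv e.symm

theorem IsStringModule.nontrivial (h : IsStringModule k ρ M) : Nontrivial M := by
  obtain ⟨C, ⟨e⟩⟩ := h
  have := (StringModule.coord k C).nontrivial
  exact e.toEquiv.nontrivial

theorem IsBandModule.isUnitalModule (h : IsBandModule k ρ M) : IsUnitalModule k ρ M := by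
  obtain ⟨C, hC, V, _, _, -, ⟨e⟩⟩ := h
  exact (BandModule.coord hC V).isUnitalModule.of_equiv e.symm

theorem IsBandModule.nontrivial (h : IsBandModule k ρ M) : Nontrivial M := by
  obtain ⟨C, hC, V, _, _, hV, ⟨e⟩⟩ := h
  have := hV.2.1
  have := (BandModule.coord (k := k) hC V).nontrivial
  exact e.toEquiv.nontrivial

theorem IsBandModule.moduleFinite (h : IsBandModule k ρ M) :
    Module.Finite (OneAdjoined k ρ) M := by
  obtain ⟨C, hC, V, _, _, hV, ⟨e⟩⟩ := h
  have := hV.1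
  have := BandModule.moduleFinite (k := k) (ρ := ρ) hC V
  exact Module.Finite.equiv e.symm

end Summands

end Finiteness

/-! ### The theorem -/

theorem theoremt {k : Type*} [Field k] {Q : Type*} [Quiver Q] (ρ : Set (QPath Q))
    (hρ : IsStringAlgebra ρ) :
    -- (i) string and band modules are indecomposable
    ((∀ C : Word ρ, IsIndecomposableModule (OneAdjoined k ρ) (StringModule k C)) ∧
      (∀ (C : Word ρ) (hC : C.IsPeriodic) (V : Type*) [AddCommGroup V] [Module k[T;T⁻¹] V],
        IsBandCoefficient k V →
          IsIndecomposableModule (OneAdjoined k ρ) (BandModule k hC V))) ∧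
    -- (ii) the isomorphisms between string and band modules
    ((∀ C D : Word ρ,
        Nonempty (StringModule k C ≃ₗ[OneAdjoined k ρ] StringModule k D) ↔ C.Equivalent D) ∧
      (∀ (C D : Word ρ) (hC : C.IsPeriodic) (hD : D.IsPeriodic)
        (V : Type*) [AddCommGroup V] [Module k[T;T⁻¹] V]
        (U : Type*) [AddCommGroup U] [Module k[T;T⁻¹] U],
        IsBandCoefficient k V → IsBandCoefficient k U →
          (Nonempty (BandModule k hC V ≃ₗ[OneAdjoined k ρ] BandModule k hD U) ↔
            ((∃ n : ℤ, D = C.shift n) ∧ Nonempty (U ≃ₗ[k[T;T⁻¹]] V)) ∨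
            ((∃ n : ℤ, D = C.inv.shift n) ∧ Nonempty (U ≃ₗ[k[T;T⁻¹]] InvModule V)))) ∧
      (∀ (C D : Word ρ) (hD : D.IsPeriodic)
        (U : Type*) [AddCommGroup U] [Module k[T;T⁻¹] U],
        IsBandCoefficient k U →
          IsEmpty (StringModule k C ≃ₗ[OneAdjoined k ρ] BandModule k hD U))) ∧
    -- (iii) finiteness conditions for string modules
    (∀ C : Word ρ,
      (IsFinitelyGenerated k ρ (StringModule k C) ↔
        C.EventuallyInverse ∧ C.inv.EventuallyInverse) ∧
      (IsFinitelyControlled k ρ (StringModule k C) ↔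
        (C.EventuallyInverse ∨ C.VertexFinite) ∧
          (C.inv.EventuallyInverse ∨ C.inv.VertexFinite))) ∧
    -- (iv) finiteness conditions for direct sums of string and band modules
    (∀ (ι : Type*) (N : ι → Type*) [∀ i, AddCommGroup (N i)]
      [∀ i, Module (OneAdjoined k ρ) (N i)],
      (∀ i, IsStringModule k ρ (N i) ∨ IsBandModule k ρ (N i)) →
        (IsFinitelyGenerated k ρ (⨁ i, N i) ↔
          (∀ i, IsStringModule k ρ (N i) → IsFinitelyGenerated k ρ (N i)) ∧ Finite ι) ∧
        (IsFinitelyControlled k ρ (⨁ i, N i) ↔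
          (∀ i, IsStringModule k ρ (N i) → IsFinitelyControlled k ρ (N i)) ∧
            ∀ v : Q, {i | IsSupportedAt k ρ (N i) v}.Finite)) := by
  obtain ⟨σ, hσ⟩ := hρ.exists_isLetterSign
  refine ⟨⟨StringModule.isIndecomposableModule hσ, fun C hC V _ _ hV =>
      BandModule.isIndecomposableModule hC hσ hV.2⟩,
    ⟨StringModule.nonempty_linearEquiv_iff hσ, fun C D hC hD V _ _ U _ _ hV _ =>
      BandModule.nonempty_linearEquiv_iff hσ hC hD V U hV.2.1,
      fun C D hD U _ _ hU => StringModule.isEmpty_linearEquiv_bandModule hσ C D hD U hU⟩,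
    fun C => ⟨?_, ?_⟩, fun ι N _ _ hN => ?_⟩
  · rw [StringModule.isFinitelyGenerated_iff, Bool.forall_bool, Word.eventuallyInverse_iff,
      Word.eventuallyInverse_inv_iff, and_comm]
  · rw [StringModule.isFinitelyControlled_iff, Bool.forall_bool, Word.eventuallyInverse_iff,
      Word.eventuallyInverse_inv_iff, Word.vertexFinite_iff, Word.vertexFinite_inv_iff, and_comm]
  · have hunit : ∀ i, IsUnitalModule k ρ (N i) := fun i =>
      (hN i).elim IsStringModule.isUnitalModule IsBandModule.isUnitalModule
    have hnt : ∀ i, Nontrivial (N i) := fun i =>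
      (hN i).elim IsStringModule.nontrivial IsBandModule.nontrivial
    refine ⟨?_, ?_⟩
    · rw [(IsUnitalModule.directSum hunit).isFinitelyGenerated_iff, DirectSum.moduleFinite_iff]
      refine and_congr_left fun _ => forall_congr' fun i => ?_
      rw [(hunit i).isFinitelyGenerated_iff]
      -- Band modules are finitely generated, so only the string summands impose a condition.
      exact ⟨fun h _ => h, fun h => (hN i).elim h IsBandModule.moduleFinite⟩
    · rw [isFinitelyControlled_directSum_iff hunit]
      refine and_congr_left fun _ => forall_congr' fun i => ?_
      refine ⟨fun h _ => h, fun h => (hN i).elim h fun hb => ?_⟩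
      have := hb.moduleFinite
      exact Module.Finite.isFinitelyControlled (hunit i)
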